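/- Let $M$ be a smooth $n$-dimensional manifold (Hausdorff, second countable, without boundary), let $E\to M$ and $F\to M$ be smooth real vector bundles of finite ranks $d$ and $d'$, and fix a torsion-free connection $\hat\nabla$ on $TM$ and connections $\nabla$ on $E$ and on $F$. For $\omega\in C^\infty(\wedge^k(E^*))$ let $\nabla^j_{X_1,\dots,X_j}\omega$ be the $j$-th covariant derivative, given by $\nabla^0\omega=\omega$ and $$\nabla^{j+1}_{X_0,\dots,X_j}\omega=\nabla_{X_0}\bigl(\nabla^{j}_{X_1,\dots,X_j}\omega\bigr)-\sum_{i=1}^{j}\nabla^{j}_{X_1,\dots,\hat\nabla_{X_0}X_i,\dots,X_j}\omega .$$ For $p\in M$ and $r,k\ge 0$ let $\mathcal U_k^r(E;p)$ be the space of linear functionals on $C^\infty(\wedge^k(E^*))$ spanned by $\omega\mapsto(\nabla^j_{X_1,\dots,X_j}\omega)_p(\alpha)$ with $0\le j\le r$, $X_1,\dots,X_j$ smooth vector fields and $\alpha\in\wedge^k(E_p)$. These spaces are the fibres of a smooth vector bundle $\mathcal U_k^r(E)\to M$, for which coordinates $x$ on an open set of $M$ together with a trivialization of $E$ over it give the local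 frame $\omega\mapsto(\partial_I\omega_K)(p)$, where $I$ runs through the nondecreasing words of length at most $r$ in $\{1,\dots,n\}$, $K$ through the $k$-element subsets of $\{1,\dots,d\}$, and $\omega_K$ is the $K$-th component of $\omega$. For $f\in C^\infty(M)$ and $T\in\mathcal U_k^r(E;p)$ let $(f\lrcorner T)(\omega):=T(f\omega)$. 1. The operation $f\lrcorner$, applied pointwise, makes $C^\infty(\mathcal U_k^r(E))$ into a $C^\infty(M)$-module, and this module is finitely generated and projective. 2. Let $r,k,s,j\ge 0$. For smooth bundle homomorphisms $\mathcal H:\mathcal U_k^r(E)\to\mathcal U_j^s(F)$ covering the identity, each of the two actions $f\cdot\mathcal H=\mathcal H\circ(f\lrcorner)$ and $f\cdot\mathcal H=(f\lrcorner)\circ\mathcal H$ makes $C^\infty(\mathrm{Hom}(\mathcal U_k^r(E),\mathcal U_j^s(F)))$ into a $C^\infty(M)$-module, and for each of them this module is finitely generated and projective. 3. Call $\mathcal H$ as in 2 consistent if, with $\mathcal H^*:C^\infty(\wedge^j(F^*))\to C^\infty(\wedge^k(E^*))$ defined by $(\mathcal H^*\theta)_p(\alpha)=\mathcal H(\alpha)(\theta)$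 for $\alpha\in\wedge^k(E_p)\cong\mathcal U_k^0(E;p)$, one has $\mathcal H(S)(\theta)=S(\mathcal H^*\theta)$ for all $p\in M$, $S\in\mathcal U_k^r(E;p)$ and $\theta\in C^\infty(\wedge^j(F^*))$. For each of the two module structures of 2, the consistent homomorphisms form a sub-bundle in the module sense, that is, a $C^\infty(M)$-submodule which is a direct summand of $C^\infty(\mathrm{Hom}(\mathcal U_k^r(E),\mathcal U_j^s(F)))$. -/

import Mathlib

open Bundle Module
open scoped Manifold ContDiff

noncomputable section

namespace UBundle

set_option linter.unusedSectionVars false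

/-- `ℝⁿ` with its Euclidean norm. -/
abbrev Rn (n : ℕ) : Type := EuclideanSpace ℝ (Fin n)

/-- The ring `C^∞(M)`. -/
abbrev Fn (n : ℕ) (M : Type*) [TopologicalSpace M] [ChartedSpace (Rn n) M] : Type _ :=
  C^∞⟮𝓡 n, M; 𝓘(ℝ), ℝ⟯

/-- Smooth vector fields on `M`. -/
abbrev VF (n : ℕ) (M : Type*) [TopologicalSpace M] [ChartedSpace (Rn n) M]
    [IsManifold (𝓡 n) ∞ M] : Type _ :=
  Cₛ^∞⟮𝓡 n; Rn n, (TangentSpace (𝓡 n) : M → Type _)⟯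

section Derivatives

variable {n : ℕ} {M : Type*} [TopologicalSpace M] [ChartedSpace (Rn n) M] [IsManifold (𝓡 n) ∞ M]

theorem contMDiff_lie (X : VF n M) (f : Fn n M) :
    ContMDiff (𝓡 n) 𝓘(ℝ) ∞ (fun p => mvfderiv (𝓡 n) f p (X p)) := by
  have h1 : ContMDiff (𝓡 n).tangent 𝓘(ℝ).tangent ∞ (tangentMap (𝓡 n) 𝓘(ℝ) f) :=
    f.contMDiff.contMDiff_tangentMap (m := ∞) (by simp)
  have h2 := h1.comp X.contMDiff
  intro p
  have h3 := ((contMDiffAt_totalSpace (F := ℝ) (E := TangentSpace 𝓘(ℝ, ℝ))).1 (h2 p)).2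
  simp only [mfld_simps, Function.comp_def] at h3
  exact h3

theorem mdiffAt (f : Fn n M) (p : M) : MDifferentiableAt (𝓡 n) 𝓘(ℝ) f p :=
  f.contMDiff.mdifferentiableAt (by simp)

/-- The derivative `f ↦ X f` of smooth functions along a vector field. -/
def lie (X : VF n M) : Fn n M →ₗ[ℝ] Fn n M where
  toFun f := ⟨fun p => mvfderiv (𝓡 n) f p (X p), contMDiff_lie X f⟩
  map_add' f g := by
    ext p
    change mvfderiv (𝓡 n) (⇑f + ⇑g) p (X p) = mvfderiv (𝓡 n) f p (X p) + mvfderiv (𝓡 n) g p (X p)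
    rw [mvfderiv_add (mdiffAt f p) (mdiffAt g p)]
    rfl
  map_smul' c f := by
    ext p
    change mvfderiv (𝓡 n) ((fun _ : M => c) • ⇑f) p (X p) = c * mvfderiv (𝓡 n) f p (X p)
    rw [mvfderiv_smul mdifferentiableAt_const (mdiffAt f p), mvfderiv_const]
    simp

theorem lie_mul (X : VF n M) (f g : Fn n M) : lie X (f * g) = lie X f * g + f * lie X g := by
  ext p
  change mvfderiv (𝓡 n) (⇑f * ⇑g) p (X p) =
    mvfderiv (𝓡 n) f p (X p) * g p + f p * mvfderiv (𝓡 n) g p (X p)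
  rw [mvfderiv_mul (mdiffAt f p) (mdiffAt g p)]
  simp
  ring

/-- Evaluation of smooth functions at a point. -/
def evalAt (p : M) : Fn n M →ₗ[ℝ] ℝ where
  toFun f := f p
  map_add' _ _ := rfl
  map_smul' _ _ := rfl

end Derivatives

section OneBundle

variable {n : ℕ} {M : Type*} [TopologicalSpace M] [ChartedSpace (Rn n) M] [IsManifold (𝓡 n) ∞ M]
  {d : ℕ} {E : M → Type*} [TopologicalSpace (TotalSpace (Rn d) E)]
  [∀ x, AddCommGroup (E x)] [∀ x, Module ℝ (E x)] [∀ x, TopologicalSpace (E x)]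
  [∀ x, IsTopologicalAddGroup (E x)] [∀ x, ContinuousSMul ℝ (E x)]
  [FiberBundle (Rn d) E] [VectorBundle ℝ (Rn d) E]

/-- The section `∇_X s`. -/
def cov (D : CovariantDerivative (𝓡 n) (Rn d) E) [hD : D.ContMDiffCovariantDerivative ∞]
    (X : VF n M) (s : Cₛ^∞⟮𝓡 n; Rn d, E⟯) : Cₛ^∞⟮𝓡 n; Rn d, E⟯ where
  toFun p := D s p (X p)
  contMDiff_toFun := by
    have h := hD.contMDiff.contMDiff (σ := s) (by simpa using s.contMDiff.contMDiffOn)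
    rw [contMDiffOn_univ] at h
    exact h.clm_bundle_apply X.contMDiff

variable (n d E) in
/-- The space `C^∞(⋀ᵏ(E*))` of smooth sections, an element of `⋀ᵏ(E_p*)` being identified with an
alternating `k`-linear form on `E_p` by the determinant pairing. Smoothness means that the
components in the local trivializations of `E` are smooth. -/
def Form (k : ℕ) : Submodule ℝ (∀ p : M, E p [⋀^Fin k]→ₗ[ℝ] ℝ) where
  carrier := {η | ∀ (p₀ : M) (v : Fin k → Rn d),
    ContMDiffOn (𝓡 n) 𝓘(ℝ) ∞
      (fun p => η p fun i => (trivializationAt (Rn d) E p₀).symm p (v i))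
      (trivializationAt (Rn d) E p₀).baseSet}
  add_mem' := by
    intro η θ hη hθ p₀ v
    exact (hη p₀ v).add (hθ p₀ v)
  zero_mem' := by
    intro p₀ v
    exact contMDiffOn_const
  smul_mem' := by
    intro c η hη p₀ v
    exact contMDiffOn_const.mul (hη p₀ v)

/-- Multiplication of a section of `⋀ᵏ(E*)` by a smooth function. -/
def mulForm {k : ℕ} (f : Fn n M) : Form n d E k →ₗ[ℝ] Form n d E k where
  toFun η := ⟨fun p => f p • η.1 p, fun p₀ v => f.contMDiff.contMDiffOn.mul (η.2 p₀ v)⟩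
  map_add' η θ := by
    ext p v
    exact mul_add _ _ _
  map_smul' c η := by
    ext p v
    exact mul_left_comm _ _ _

variable [ContMDiffVectorBundle ∞ (Rn d) E (𝓡 n)]

theorem contMDiff_apply {k : ℕ} (s : Fin k → Cₛ^∞⟮𝓡 n; Rn d, E⟯) (η : Form n d E k) :
    ContMDiff (𝓡 n) 𝓘(ℝ) ∞ (fun p => η.1 p fun i => s i p) := by
  intro p₀
  let e := trivializationAt (Rn d) E p₀
  let b := (EuclideanSpace.basisFun (Fin d) ℝ).toBasis
  have hp₀ : p₀ ∈ e.baseSet := FiberBundle.mem_baseSet_trivializationAt' p₀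
  have ho : e.baseSet ∈ nhds p₀ := e.open_baseSet.mem_nhds hp₀
  have key : ∀ p ∈ e.baseSet, (η.1 p fun i => s i p) =
      ∑ K : Fin k → Fin d, (∏ i, e.localFrameCoeff (𝓡 n) b (K i) p (s i p)) *
        η.1 p (fun i => e.symm p (b (K i))) := by
    intro p hp
    have h1 : ∀ i, s i p = ∑ m, e.localFrameCoeff (𝓡 n) b m p (s i p) • e.symm p (b m) := by
      intro i
      have := e.eq_sum_localFrameCoeff_smul (I := 𝓡 n) (b := b) (s := fun x => s i x) hp
      refine this.trans (Finset.sum_congr rfl fun m _ => ?_)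
      rw [e.localFrame_apply_of_mem_baseSet b hp]
      simp [Trivialization.basisAt]
    have h2 : (fun i => s i p) =
        fun i => ∑ m, e.localFrameCoeff (𝓡 n) b m p (s i p) • e.symm p (b m) := funext h1
    conv_lhs => rw [h2]
    have h3 := (η.1 p).toMultilinearMap.map_sum
      (fun i m => e.localFrameCoeff (𝓡 n) b m p (s i p) • e.symm p (b m))
    refine h3.trans (Finset.sum_congr rfl fun K _ => ?_)
    exact (η.1 p).toMultilinearMap.map_smul_univ _ _
  have hsm : ContMDiffAt (𝓡 n) 𝓘(ℝ) ∞ (fun p =>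
      ∑ K : Fin k → Fin d, (∏ i, e.localFrameCoeff (𝓡 n) b (K i) p (s i p)) *
        η.1 p (fun i => e.symm p (b (K i)))) p₀ := by
    refine ContMDiffAt.sum fun K _ => ContMDiffAt.mul ?_ ((η.2 p₀ _).contMDiffAt ho)
    refine contMDiffAt_finsetProd fun i _ => ?_
    exact contMDiffAt_localFrameCoeff (e := e) b hp₀ (s i).contMDiff.contMDiffAt (K i)
  exact hsm.congr_of_eventuallyEq (Filter.eventually_of_mem ho key)

/-- The pairing `η ↦ η(s₁, …, s_k)` with sections of `E`. -/
def pair {k : ℕ} (s : Fin k → Cₛ^∞⟮𝓡 n; Rn d, E⟯) : Form n d E k →ₗ[ℝ] Fn n M where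
  toFun η := ⟨fun p => η.1 p fun i => s i p, contMDiff_apply s η⟩
  map_add' _ _ := rfl
  map_smul' _ _ := rfl

variable (D₀ : CovariantDerivative (𝓡 n) (Rn n) (TangentSpace (𝓡 n) : M → Type _))
  [D₀.ContMDiffCovariantDerivative ∞]
  (D : CovariantDerivative (𝓡 n) (Rn d) E) [D.ContMDiffCovariantDerivative ∞]

/-- `higherCov D₀ D j X s η` is the function `(∇ʲ_{X₁,…,X_j} η)(s₁,…,s_k)`, the pairing of the
`j`-th covariant derivative of `η ∈ C^∞(⋀ᵏ(E*))` with `s₁ ∧ … ∧ s_k`. Here `D` is the connection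
`∇` of `E` and `D₀` the connection `∇̂` of `TM`. The recursion is
`∇ʲ⁺¹_{X₀,…,X_j} η = ∇_{X₀}(∇ʲ_{X₁,…,X_j} η) - ∑ᵢ ∇ʲ_{X₁,…,∇̂_{X₀}Xᵢ,…,X_j} η`,
with the induced connection on forms,
`(∇_X θ)(s₁,…,s_k) = X(θ(s₁,…,s_k)) - ∑ₗ θ(s₁,…,∇_X sₗ,…,s_k)`. -/
def higherCov {k : ℕ} : (j : ℕ) → (Fin j → VF n M) → (Fin k → Cₛ^∞⟮𝓡 n; Rn d, E⟯) →
    (Form n d E k →ₗ[ℝ] Fn n M)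
  | 0, _, s => pair s
  | j + 1, X, s =>
      lie (X 0) ∘ₗ higherCov j (Fin.tail X) s
        - ∑ l : Fin k, higherCov j (Fin.tail X) (Function.update s l (cov D (X 0) (s l)))
        - ∑ i : Fin j,
            higherCov j (Function.update (Fin.tail X) i (cov D₀ (X 0) (Fin.tail X i))) s

/-- The functional `η ↦ (∇ʲ_{X₁,…,X_j} η)_p(s₁ ∧ … ∧ s_k)`, that is, the image of
`(X₁(p) ⊗ … ⊗ X_j(p)) ⊠ (s₁(p) ∧ … ∧ s_k(p))` under `Φ_p`. -/
def Phi {k : ℕ} (p : M) (j : ℕ) (X : Fin j → VF n M) (s : Fin k → Cₛ^∞⟮𝓡 n; Rn d, E⟯) :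
    Form n d E k →ₗ[ℝ] ℝ :=
  evalAt p ∘ₗ higherCov D₀ D j X s

/-- The fibre `𝒰_k^r(E; p)`: the image of `⊗^{≤ r}(T_pM) ⊠ ⋀ᵏ(E_p)` under `Φ_p`. -/
def U (r k : ℕ) (p : M) : Submodule ℝ (Form n d E k →ₗ[ℝ] ℝ) :=
  Submodule.span ℝ {T | ∃ j ≤ r, ∃ (X : Fin j → VF n M) (s : Fin k → Cₛ^∞⟮𝓡 n; Rn d, E⟯),
    T = Phi D₀ D p j X s}

theorem Phi_mem {r k j : ℕ} (hj : j ≤ r) (p : M) (X : Fin j → VF n M)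
    (s : Fin k → Cₛ^∞⟮𝓡 n; Rn d, E⟯) : Phi D₀ D p j X s ∈ U D₀ D r k p :=
  Submodule.subset_span ⟨j, hj, X, s, rfl⟩

section Corner

/-- Operators `η ↦ ∑ c · (∇ʲ_X η)(s)` with `j ≤ r` and smooth coefficients `c`. -/
def Op (r k : ℕ) : Submodule (Fn n M) (Form n d E k → Fn n M) :=
  Submodule.span (Fn n M) {P | ∃ j ≤ r, ∃ (X : Fin j → VF n M)
    (s : Fin k → Cₛ^∞⟮𝓡 n; Rn d, E⟯), P = ⇑(higherCov D₀ D j X s)}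

theorem Op_mem {r k j : ℕ} (hj : j ≤ r) (X : Fin j → VF n M)
    (s : Fin k → Cₛ^∞⟮𝓡 n; Rn d, E⟯) : ⇑(higherCov D₀ D j X s) ∈ Op D₀ D r k :=
  Submodule.subset_span ⟨j, hj, X, s, rfl⟩

theorem Op_mono {r r' k : ℕ} (h : r ≤ r') : Op (n := n) (E := E) D₀ D r k ≤ Op D₀ D r' k :=
  Submodule.span_mono fun _ ⟨j, hj, X, s, e⟩ => ⟨j, hj.trans h, X, s, e⟩

theorem higherCov_succ {k j : ℕ} (X₀ : VF n M) (X : Fin j → VF n M)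
    (s : Fin k → Cₛ^∞⟮𝓡 n; Rn d, E⟯) (η : Form n d E k) :
    higherCov D₀ D (j + 1) (Fin.cons X₀ X) s η =
      lie X₀ (higherCov D₀ D j X s η)
        - ∑ l : Fin k, higherCov D₀ D j X (Function.update s l (cov D X₀ (s l))) η
        - ∑ i : Fin j, higherCov D₀ D j (Function.update X i (cov D₀ X₀ (X i))) s η := by
  simp [higherCov]

theorem lie_Op {r k : ℕ} (X₀ : VF n M) {P : Form n d E k → Fn n M} (hP : P ∈ Op D₀ D r k) :
    (fun η => lie X₀ (P η)) ∈ Op D₀ D (r + 1) k := by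
  induction hP using Submodule.span_induction with
  | mem P h =>
    obtain ⟨j, hj, X, s, rfl⟩ := h
    have : (fun η => lie X₀ (higherCov D₀ D j X s η)) =
        ⇑(higherCov D₀ D (j + 1) (Fin.cons X₀ X) s)
        + ∑ l : Fin k, ⇑(higherCov D₀ D j X (Function.update s l (cov D X₀ (s l))))
        + ∑ i : Fin j, ⇑(higherCov D₀ D j (Function.update X i (cov D₀ X₀ (X i))) s) := by
      funext η
      simp only [Pi.add_apply, Finset.sum_apply, higherCov_succ]
      abel
    rw [this]
    refine add_mem (add_mem (Op_mem D₀ D (by omega) _ _) ?_) ?_ <;>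
    exact sum_mem fun _ _ => Op_mem D₀ D (by omega) _ _
  | zero =>
    have : (fun η : Form n d E k => lie X₀ ((0 : Form n d E k → Fn n M) η)) = 0 := by
      funext η
      simp
    rw [this]
    exact zero_mem _
  | add P Q _ _ hP hQ =>
    have : (fun η => lie X₀ ((P + Q) η)) = (fun η => lie X₀ (P η)) + fun η => lie X₀ (Q η) := by
      funext η
      simp
    rw [this]
    exact add_mem hP hQ
  | smul c P hPm hP =>
    have : (fun η => lie X₀ ((c • P) η)) = lie X₀ c • P + c • fun η => lie X₀ (P η) := by
      funext η
      simp [lie_mul]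
    rw [this]
    exact add_mem (Submodule.smul_mem _ _ (Op_mono D₀ D (Nat.le_succ r) hPm))
      (Submodule.smul_mem _ _ hP)

theorem higherCov_mulForm {k : ℕ} (f : Fn n M) (j : ℕ) (X : Fin j → VF n M)
    (s : Fin k → Cₛ^∞⟮𝓡 n; Rn d, E⟯) :
    (fun η => higherCov D₀ D j X s (mulForm f η)) ∈ Op D₀ D j k := by
  induction j generalizing s with
  | zero => exact Submodule.smul_mem _ f (Op_mem D₀ D le_rfl X s)
  | succ j ih =>
    have : (fun η => higherCov D₀ D (j + 1) X s (mulForm f η)) =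
        (fun η => lie (X 0) (higherCov D₀ D j (Fin.tail X) s (mulForm f η)))
        - ∑ l : Fin k, (fun η => higherCov D₀ D j (Fin.tail X)
            (Function.update s l (cov D (X 0) (s l))) (mulForm f η))
        - ∑ i : Fin j, (fun η => higherCov D₀ D j
            (Function.update (Fin.tail X) i (cov D₀ (X 0) (Fin.tail X i))) s (mulForm f η)) := by
      funext η
      simp [higherCov]
    rw [this]
    refine sub_mem (sub_mem (lie_Op D₀ D _ (ih _ _)) ?_) ?_ <;>
    exact sum_mem fun _ _ => Op_mono D₀ D (Nat.le_succ j) (ih _ _)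

theorem Op_apply_mem {r k : ℕ} (p : M) {P : Form n d E k → Fn n M} (hP : P ∈ Op D₀ D r k) :
    ∃ T ∈ U D₀ D r k p, ∀ η, T η = P η p := by
  induction hP using Submodule.span_induction with
  | mem P h =>
    obtain ⟨j, hj, X, s, rfl⟩ := h
    exact ⟨_, Phi_mem D₀ D hj p X s, fun _ => rfl⟩
  | zero => exact ⟨0, zero_mem _, fun _ => rfl⟩
  | add P Q _ _ hP hQ =>
    obtain ⟨T, hT, hT'⟩ := hP
    obtain ⟨S, hS, hS'⟩ := hQ
    exact ⟨T + S, add_mem hT hS, fun η => by simp [hT', hS']⟩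
  | smul c P _ hP =>
    obtain ⟨T, hT, hT'⟩ := hP
    exact ⟨c p • T, Submodule.smul_mem _ _ hT, fun η => by simp [hT']⟩

theorem corner_mem {r k : ℕ} (f : Fn n M) (p : M) (T : Form n d E k →ₗ[ℝ] ℝ)
    (hT : T ∈ U D₀ D r k p) : T ∘ₗ mulForm f ∈ U D₀ D r k p := by
  induction hT using Submodule.span_induction with
  | mem T h =>
    obtain ⟨j, hj, X, s, rfl⟩ := h
    obtain ⟨S, hS, hS'⟩ :=
      Op_apply_mem D₀ D p (Op_mono D₀ D hj (higherCov_mulForm D₀ D f j X s))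
    have : Phi D₀ D p j X s ∘ₗ mulForm f = S := LinearMap.ext fun η => (hS' η).symm
    rwa [this]
  | zero => simp
  | add S T _ _ hS hT =>
    rw [LinearMap.add_comp]
    exact add_mem hS hT
  | smul c T _ hT =>
    rw [LinearMap.smul_comp]
    exact Submodule.smul_mem _ _ hT

end Corner

/-- The action `f⌟` on the fibre: `(f⌟T)(η) = T(f η)`. -/
def corner {r k : ℕ} (f : Fn n M) (p : M) : U D₀ D r k p →ₗ[ℝ] U D₀ D r k p where
  toFun T := ⟨T.1 ∘ₗ mulForm f, corner_mem D₀ D f p T.1 T.2⟩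
  map_add' _ _ := rfl
  map_smul' _ _ := rfl

/-- Indices of the standard basis `x_I ⊠ e_K` of `S^{≤ r}(ℝⁿ) ⊠ ⋀ᵏ(ℝᵈ)`: nondecreasing words `I`
in `{1,…,n}` of length at most `r`, and `k`-element subsets `K` of `{1,…,d}`. -/
abbrev Idx (n d r k : ℕ) : Type :=
  (Σ j : Fin (r + 1), Fin j →o Fin n) × (Fin k ↪o Fin d)

instance (n d r k : ℕ) : Fintype (Idx n d r k) :=
  @Fintype.ofFinite _ (by
    have : ∀ j : Fin (r + 1), Finite (Fin j →o Fin n) := fun j => DFunLike.finite _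
    have : Finite (Fin k ↪o Fin d) := DFunLike.finite _
    infer_instance)

variable (n d E) in
/-- Domain over which both the chart of `M` and the trivialization of `E` at `p₀` are defined. -/
def dom (p₀ : M) : Set M := (chartAt (Rn n) p₀).source ∩ (trivializationAt (Rn d) E p₀).baseSet

/-- The local frame of `𝒰_k^r(E)` over `dom p₀`: the element indexed by `(I, K)` sends `η` to
the partial derivative `∂_I η_K` at `p`, computed in the chart at `p₀`, of the component `η_K` of
`η` in the trivialization of `E` at `p₀`. -/
def frame {r k : ℕ} (p₀ : M) (i : Idx n d r k) (p : M) (η : Form n d E k) : ℝ :=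
  iteratedFDeriv ℝ i.1.1
    (fun x : Rn n => η.1 ((chartAt (Rn n) p₀).symm x) fun l =>
      (trivializationAt (Rn d) E p₀).symm ((chartAt (Rn n) p₀).symm x)
        (EuclideanSpace.single (i.2 l) 1))
    (chartAt (Rn n) p₀ p)
    (fun m => EuclideanSpace.single (i.1.2 m) 1)

/-- `c` is the coordinate vector of `T` in the local frame around `p₀`. -/
def HasCoords {r k : ℕ} (p₀ p : M) (T : Form n d E k →ₗ[ℝ] ℝ) (c : Idx n d r k → ℝ) : Prop :=
  ∀ η, T η = ∑ i, c i * frame p₀ i p η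

/-- The group `C^∞(𝒰_k^r(E))` of smooth sections: in each local frame the coordinates are smooth
functions. -/
def USec (r k : ℕ) : AddSubgroup (∀ p : M, U D₀ D r k p) where
  carrier := {T | ∀ p₀ : M, ∃ a : Idx n d r k → M → ℝ,
    (∀ i, ContMDiffOn (𝓡 n) 𝓘(ℝ) ∞ (a i) (dom n d E p₀)) ∧
    ∀ p ∈ dom n d E p₀, HasCoords p₀ p (T p).1 fun i => a i p}
  add_mem' := by
    intro S T hS hT p₀
    obtain ⟨a, ha, ha'⟩ := hS p₀
    obtain ⟨b, hb, hb'⟩ := hT p₀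
    refine ⟨a + b, fun i => (ha i).add (hb i), fun p hp η => ?_⟩
    have h : ((S + T) p).1 η = (S p).1 η + (T p).1 η := rfl
    rw [h, ha' p hp η, hb' p hp η, ← Finset.sum_add_distrib]
    exact Finset.sum_congr rfl fun i _ => (add_mul _ _ _).symm
  zero_mem' := by
    intro p₀
    refine ⟨0, fun i => contMDiffOn_const, fun p hp η => ?_⟩
    have h : ((0 : ∀ p : M, U D₀ D r k p) p).1 η = 0 := rfl
    rw [h]
    simp
  neg_mem' := by
    intro S hS p₀
    obtain ⟨a, ha, ha'⟩ := hS p₀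
    refine ⟨-a, fun i => (ha i).neg, fun p hp η => ?_⟩
    have h : ((-S) p).1 η = -(S p).1 η := rfl
    rw [h, ha' p hp η, ← Finset.sum_neg_distrib]
    exact Finset.sum_congr rfl fun i _ => (neg_mul _ _).symm

end OneBundle

section TwoBundles

variable {n : ℕ} {M : Type*} [TopologicalSpace M] [ChartedSpace (Rn n) M] [IsManifold (𝓡 n) ∞ M]
  {d : ℕ} {E : M → Type*} [TopologicalSpace (TotalSpace (Rn d) E)]
  [∀ x, AddCommGroup (E x)] [∀ x, Module ℝ (E x)] [∀ x, TopologicalSpace (E x)]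
  [∀ x, IsTopologicalAddGroup (E x)] [∀ x, ContinuousSMul ℝ (E x)]
  [FiberBundle (Rn d) E] [VectorBundle ℝ (Rn d) E] [ContMDiffVectorBundle ∞ (Rn d) E (𝓡 n)]
  {d' : ℕ} {F : M → Type*} [TopologicalSpace (TotalSpace (Rn d') F)]
  [∀ x, AddCommGroup (F x)] [∀ x, Module ℝ (F x)] [∀ x, TopologicalSpace (F x)]
  [∀ x, IsTopologicalAddGroup (F x)] [∀ x, ContinuousSMul ℝ (F x)]
  [FiberBundle (Rn d') F] [VectorBundle ℝ (Rn d') F] [ContMDiffVectorBundle ∞ (Rn d') F (𝓡 n)]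
  (D₀ : CovariantDerivative (𝓡 n) (Rn n) (TangentSpace (𝓡 n) : M → Type _))
  [D₀.ContMDiffCovariantDerivative ∞]
  (D : CovariantDerivative (𝓡 n) (Rn d) E) [D.ContMDiffCovariantDerivative ∞]
  (D' : CovariantDerivative (𝓡 n) (Rn d') F) [D'.ContMDiffCovariantDerivative ∞]

instance homAddCommGroup (r k s j : ℕ) (p : M) :
    AddCommGroup (U D₀ D r k p →ₗ[ℝ] U D₀ D' s j p) :=
  @LinearMap.addCommGroup ℝ ℝ (U D₀ D r k p) (U D₀ D' s j p) _ _ _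
    (Submodule.addCommGroup (U D₀ D' s j p)) _ (Submodule.module _) _

/-- The group `C^∞(Hom(𝒰_k^r(E), 𝒰_j^s(F)))` of smooth sections: in each pair of local frames the
homomorphism is given by a matrix of smooth functions. -/
def HomSec (r k s j : ℕ) : AddSubgroup (∀ p : M, U D₀ D r k p →ₗ[ℝ] U D₀ D' s j p) where
  carrier := {H | ∀ p₀ : M, ∃ A : Idx n d' s j → Idx n d r k → M → ℝ,
    (∀ i' i, ContMDiffOn (𝓡 n) 𝓘(ℝ) ∞ (A i' i) (dom n d E p₀ ∩ dom n d' F p₀)) ∧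
    ∀ p ∈ dom n d E p₀ ∩ dom n d' F p₀, ∀ (S : U D₀ D r k p) (c : Idx n d r k → ℝ),
      HasCoords p₀ p S.1 c → HasCoords p₀ p (H p S).1 fun i' => ∑ i, A i' i p * c i}
  add_mem' := by
    intro G H hG hH p₀
    obtain ⟨A, hA, hA'⟩ := hG p₀
    obtain ⟨B, hB, hB'⟩ := hH p₀
    refine ⟨A + B, fun i' i => (hA i' i).add (hB i' i), fun p hp S c hc η => ?_⟩
    have h : ((G + H) p S).1 η = (G p S).1 η + (H p S).1 η := rfl
    rw [h, hA' p hp S c hc η, hB' p hp S c hc η, ← Finset.sum_add_distrib]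
    refine Finset.sum_congr rfl fun i' _ => ?_
    rw [← add_mul, ← Finset.sum_add_distrib]
    congr 1
    exact Finset.sum_congr rfl fun i _ => (add_mul _ _ _).symm
  zero_mem' := by
    intro p₀
    refine ⟨0, fun i' i => contMDiffOn_const, fun p hp S c hc η => ?_⟩
    have h : ((0 : ∀ p : M, U D₀ D r k p →ₗ[ℝ] U D₀ D' s j p) p S).1 η = 0 := rfl
    rw [h]
    simp
  neg_mem' := by
    intro G hG p₀
    obtain ⟨A, hA, hA'⟩ := hG p₀
    refine ⟨-A, fun i' i => (hA i' i).neg, fun p hp S c hc η => ?_⟩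
    have h : ((-G) p S).1 η = -(G p S).1 η := rfl
    rw [h, hA' p hp S c hc η, ← Finset.sum_neg_distrib]
    refine Finset.sum_congr rfl fun i' _ => ?_
    rw [← neg_mul, ← Finset.sum_neg_distrib]
    congr 1
    exact Finset.sum_congr rfl fun i _ => (neg_mul _ _).symm

/-- A homomorphism `H : 𝒰_k^r(E) → 𝒰_j^s(F)` is consistent if `(H*)* = H`. Here
`H* : C^∞(⋀ʲ(F*)) → C^∞(⋀ᵏ(E*))` is `(H*θ)_p(α) = H(α)(θ)` for `α ∈ ⋀ᵏ(E_p) = 𝒰_k^0(E; p)`, and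
the dual `T*` of an operator `T` is `T*(S) = S ∘ T`. -/
def IsConsistent {r k s j : ℕ} (H : ∀ p : M, U D₀ D r k p →ₗ[ℝ] U D₀ D' s j p) : Prop :=
  ∃ Hstar : Form n d' F j → Form n d E k,
    (∀ (θ : Form n d' F j) (p : M) (t : Fin k → Cₛ^∞⟮𝓡 n; Rn d, E⟯),
      (Hstar θ).1 p (fun i => t i p) =
        (H p ⟨Phi D₀ D p 0 Fin.elim0 t, Phi_mem D₀ D (Nat.zero_le r) p _ t⟩).1 θ) ∧
    ∀ (p : M) (S : U D₀ D r k p) (θ : Form n d' F j), (H p S).1 θ = S.1 (Hstar θ)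

end TwoBundles

end UBundle

end

/-! The action `f⌟` is not fibrewise multiplication. By the Leibniz rule, however, `f⌟T - f(p)T` has
smaller order than `T` (`corner_add_neg_smul_mem`), so `f⌟` preserves the filtration by order, and
on its graded pieces `f` acts through its values. Each graded piece can be treated as the sections
of an ordinary vector bundle, and the extensions between them split.

`GradedCoords` isolates what this argument needs: local coordinates with a degree, on whose leading
part functions act by multiplication. `exists_dual_basis_step` is the Serre–Swan argument for one
degree: a partition of unity yields finitely many linear functionals and elements that reproduce an
element up to lower degree. Iterating gives finite generation and projectivity (`finite_projective`)
and shows that every filtration step is a direct summand (`exists_isCompl_filt`). As `M` need not be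
compact, finiteness of the dual system rests on a cover by `n + 1` open sets, each a disjoint union
of small pieces (`exists_finite_cover_locally_constant`).

To apply this to `𝒰_k^r(E)`, the partial derivatives in a chart and trivialization are shown to be a
basis of each fibre (`U_le_span_frameL`, `frameL_mem_U`, `linearIndependent_frameL`). Smoothness can
then be tested on forms and on sections (`mem_USec_iff`, `mem_HomSec_iff`). For homomorphisms,
postcomposition is graded by the target order, and precomposition by the source order in reverse.

A consistent `H` is composition with its dual operator `H*`, so it is determined by its restriction
to functionals of order zero. If `n > 0`, differentiating raises the order of a nonzero leading part
by exactly one, whence `H*` has order at most `s - r` (`apply_mem_Ult`). Conversely, every operator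
of that order gives a consistent homomorphism (`exists_isConsistent_restrict_eq`). Restriction thus
identifies the consistent homomorphisms with a filtration step of the homomorphisms out of
`𝒰_k^0(E)`, and the complement of this step is pulled back. If `n = 0` every homomorphism is
consistent; if `n > 0` and `s < r` only zero is. -/

noncomputable section

namespace UBundle

set_option linter.unusedSectionVars false

/-! ### Covering a manifold by finitely many families of disjoint small open sets. -/

section Cover

open Set

variable {n : ℕ} {M : Type*} [TopologicalSpace M] [ChartedSpace (Rn n) M]

/-- The image of an `n`-dimensional manifold thickened by one direction has dimension at most
`n + 1`. -/
theorem dimH_thickened_image_le [SecondCountableTopology M] [IsManifold (𝓡 n) ∞ M]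
    {V : Type*} [NormedAddCommGroup V]
    [NormedSpace ℝ V] {O : Set M} (hO : IsOpen O) {g : M → V}
    (hg : ContMDiffOn (𝓡 n) 𝓘(ℝ, V) 1 g O) (e : V) :
    dimH {v : V | ∃ p ∈ O, ∃ c : ℝ, v = g p + c • e} ≤ (n + 1 : ℕ) := by
  -- Near `p` the set lies in the image of a chart ball times `ℝ` under a `C¹` map. That product is
  -- convex and has dimension at most `n + 1`. Second countability then reduces the claim to
  -- countably many such pieces.
  have key : ∀ p ∈ O, ∃ u ∈ nhds p, dimH {v : V | ∃ q ∈ u, ∃ c : ℝ, v = g q + c • e} ≤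
      (n + 1 : ℕ) := by
    intro p hp
    let φ := chartAt (Rn n) p
    have hps : p ∈ φ.source := mem_chart_source _ p
    have hopen : IsOpen (φ.target ∩ φ.symm ⁻¹' O) := φ.isOpen_inter_preimage_symm hO
    have hmem : φ p ∈ φ.target ∩ φ.symm ⁻¹' O := ⟨φ.map_source hps, by simpa [φ.left_inv hps]⟩
    obtain ⟨ε, hε, hball⟩ := Metric.isOpen_iff.1 hopen _ hmem
    have hsm : ContDiffOn ℝ 1 (g ∘ φ.symm) (Metric.ball (φ p) ε) := by
      rw [← contMDiffOn_iff_contDiffOn]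
      refine hg.comp ((contMDiffOn_chart_symm (x := p) (n := ∞)).of_le (by simp) |>.mono
        fun x hx => (hball hx).1) fun x hx => (hball hx).2
    let G : Rn n × ℝ → V := fun z => (g ∘ φ.symm) z.1 + z.2 • e
    have hG : ContDiffOn ℝ 1 G (Metric.ball (φ p) ε ×ˢ univ) := by
      refine (hsm.comp contDiffOn_fst fun z hz => hz.1).add ?_
      exact (contDiff_snd.smul contDiff_const).contDiffOn
    refine ⟨φ.source ∩ φ ⁻¹' Metric.ball (φ p) ε,
      (φ.isOpen_inter_preimage Metric.isOpen_ball).mem_nhds ⟨hps, Metric.mem_ball_self hε⟩, ?_⟩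
    have hsub : {v : V | ∃ q ∈ φ.source ∩ φ ⁻¹' Metric.ball (φ p) ε, ∃ c : ℝ, v = g q + c • e} ⊆
        G '' (Metric.ball (φ p) ε ×ˢ univ) := by
      rintro v ⟨q, ⟨hq, hqb⟩, c, rfl⟩
      exact ⟨(φ q, c), ⟨hqb, mem_univ _⟩, by simp [G, φ.left_inv hq]⟩
    calc _ ≤ dimH (G '' (Metric.ball (φ p) ε ×ˢ univ)) := dimH_mono hsub
      _ ≤ dimH (Metric.ball (φ p) ε ×ˢ (univ : Set ℝ)) :=
        hG.dimH_image_le ((convex_ball _ _).prod convex_univ) Subset.rfl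
      _ ≤ dimH (univ : Set (Rn n × ℝ)) := dimH_mono (subset_univ _)
      _ = (n + 1 : ℕ) := by rw [Real.dimH_univ_eq_finrank]; simp
  choose! u hu hdim using key
  obtain ⟨t, htO, htc, ht⟩ := TopologicalSpace.countable_cover_nhdsWithin
    (f := u) (s := O) fun p hp => mem_nhdsWithin_of_mem_nhds (hu p hp)
  have hsub : {v : V | ∃ p ∈ O, ∃ c : ℝ, v = g p + c • e} ⊆
      ⋃ p ∈ t, {v : V | ∃ q ∈ u p, ∃ c : ℝ, v = g q + c • e} := by
    rintro v ⟨q, hq, c, rfl⟩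
    obtain ⟨p, hp, hqp⟩ := mem_iUnion₂.1 (ht hq)
    exact mem_iUnion₂.2 ⟨p, hp, q, hqp, c, rfl⟩
  refine (dimH_mono hsub).trans ?_
  rw [dimH_bUnion htc]
  exact iSup₂_le fun p hp => hdim p (htO hp)

/-- Positive weights can be chosen such that at no point `n + 2` of the weighted functions share a
positive value. -/
theorem exists_generic_weights [SecondCountableTopology M] [IsManifold (𝓡 n) ∞ M]
    (φ : ℕ → Fn n M) :
    ∃ w : ℕ → ℝ, (∀ i, 0 < w i) ∧ ∀ e : Fin (n + 2) → ℕ, Function.Injective e → ∀ p c,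
      0 < c → ¬ ∀ a, w (e a) * φ (e a) p = c := by
  let V := Fin (n + 2) → ℝ
  -- The weights will be exponentials of a polynomial in the index with coefficient vector `v`.
  -- After taking logarithms, a coincidence of `n + 2` weighted values says that a Vandermonde
  -- matrix maps `v` to `-log φ(p) + log c • 1`. Inverting the matrix places `v` in a set of
  -- dimension at most `n + 1`.
  let A : (Fin (n + 2) → ℕ) → Matrix (Fin (n + 2)) (Fin (n + 2)) ℝ := fun e =>
    (Matrix.vandermonde fun a => (e a : ℝ))⁻¹
  let O : (Fin (n + 2) → ℕ) → Set M := fun e => {p | ∀ a, 0 < φ (e a) p}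
  let g : (Fin (n + 2) → ℕ) → M → V := fun e p a => - Real.log (φ (e a) p)
  have hO : ∀ e, IsOpen (O e) := by
    intro e
    simp only [O, ofPred_forall]
    exact isOpen_iInter_of_finite fun a => isOpen_lt continuous_const (φ (e a)).contMDiff.continuous
  have hg : ∀ e, ContMDiffOn (𝓡 n) 𝓘(ℝ, V) 1 (g e) (O e) := by
    intro e
    rw [contMDiffOn_pi_space]
    intro a p hp
    have h1 : ContDiffAt ℝ 1 (fun x : ℝ => - Real.log x) (φ (e a) p) :=
      (Real.contDiffAt_log.2 (hp a).ne').neg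
    exact (h1.contMDiffAt.comp p ((φ (e a)).contMDiff.of_le (by simp) p)).contMDiffWithinAt
  let L : (Fin (n + 2) → ℕ) → V →L[ℝ] V := fun e => (Matrix.mulVecLin (A e)).toContinuousLinearMap
  let bad : (Fin (n + 2) → ℕ) → Set V := fun e =>
    {v | ∃ p ∈ O e, ∃ c : ℝ, v = (L e ∘ g e) p + c • L e (fun _ => 1)}
  have hbad : ∀ e, dimH (bad e) ≤ (n + 1 : ℕ) := fun e =>
    dimH_thickened_image_le (hO e) ((L e).contMDiff.comp_contMDiffOn (hg e)) _
  -- There are only countably many index tuples, so the union of all bad sets still has dimension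
  -- below `n + 2` and some `v` avoids it.
  have hlt : dimH (⋃ e, bad e) < finrank ℝ V := by
    rw [dimH_iUnion]
    refine (iSup_le hbad).trans_lt ?_
    simp only [V, finrank_fin_fun]
    exact_mod_cast Nat.lt_succ_self _
  obtain ⟨v, hv⟩ := (dense_compl_of_dimH_lt_finrank hlt).nonempty
  refine ⟨fun i => Real.exp (∑ m : Fin (n + 2), (i : ℝ) ^ (m : ℕ) * v m), fun i => Real.exp_pos _,
    fun e he p c hc h => hv (mem_iUnion.2 ⟨e, p, ?_, Real.log c, ?_⟩)⟩
  · intro a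
    have h1 := h a
    by_contra h2
    have := mul_nonpos_of_nonneg_of_nonpos
      (Real.exp_pos (∑ m : Fin (n + 2), ((e a : ℕ) : ℝ) ^ (m : ℕ) * v m)).le (not_lt.1 h2)
    linarith
  · have hpos : ∀ a, 0 < φ (e a) p := by
      intro a
      by_contra h2
      have := mul_nonpos_of_nonneg_of_nonpos
        (Real.exp_pos (∑ m : Fin (n + 2), ((e a : ℕ) : ℝ) ^ (m : ℕ) * v m)).le (not_lt.1 h2)
      linarith [h a]
    have h3 : (Matrix.vandermonde fun a => (e a : ℝ)).mulVec v =
        g e p + Real.log c • fun _ => 1 := by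
      funext a
      have := congrArg Real.log (h a)
      rw [Real.log_mul (Real.exp_pos _).ne' (hpos a).ne', Real.log_exp] at this
      change ∑ m : Fin (n + 2), Matrix.vandermonde (fun a => (e a : ℝ)) a m * v m = - Real.log (φ (e a) p) + Real.log c * 1
      simp only [Matrix.vandermonde_apply]
      linarith
    have hdet : IsUnit (Matrix.vandermonde fun a => (e a : ℝ)).det := by
      rw [isUnit_iff_ne_zero, Matrix.det_vandermonde_ne_zero_iff]
      exact fun a b hab => he (Nat.cast_injective hab)
    have h4 : v = (A e).mulVec ((Matrix.vandermonde fun a => (e a : ℝ)).mulVec v) := by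
      rw [Matrix.mulVec_mulVec, Matrix.nonsing_inv_mul _ hdet, Matrix.one_mulVec]
    conv_lhs => rw [h4, h3]
    exact ((L e).map_add _ _).trans (by rw [(L e).map_smul]; rfl)

/-- The points at which the functions with index in `S` are positive and dominate all others. -/
def dominated {M : Type*} (ψ : ℕ → M → ℝ) (S : Finset ℕ) : Set M :=
  {p | ∀ i ∈ S, 0 < ψ i p ∧ ∀ j ∉ S, ψ j p < ψ i p}

/-- By local finiteness only finitely many `ψ j` matter near a point; the others vanish there and
lie below the positive ones automatically. -/
theorem isOpen_dominated {ψ : ℕ → M → ℝ} (hc : ∀ i, Continuous (ψ i))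
    (hlf : LocallyFinite fun i => Function.support (ψ i)) (S : Finset ℕ) :
    IsOpen (dominated ψ S) := by
  rw [isOpen_iff_mem_nhds]
  intro p hp
  obtain ⟨t, ht, hfin⟩ := hlf p
  have h1 : ∀ᶠ q in nhds p, ∀ i ∈ S, 0 < ψ i q :=
    (Filter.eventually_all_finset S).2 fun i hi =>
      (hc i).continuousAt.eventually_const_lt (hp i hi).1
  have h2 : ∀ᶠ q in nhds p, ∀ i ∈ S, ∀ j ∈ hfin.toFinset, j ∉ S → ψ j q < ψ i q := by
    refine (Filter.eventually_all_finset S).2 fun i hi =>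
      (Filter.eventually_all_finset _).2 fun j _ => ?_
    by_cases hj : j ∈ S
    · exact Filter.Eventually.of_forall fun _ h => absurd hj h
    · filter_upwards [(hc j).continuousAt.eventually_lt (hc i).continuousAt ((hp i hi).2 j hj)]
        with q hq _ using hq
  filter_upwards [h1, h2, ht] with q hq1 hq2 hqt i hi
  refine ⟨hq1 i hi, fun j hj => ?_⟩
  by_cases hjq : ψ j q = 0
  · rw [hjq]; exact hq1 i hi
  · exact hq2 i hi j (hfin.mem_toFinset.2 ⟨q, hjq, hqt⟩) hj

/-- Distinct sets of equal size each contain an index missing from the other, and these two indices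
would have to dominate each other. Hence the pieces belonging to one cardinality are disjoint. -/
theorem eq_of_mem_dominated {M : Type*} {ψ : ℕ → M → ℝ} {S S' : Finset ℕ} (hcard : S.card = S'.card) {p : M}
    (h : p ∈ dominated ψ S) (h' : p ∈ dominated ψ S') : S = S' := by
  by_contra hne
  have h1 : ¬ S ⊆ S' := fun hs => hne (Finset.eq_of_subset_of_card_le hs hcard.ge)
  have h2 : ¬ S' ⊆ S := fun hs => hne (Finset.eq_of_subset_of_card_le hs hcard.le).symm
  obtain ⟨i, hi, hi'⟩ := Finset.not_subset.1 h1
  obtain ⟨j, hj, hj'⟩ := Finset.not_subset.1 h2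
  exact lt_asymm ((h i hi).2 j hj') ((h' j hj).2 i hi')

/-- A manifold of dimension `n` is covered by `n + 1` open sets, each of which is a disjoint union
of open sets subordinate to a given open cover. The disjoint union is encoded by a locally
constant selection of members of the cover. -/
theorem exists_finite_cover_locally_constant [T2Space M] [SecondCountableTopology M]
    [IsManifold (𝓡 n) ∞ M] (dom : M → Set M) (hdo : ∀ p, IsOpen (dom p)) (hd : ∀ p, p ∈ dom p) :
    ∃ (W : Fin (n + 1) → Set M) (σ : Fin (n + 1) → M → M), (∀ c, IsOpen (W c)) ∧
      (⋃ c, W c) = univ ∧ (∀ c, ∀ p ∈ W c, p ∈ dom (σ c p)) ∧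
      ∀ c, ∀ p ∈ W c, ∀ᶠ q in nhds p, σ c q = σ c p := by
  classical
  rcases isEmpty_or_nonempty M with hM | hM
  · exact ⟨fun _ => ∅, fun _ => id, fun _ => isOpen_empty, by ext p; exact hM.elim p,
      fun _ p => hM.elim p, fun _ p => hM.elim p⟩
  obtain ⟨t, htc, ht⟩ := TopologicalSpace.countable_cover_nhds fun p => (hdo p).mem_nhds (hd p)
  have htne : t.Nonempty := by
    by_contra h
    rw [not_nonempty_iff_eq_empty] at h
    obtain ⟨p⟩ := hM
    have : p ∈ (univ : Set M) := mem_univ p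
    rw [← ht, h] at this
    simp at this
  obtain ⟨x, hx⟩ := htc.exists_eq_range htne
  have : LocallyCompactSpace M := ChartedSpace.locallyCompactSpace (Rn n) M
  obtain ⟨f, hf⟩ := SmoothPartitionOfUnity.exists_isSubordinate (I := 𝓡 n) (M := M)
    isClosed_univ (fun i : ℕ => dom (x i)) (fun i => hdo _) (by
      rw [hx] at ht
      simp only [biUnion_range] at ht
      rw [ht])
  obtain ⟨w, hw, hgen⟩ := exists_generic_weights fun i => f i
  let ψ : ℕ → M → ℝ := fun i p => w i * f i p
  have hψc : ∀ i, Continuous (ψ i) := fun i => continuous_const.mul (f i).contMDiff.continuous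
  have hsupp : ∀ i p, 0 < ψ i p → p ∈ Function.support (f i) := by
    intro i p h h0
    simp [ψ, h0] at h
  have hlf : LocallyFinite fun i => Function.support (ψ i) :=
    f.locallyFinite.subset fun i p hp h0 => hp (by simp [ψ, h0])
  have hψ0 : ∀ i p, 0 ≤ ψ i p := fun i p => mul_nonneg (hw i).le (f.nonneg i p)
  -- Any member of `S` would serve; the value for empty `S` plays no role, since `Q c p S` forces
  -- `S` to have `c + 1` elements.
  let pick : Finset ℕ → M := fun S => if h : S.Nonempty then x (S.min' h) else x 0
  let Q : Fin (n + 1) → M → Finset ℕ → Prop := fun c p S => S.card = c + 1 ∧ p ∈ dominated ψ S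
  refine ⟨fun c => {p | ∃ S, Q c p S},
    fun c p => if h : ∃ S, Q c p S then pick h.choose else p, ?_, ?_, ?_, ?_⟩
  · intro c
    have : {p | ∃ S, Q c p S} = ⋃ S ∈ {S : Finset ℕ | S.card = c + 1}, dominated ψ S := by
      ext p; simp [Q]
    change IsOpen {p | ∃ S, Q c p S}
    rw [this]
    exact isOpen_biUnion fun S _ => isOpen_dominated hψc hlf S
  · refine eq_univ_of_forall fun p => ?_
    obtain ⟨i₀, hi₀⟩ := f.exists_pos_of_mem (mem_univ p)
    have hfin : {i | ψ i p ≠ 0}.Finite := hlf.point_finite p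
    have hne : hfin.toFinset.Nonempty :=
      ⟨i₀, hfin.mem_toFinset.2 (mul_pos (hw i₀) hi₀).ne'⟩
    obtain ⟨m, hm, hmax⟩ := hfin.toFinset.exists_max_image (fun i => ψ i p) hne
    have hmpos : 0 < ψ m p := lt_of_le_of_ne (hψ0 m p) (Ne.symm (hfin.mem_toFinset.1 hm))
    have hle : ∀ j, ψ j p ≤ ψ m p := by
      intro j
      by_cases hj : ψ j p = 0
      · rw [hj]; exact hmpos.le
      · exact hmax j (hfin.mem_toFinset.2 hj)
    -- The set of all maximizers at `p` dominates the remaining indices. Genericity of the weights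
    -- bounds its size by `n + 1`.
    let S := hfin.toFinset.filter fun i => ψ i p = ψ m p
    have hS : ∀ j, j ∈ S ↔ ψ j p = ψ m p := by
      intro j
      simp only [S, Finset.mem_filter, hfin.mem_toFinset, mem_ofPred_eq, and_iff_right_iff_imp]
      intro h; rw [h]; exact hmpos.ne'
    have hdom : p ∈ dominated ψ S := by
      intro i hi
      rw [hS] at hi
      rw [hi]
      exact ⟨hmpos, fun j hj => lt_of_le_of_ne (hle j) fun h => hj ((hS j).2 h)⟩
    have hcard0 : 0 < S.card := Finset.card_pos.2 ⟨m, (hS m).2 rfl⟩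
    have hcard : S.card ≤ n + 1 := by
      by_contra hlt
      obtain ⟨S', hS', hc'⟩ := Finset.exists_subset_card_eq (show n + 2 ≤ S.card by omega)
      let e := S'.orderEmbOfFin hc'
      refine hgen e e.injective p (ψ m p) hmpos fun a => ?_
      exact (hS _).1 (hS' (Finset.orderEmbOfFin_mem S' hc' a))
    exact mem_iUnion.2 ⟨⟨S.card - 1, by omega⟩, S, by simp; omega, hdom⟩
  · intro c p hp
    have hp' : ∃ S, Q c p S := hp
    simp only [dif_pos hp']
    obtain ⟨h1, h2⟩ := hp'.choose_spec
    have hne : hp'.choose.Nonempty := Finset.card_pos.1 (by omega)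
    simp only [pick, dif_pos hne]
    have := (h2 _ (hp'.choose.min'_mem hne)).1
    exact hf _ (subset_closure (hsupp _ _ this))
  · intro c p hp
    have hp' : ∃ S, Q c p S := hp
    obtain ⟨h1, h2⟩ := hp'.choose_spec
    filter_upwards [(isOpen_dominated hψc hlf _).mem_nhds h2] with q hq
    have hq' : ∃ S, Q c q S := ⟨_, h1, hq⟩
    -- The set chosen at `p` also dominates at nearby `q`, and uniqueness among sets of this size
    -- forces the same choice there.
    have : hq'.choose = hp'.choose :=
      eq_of_mem_dominated (hq'.choose_spec.1.trans h1.symm) hq'.choose_spec.2 hq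
    simp only [dif_pos hp', dif_pos hq', this]

end Cover

/-! ### Serre–Swan argument for filtered modules. -/

section GradedCoords

variable {n : ℕ} {M : Type*} [TopologicalSpace M] [ChartedSpace (Rn n) M]

/-- Local smooth coordinates on a module over the smooth functions of `M`, graded such that
functions act on the leading coordinates by multiplication. -/
structure GradedCoords (n : ℕ) (M : Type*) [TopologicalSpace M] [ChartedSpace (Rn n) M]
    (P : Type*) [AddCommGroup P] [Module (Fn n M) P] (I : Type*) where
  /-- The domain of the coordinates around a point. -/
  dom : M → Set M
  isOpen_dom : ∀ p, IsOpen (dom p)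
  mem_dom : ∀ p, p ∈ dom p
  /-- The degree of a coordinate. -/
  deg : I → ℕ
  /-- The coordinates around a point. -/
  coord : M → P → I → M → ℝ
  coord_add : ∀ p₀, ∀ p ∈ dom p₀, ∀ T T' i, coord p₀ (T + T') i p = coord p₀ T i p + coord p₀ T' i p
  smooth : ∀ p₀ T i, ContMDiffOn (𝓡 n) 𝓘(ℝ) ∞ (coord p₀ T i) (dom p₀)
  -- The individual coordinates depend on the frame; the filtration by degree does not.
  vanish_congr : ∀ t T p p₀ p₁, p ∈ dom p₀ → p ∈ dom p₁ → (∀ i, t ≤ deg i → coord p₀ T i p = 0) →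
    ∀ i, t ≤ deg i → coord p₁ T i p = 0
  eq_zero : ∀ T, (∀ p i, coord p T i p = 0) → T = 0
  -- The frame used at a point of `W` may vary from one piece of `W` to another, so one global
  -- element is glued from all pieces of `W` at once.
  realize : ∀ (W : Set M) (σ : M → M), IsOpen W → (∀ p ∈ W, p ∈ dom (σ p)) →
    (∀ p ∈ W, ∀ᶠ q in nhds p, σ q = σ p) → ∀ a : I → Fn n M, (∀ i, tsupport (a i) ⊆ W) →
    ∃ T, (∀ p ∈ W, ∀ i, coord (σ p) T i p = a i p) ∧ ∀ p ∉ W, ∀ i, coord p T i p = 0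
  -- Linearity over functions is demanded only where no coordinate of higher degree contributes,
  -- because such coordinates feed derivatives of `f` into lower degrees.
  coord_smul : ∀ (f : Fn n M) T p₀, ∀ p ∈ dom p₀, ∀ i,
    (∀ i', deg i < deg i' → coord p₀ T i' p = 0) → coord p₀ (f • T) i p = f p * coord p₀ T i p

namespace GradedCoords

variable {P : Type*} [AddCommGroup P] [Module (Fn n M) P] {I : Type*} (C : GradedCoords n M P I)

theorem coord_zero {p₀ p : M} (hp : p ∈ C.dom p₀) (i : I) : C.coord p₀ 0 i p = 0 := by
  have := C.coord_add p₀ p hp 0 0 i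
  simpa using this

theorem coord_sub {p₀ p : M} (hp : p ∈ C.dom p₀) (T T' : P) (i : I) :
    C.coord p₀ (T - T') i p = C.coord p₀ T i p - C.coord p₀ T' i p := by
  have := C.coord_add p₀ p hp (T - T') T' i
  rw [sub_add_cancel] at this
  linarith

theorem coord_sum {ι : Type*} {p₀ p : M} (hp : p ∈ C.dom p₀) (s : Finset ι) (T : ι → P) (i : I) :
    C.coord p₀ (∑ a ∈ s, T a) i p = ∑ a ∈ s, C.coord p₀ (T a) i p := by
  classical
  induction s using Finset.induction_on with
  | empty => simpa using C.coord_zero hp i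
  | insert a s ha ih => rw [Finset.sum_insert ha, Finset.sum_insert ha, C.coord_add _ _ hp, ih]

/-- The submodule of elements whose coordinates of degree at least `t` vanish. -/
def filt (t : ℕ) : Submodule (Fn n M) P where
  carrier := {T | ∀ p p₀, p ∈ C.dom p₀ → ∀ i, t ≤ C.deg i → C.coord p₀ T i p = 0}
  add_mem' := by
    intro T T' hT hT' p p₀ hp i hi
    rw [C.coord_add _ _ hp, hT p p₀ hp i hi, hT' p p₀ hp i hi, add_zero]
  zero_mem' := fun p p₀ hp i _ => C.coord_zero hp i
  smul_mem' := by
    intro f T hT p p₀ hp i hi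
    rw [C.coord_smul f T p₀ p hp i fun i' hi' => hT p p₀ hp i' (hi.trans hi'.le), hT p p₀ hp i hi,
      mul_zero]

theorem mem_filt {t : ℕ} {T : P} : T ∈ C.filt t ↔
    ∀ p p₀, p ∈ C.dom p₀ → ∀ i, t ≤ C.deg i → C.coord p₀ T i p = 0 := Iff.rfl

theorem filt_mono {t t' : ℕ} (h : t ≤ t') : C.filt t ≤ C.filt t' :=
  fun _ hT p p₀ hp i hi => hT p p₀ hp i (h.trans hi)

theorem filt_zero : C.filt 0 = ⊥ := by
  rw [eq_bot_iff]
  intro T hT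
  exact C.eq_zero T fun p i => hT p p (C.mem_dom p) i (Nat.zero_le _)

theorem mem_filt_of_exists {t : ℕ} {T : P}
    (h : ∀ p, ∃ p₀, p ∈ C.dom p₀ ∧ ∀ i, t ≤ C.deg i → C.coord p₀ T i p = 0) : T ∈ C.filt t := by
  intro p p₁ hp₁
  obtain ⟨p₀, hp₀, h0⟩ := h p
  exact C.vanish_congr t T p p₀ p₁ hp₀ hp₁ h0

/-- On elements of degree at most `t`, the coordinates of degree `t` are linear over functions. Cut
off by a partition of unity on the `n + 1` sets, they become global functionals, and matching global
elements come from `realize`. This is a finite dual basis of the quotient by the next filtration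
step. -/
theorem exists_dual_basis_step [Finite I] [T2Space M] [SecondCountableTopology M]
    [IsManifold (𝓡 n) ∞ M] (t : ℕ) :
    ∃ (ι : Type) (_ : Fintype ι) (α : ι → C.filt (t + 1) →ₗ[Fn n M] Fn n M)
      (ε : ι → C.filt (t + 1)),
      (∀ T : C.filt (t + 1), (T : P) - ∑ a, α a T • (ε a : P) ∈ C.filt t) ∧
      ∀ a (T : C.filt (t + 1)), (T : P) ∈ C.filt t → α a T = 0 := by
  classical
  have := Fintype.ofFinite I
  obtain ⟨N, ⟨eI⟩⟩ := Finite.exists_equiv_fin I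
  obtain ⟨W, σ, hWo, hWc, hσ, hσc⟩ :=
    exists_finite_cover_locally_constant (n := n) C.dom C.isOpen_dom C.mem_dom
  have : LocallyCompactSpace M := ChartedSpace.locallyCompactSpace (Rn n) M
  obtain ⟨χ, hχ⟩ := SmoothPartitionOfUnity.exists_isSubordinate (I := 𝓡 n) (M := M)
    isClosed_univ W hWo hWc.ge
  have hχ0 : ∀ c, ∀ p ∉ W c, χ c p = 0 := fun c p hp =>
    image_eq_zero_of_notMem_tsupport fun h => hp (hχ c h)
  -- One factor `χ c` goes into the functional and the other into the element, so the products
  -- reproduce `u • T` up to lower degree. The inverse `v` of `u` corrects this.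
  let u : Fn n M := ∑ c, χ c * χ c
  have hu : ∀ p, u p = ∑ c, χ c p * χ c p := fun p => by
    change evalAt p (∑ c, χ c * χ c) = _
    rw [map_sum]
    rfl
  have hupos : ∀ p, 0 < u p := by
    intro p
    obtain ⟨c, hc⟩ := χ.exists_pos_of_mem (Set.mem_univ p)
    rw [hu]
    exact Finset.sum_pos' (fun c _ => mul_self_nonneg _) ⟨c, Finset.mem_univ _, mul_pos hc hc⟩
  let v : Fn n M := ⟨fun p => (u p)⁻¹, fun p =>
    ((contDiffAt_inv ℝ (hupos p).ne').contMDiffAt).comp p (u.contMDiff p)⟩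
  have hvu : v * u = 1 := by
    ext p
    exact inv_mul_cancel₀ (hupos p).ne'
  -- Since `σ c` is locally constant on `W c`, only one frame is involved near each point of the
  -- support of `χ c`.
  have hsm : ∀ c (T : P) i, ContMDiff (𝓡 n) 𝓘(ℝ) ∞ fun p => χ c p * C.coord (σ c p) T i p := by
    intro c T i
    refine contMDiff_of_tsupport fun p hp => ?_
    have hpW : p ∈ W c := hχ c (closure_mono (Function.support_mul_subset_left _ _) hp)
    refine ContMDiffAt.congr_of_eventuallyEq ((χ c).contMDiff.contMDiffAt.mul
      ((C.smooth (σ c p) T i).contMDiffAt ((C.isOpen_dom _).mem_nhds (hσ c p hpW)))) ?_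
    filter_upwards [hσc c p hpW] with q hq
    rw [hq]
    rfl
  let α : Fin (n + 1) → I → C.filt (t + 1) → Fn n M := fun c i T => ⟨_, hsm c T i⟩
  have hα : ∀ c i T p, α c i T p = χ c p * C.coord (σ c p) T i p := fun _ _ _ _ => rfl
  have hreal : ∀ (c : Fin (n + 1)) (i : I), ∃ T : P,
      (∀ p ∈ W c, ∀ i', C.coord (σ c p) T i' p = if i' = i then χ c p else 0) ∧
      ∀ p ∉ W c, ∀ i', C.coord p T i' p = 0 := by
    intro c i
    obtain ⟨T, h1, h2⟩ := C.realize (W c) (σ c) (hWo c) (hσ c) (hσc c)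
      (fun i' => if i' = i then χ c else 0) (by
        intro i'
        by_cases h : i' = i
        · simpa [h] using hχ c
        · simp only [h, if_false]
          intro p hp
          have h0 : tsupport (⇑(0 : Fn n M)) = ∅ := by
            rw [tsupport_eq_empty_iff]; rfl
          rw [h0] at hp
          exact hp.elim)
    refine ⟨T, fun p hp i' => ?_, h2⟩
    rw [h1 p hp]
    by_cases h : i' = i <;> simp [h]
  choose ε hε hε0 using hreal
  have hεmem : ∀ c i, C.deg i = t → ε c i ∈ C.filt (t + 1) := by
    intro c i hi
    refine C.mem_filt_of_exists fun p => ?_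
    by_cases hp : p ∈ W c
    · refine ⟨σ c p, hσ c p hp, fun i' hi' => ?_⟩
      rw [hε c i p hp, if_neg (by rintro rfl; omega)]
    · exact ⟨p, C.mem_dom p, fun i' _ => hε0 c i p hp i'⟩
  -- The coordinates of degree `t` are compared in the frame `σ c p` on `W c`. Off `W c` both `χ c`
  -- and the coordinates of the `ε c i` vanish.
  have hdiff : ∀ c (T : C.filt (t + 1)),
      (∑ i : {i // C.deg i = t}, α c i T • ε c i) - (χ c * χ c) • (T : P) ∈ C.filt t := by
    intro c T
    refine C.mem_filt_of_exists fun p => ?_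
    have hTt : ∀ p₀, p ∈ C.dom p₀ → ∀ i, t ≤ C.deg i → ∀ i', C.deg i < C.deg i' →
        C.coord p₀ T i' p = 0 := fun p₀ hp₀ i hi i' hi' => T.2 p p₀ hp₀ i' (by omega)
    by_cases hp : p ∈ W c
    · have hpd := hσ c p hp
      refine ⟨σ c p, hpd, fun i hi => ?_⟩
      rw [C.coord_sub hpd, C.coord_sum hpd, C.coord_smul _ _ _ _ hpd _ (hTt _ hpd i hi)]
      have h1 : ∀ i' : {i // C.deg i = t}, C.coord (σ c p) (α c i' T • ε c i') i p =
          if i = i' then χ c p * χ c p * C.coord (σ c p) T i p else 0 := by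
        intro i'
        rw [C.coord_smul _ _ _ _ hpd _ fun i'' hi'' => by
          rw [hε c i' p hp, if_neg]; rintro rfl; have := i'.2; omega, hε c i' p hp, hα]
        by_cases h : i = i'
        · simp only [h, if_true]; ring
        · simp [h]
      rw [Finset.sum_congr rfl fun i' _ => h1 i']
      by_cases hit : C.deg i = t
      · rw [Finset.sum_eq_single ⟨i, hit⟩]
        · simp
        · intro b _ hb
          rw [if_neg]; rintro rfl; exact hb rfl
        · simp
      · rw [Finset.sum_eq_zero, T.2 p _ hpd i (by omega)]
        · simp
        · intro b _
          rw [if_neg]; rintro rfl; exact hit b.2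
    · have hpd := C.mem_dom p
      refine ⟨p, hpd, fun i hi => ?_⟩
      rw [C.coord_sub hpd, C.coord_sum hpd, C.coord_smul _ _ _ _ hpd _ (hTt _ hpd i hi)]
      rw [Finset.sum_eq_zero]
      · have : (χ c * χ c) p = χ c p * χ c p := rfl
        rw [this, hχ0 c p hp]; simp
      · intro i' _
        rw [C.coord_smul _ _ _ _ hpd _ fun i'' _ => hε0 c i' p hp i'', hε0 c i' p hp, mul_zero]
  have hαlin : ∀ c i, C.deg i = t → ∀ p, p ∈ W c → ∀ (f : Fn n M) (T : C.filt (t + 1)),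
      C.coord (σ c p) (f • (T : P)) i p = f p * C.coord (σ c p) T i p := by
    intro c i hi p hp f T
    exact C.coord_smul f T _ p (hσ c p hp) i fun i' hi' => T.2 p _ (hσ c p hp) i' (by omega)
  let αl : ∀ c (i : {i // C.deg i = t}), C.filt (t + 1) →ₗ[Fn n M] Fn n M := fun c i =>
    { toFun := α c i
      map_add' := by
        intro T T'
        ext p
        change α c i (T + T') p = α c i T p + α c i T' p
        simp only [hα]
        by_cases hp : p ∈ W c
        · rw [Submodule.coe_add, C.coord_add _ _ (hσ c p hp)]; ring
        · rw [hχ0 c p hp]; ring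
      map_smul' := by
        intro f T
        ext p
        change α c i (f • T) p = f p * α c i T p
        simp only [hα]
        by_cases hp : p ∈ W c
        · rw [Submodule.coe_smul, hαlin c i i.2 p hp]; ring
        · rw [hχ0 c p hp]; ring }
  -- Indexing through `Fin N` puts the index type into `Type`, whatever the universe of `I`.
  refine ⟨Fin (n + 1) × {j : Fin N // C.deg (eI.symm j) = t}, inferInstance,
    fun a => αl a.1 ⟨eI.symm a.2, a.2.2⟩,
    fun a => v • ⟨ε a.1 (eI.symm a.2), hεmem _ _ a.2.2⟩, fun T => ?_, fun a T hT => ?_⟩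
  · have h1 : (T : P) = v • u • (T : P) := by rw [smul_smul, hvu, one_smul]
    have h2 : ∑ a : Fin (n + 1) × {j : Fin N // C.deg (eI.symm j) = t},
        αl a.1 ⟨eI.symm a.2, a.2.2⟩ T •
          ((v • ⟨ε a.1 (eI.symm a.2), hεmem _ _ a.2.2⟩ : C.filt (t + 1)) : P) =
        v • ∑ c, ∑ i : {i // C.deg i = t}, α c i T • ε c i := by
      rw [Fintype.sum_prod_type, Finset.smul_sum]
      refine Finset.sum_congr rfl fun c _ => ?_
      rw [Finset.smul_sum]
      refine Fintype.sum_equiv (eI.symm.subtypeEquiv fun j => Iff.rfl) _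
        (fun i : {i // C.deg i = t} => v • α c i T • ε c i) fun j => ?_
      rw [Submodule.coe_smul, smul_comm]
      rfl
    simp only []
    rw [h2]
    conv in (T : P) - _ => rw [h1]
    rw [← smul_sub]
    refine Submodule.smul_mem _ _ ?_
    rw [← neg_mem_iff, neg_sub, Finset.sum_smul, ← Finset.sum_sub_distrib]
    exact sum_mem fun c _ => hdiff c T
  · ext p
    change χ a.1 p * C.coord (σ a.1 p) T (eI.symm a.2) p = 0
    by_cases hp : p ∈ W a.1
    · rw [hT p _ (hσ _ p hp) _ a.2.2.ge, mul_zero]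
    · rw [hχ0 _ p hp, zero_mul]

/-- Subtract the expansion in the dual basis of degree `t`; the functionals vanish on `C.filt t`, so
nothing changes there. -/
theorem exists_retraction_step [Finite I] [T2Space M] [SecondCountableTopology M]
    [IsManifold (𝓡 n) ∞ M] (t : ℕ) :
    ∃ ρ : C.filt (t + 1) →ₗ[Fn n M] C.filt t, ∀ T : C.filt (t + 1), (T : P) ∈ C.filt t →
      (ρ T : P) = T := by
  obtain ⟨ι, _, α, ε, h1, h2⟩ := C.exists_dual_basis_step t
  refine ⟨LinearMap.codRestrict (C.filt t) ((C.filt (t + 1)).subtype -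
    ∑ a, (α a).smulRight (ε a : P)) fun T => ?_, fun T hT => ?_⟩
  · simpa using h1 T
  · simp [h2 _ T hT]

theorem exists_retraction [Finite I] [T2Space M] [SecondCountableTopology M]
    [IsManifold (𝓡 n) ∞ M] (t m : ℕ) :
    ∃ ρ : C.filt (t + m) →ₗ[Fn n M] C.filt t, ∀ T : C.filt (t + m), (T : P) ∈ C.filt t →
      (ρ T : P) = T := by
  induction m with
  | zero => exact ⟨LinearMap.id, fun _ _ => rfl⟩
  | succ m ih =>
    obtain ⟨ρ, hρ⟩ := ih
    obtain ⟨ρ', hρ'⟩ := C.exists_retraction_step (t + m)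
    refine ⟨ρ ∘ₗ ρ', fun T hT => ?_⟩
    have h := hρ' T (C.filt_mono (Nat.le_add_right t m) hT)
    change (ρ (ρ' T) : P) = T
    rw [hρ _ (by rw [h]; exact hT), h]

/-- An element is recovered from its remainder of lower degree and its finitely many leading
coefficients. So `C.filt (t + 1)` is a retract of `C.filt t` plus a finite free module. -/
theorem finite_projective_filt [Finite I] [T2Space M] [SecondCountableTopology M]
    [IsManifold (𝓡 n) ∞ M] (t : ℕ) :
    Module.Finite (Fn n M) (C.filt t) ∧ Module.Projective (Fn n M) (C.filt t) := by
  induction t with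
  | zero =>
    rw [C.filt_zero]
    exact ⟨inferInstance, inferInstance⟩
  | succ t ih =>
    obtain ⟨_, _⟩ := ih
    obtain ⟨ι, _, α, ε, h1, h2⟩ := C.exists_dual_basis_step t
    let ρ : C.filt (t + 1) →ₗ[Fn n M] C.filt t :=
      LinearMap.codRestrict (C.filt t) ((C.filt (t + 1)).subtype -
        ∑ a, (α a).smulRight (ε a : P)) fun T => by simpa using h1 T
    let f : C.filt (t + 1) →ₗ[Fn n M] C.filt t × (ι → Fn n M) := ρ.prod (LinearMap.pi α)
    let g : C.filt t × (ι → Fn n M) →ₗ[Fn n M] C.filt (t + 1) :=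
      (Submodule.inclusion (C.filt_mono (Nat.le_succ t))).coprod
        (Fintype.linearCombination (Fn n M) ε)
    have hgf : g ∘ₗ f = LinearMap.id := by
      refine LinearMap.ext fun T => Subtype.ext ?_
      simp [f, g, ρ, Fintype.linearCombination_apply]
    refine ⟨Module.Finite.of_surjective g fun T => ⟨f T, LinearMap.congr_fun hgf T⟩,
      Module.Projective.of_split f g hgf⟩

theorem exists_filt_eq_top [Finite I] : ∃ m, ∀ t, m ≤ t → C.filt t = ⊤ := by
  have := Fintype.ofFinite I
  refine ⟨Finset.univ.sup C.deg + 1, fun t ht => eq_top_iff.2 fun T _ p p₀ hp i hi => ?_⟩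
  have := Finset.le_sup (f := C.deg) (Finset.mem_univ i)
  omega

theorem finite_projective (C : GradedCoords n M P I) [Finite I] [T2Space M] [SecondCountableTopology M]
    [IsManifold (𝓡 n) ∞ M] :
    Module.Finite (Fn n M) P ∧ Module.Projective (Fn n M) P := by
  obtain ⟨m, hm⟩ := C.exists_filt_eq_top
  obtain ⟨h1, h2⟩ := C.finite_projective_filt m
  rw [hm m le_rfl] at h1 h2
  exact ⟨Module.Finite.equiv Submodule.topEquiv, Module.Projective.of_equiv Submodule.topEquiv⟩

/-- The filtration reaches the whole module after finitely many steps, and the step retractions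
compose to a projection onto `C.filt t`. -/
theorem exists_isCompl_filt [Finite I] [T2Space M] [SecondCountableTopology M]
    [IsManifold (𝓡 n) ∞ M] (t : ℕ) : ∃ Q, IsCompl (C.filt t) Q := by
  obtain ⟨m, hm⟩ := C.exists_filt_eq_top
  obtain ⟨ρ, hρ⟩ := C.exists_retraction t m
  have htop := hm (t + m) (Nat.le_add_left m t)
  let ι : P →ₗ[Fn n M] C.filt (t + m) :=
    LinearMap.codRestrict _ LinearMap.id fun T => by rw [htop]; trivial
  exact ⟨_, LinearMap.isCompl_of_proj (f := ρ ∘ₗ ι) fun T => Subtype.ext (hρ (ι T) T.2)⟩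

end GradedCoords

end GradedCoords

/-- A submodule mapped bijectively onto a complemented submodule is complemented. -/
theorem exists_isCompl_of_bijOn {R X Y : Type*} [Ring R] [AddCommGroup X] [Module R X]
    [AddCommGroup Y] [Module R Y] (f : X →ₗ[R] Y) (N : Submodule R X) {Q Q' : Submodule R Y}
    (hQ : IsCompl Q Q') (hf : Set.BijOn f N Q) : ∃ N', IsCompl N N' := by
  -- The preimage of the complement works: to split `x`, lift the `Q`-part of `f x` to `N` and
  -- subtract.
  refine ⟨Q'.comap f, ?_⟩
  rw [isCompl_iff, Submodule.disjoint_def, codisjoint_iff, eq_top_iff]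
  constructor
  · intro x hx hx'
    have h0 : f x = 0 := Submodule.disjoint_def.1 hQ.disjoint _ (hf.mapsTo hx) hx'
    exact hf.injOn hx N.zero_mem (by rw [h0, map_zero])
  · intro x _
    have : f x ∈ Q ⊔ Q' := by rw [hQ.sup_eq_top]; trivial
    obtain ⟨q, hq, q', hq', h⟩ := Submodule.mem_sup.1 this
    obtain ⟨y, hy, rfl⟩ := hf.surjOn hq
    refine Submodule.mem_sup.2 ⟨y, hy, x - y, ?_, by abel⟩
    rw [Submodule.mem_comap, map_sub, ← h]
    simpa using hq'

/-! ### Symmetry of iterated derivatives, and derivatives of exponentials. -/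

section Calculus

variable {V : Type*} [NormedAddCommGroup V] [NormedSpace ℝ V]

theorem differentiableAt_iteratedFDeriv {f : V → ℝ} {x : V} (hf : ContDiffAt ℝ ∞ f x) (j : ℕ) :
    DifferentiableAt ℝ (iteratedFDeriv ℝ j f) x :=
  (hf.iteratedFDeriv_right (m := ∞) (i := j) (mod_cast le_top)).differentiableAt (by simp)

theorem contDiffAt_iteratedFDeriv_apply {f : V → ℝ} {x : V} (hf : ContDiffAt ℝ ∞ f x) {j : ℕ}
    (v : Fin j → V) : ContDiffAt ℝ ∞ (fun y => iteratedFDeriv ℝ j f y v) x :=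
  ((ContinuousMultilinearMap.apply ℝ (fun _ : Fin j => V) ℝ v).contDiff.contDiffAt).comp x
    (hf.iteratedFDeriv_right (m := ∞) (i := j) (mod_cast le_top))

/-- Iterated derivatives of a smooth real function are symmetric. -/
theorem iteratedFDeriv_comp_perm_of_smooth {f : V → ℝ} {j : ℕ} (σ : Equiv.Perm (Fin j)) {x : V}
    (hf : ∀ᶠ y in nhds x, ContDiffAt ℝ ∞ f y) (v : Fin j → V) :
    iteratedFDeriv ℝ j f x (v ∘ σ) = iteratedFDeriv ℝ j f x v := by
  induction j generalizing x with
  | zero => congr 1; ext m; exact m.elim0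
  | succ j ih =>
    -- Transpositions of neighbours generate the permutations, so it suffices to swap two adjacent
    -- slots.
    have hσ : σ ∈ Submonoid.closure
        (Set.range fun i : Fin j => Equiv.swap i.castSucc i.succ) := by
      rw [Equiv.Perm.mclosure_swap_castSucc_succ]; trivial
    induction hσ using Submonoid.closure_induction generalizing v with
    | one => rfl
    | mul σ τ _ _ hσ hτ =>
      have : v ∘ ⇑(σ * τ) = (v ∘ σ) ∘ τ := rfl
      rw [this, hτ, hσ]
    | mem σ h =>
      obtain ⟨i, rfl⟩ := h
      have hx := hf.self_of_nhds
      rw [(differentiableAt_iteratedFDeriv hx j).iteratedFDeriv_succ_apply_left',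
        (differentiableAt_iteratedFDeriv hx j).iteratedFDeriv_succ_apply_left']
      cases j with
      | zero => exact i.elim0
      | succ j =>
        induction i using Fin.cases with
        | zero =>
          -- Swapping the first two slots is the symmetry of the second derivative of the function
          -- obtained by freezing the other slots.
          have h2 : ∀ m : Fin (j + 2) → V,
              fderiv ℝ (fun y => iteratedFDeriv ℝ (j + 1) f y (Fin.tail m)) x (m 0) =
              fderiv ℝ (fderiv ℝ (fun y => iteratedFDeriv ℝ j f y (Fin.tail (Fin.tail m)))) x
                (m 0) (m 1) := by
            intro m
            have hG := contDiffAt_iteratedFDeriv_apply hx (Fin.tail (Fin.tail m))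
            have : (fun y => iteratedFDeriv ℝ (j + 1) f y (Fin.tail m)) =ᶠ[nhds x]
                fun y => fderiv ℝ (fun y => iteratedFDeriv ℝ j f y (Fin.tail (Fin.tail m))) y
                  (m 1) := by
              filter_upwards [hf] with y hy
              rw [(differentiableAt_iteratedFDeriv hy j).iteratedFDeriv_succ_apply_left']
              rfl
            rw [this.fderiv_eq, fderiv_clm_apply
              ((hG.fderiv_right (m := ∞) (by simp)).differentiableAt (by simp))
              (differentiableAt_const _)]
            simp
          rw [h2, h2]
          have ht : Fin.tail (Fin.tail (v ∘ ⇑(Equiv.swap (0 : Fin (j + 1)).castSucc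
              (0 : Fin (j + 1)).succ))) = Fin.tail (Fin.tail v) := by
            funext m
            simp only [Fin.tail, Function.comp_apply]
            rw [Equiv.swap_apply_of_ne_of_ne] <;> simp [Fin.ext_iff]
          have h0 : (v ∘ ⇑(Equiv.swap (0 : Fin (j + 1)).castSucc (0 : Fin (j + 1)).succ)) 0 =
              v 1 := by
            simp
          have h1 : (v ∘ ⇑(Equiv.swap (0 : Fin (j + 1)).castSucc (0 : Fin (j + 1)).succ)) 1 =
              v 0 := by
            simp
          rw [ht, h0, h1]
          exact ((contDiffAt_iteratedFDeriv_apply hx _).isSymmSndFDerivAt (by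
            rw [minSmoothness_of_isRCLikeNormedField]; exact ENat.LEInfty.out)) _ _
        | succ i =>
          have h0 : (v ∘ ⇑(Equiv.swap i.succ.castSucc i.succ.succ)) 0 = v 0 := by
            simp only [Function.comp_apply]
            rw [Equiv.swap_apply_of_ne_of_ne] <;> simp [Fin.ext_iff]
          have ht : Fin.tail (v ∘ ⇑(Equiv.swap i.succ.castSucc i.succ.succ)) =
              Fin.tail v ∘ ⇑(Equiv.swap i.castSucc i.succ) := by
            funext m
            simp only [Fin.tail, Function.comp_apply]
            congr 1
            have hinj := Fin.succ_injective (j + 1)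
            rw [← Fin.succ_castSucc, ← hinj.map_swap]
          rw [h0, ht]
          congr 1
          -- The first slot is untouched, so the induction hypothesis is differentiated once. This
          -- needs it on a neighbourhood, which is why smoothness is assumed near `x` and not only
          -- at `x`.
          refine Filter.EventuallyEq.fderiv_eq ?_
          filter_upwards [hf.eventually_nhds] with y hy
          exact ih _ hy _

/-- Differentiating in direction `v` multiplies the exponential by `L v`. Derivatives thereby become
monomials, which is what separates the frame elements later. -/
theorem iteratedFDeriv_exp_clm (L : V →L[ℝ] ℝ) (c : ℝ) (j : ℕ) (x : V) (v : Fin j → V) :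
    iteratedFDeriv ℝ j (fun y => Real.exp (L y - c)) x v =
      (∏ m, L (v m)) * Real.exp (L x - c) := by
  induction j generalizing x with
  | zero => simp
  | succ j ih =>
    have hs : ContDiff ℝ ∞ fun y => Real.exp (L y - c) :=
      (L.contDiff.sub contDiff_const).exp
    rw [(differentiableAt_iteratedFDeriv hs.contDiffAt j).iteratedFDeriv_succ_apply_left']
    simp only [ih]
    have hd : HasFDerivAt (fun y => Real.exp (L y - c)) (Real.exp (L x - c) • L) x :=
      (L.hasFDerivAt.sub_const c).exp
    rw [(hd.const_mul _).fderiv, Fin.prod_univ_succ]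
    simp only [Fin.tail, smul_apply, smul_eq_mul]
    ring

end Calculus

/-! ### Extending local functions and frames to global ones. -/

section Sections


variable {n : ℕ} {M : Type*} [TopologicalSpace M] [T2Space M] [ChartedSpace (Rn n) M]
  [IsManifold (𝓡 n) ∞ M]

theorem exists_cutoff {q : M} {u : Set M} (hu : u ∈ nhds q) :
    ∃ χ : Fn n M, χ =ᶠ[nhds q] 1 ∧ tsupport χ ⊆ u := by
  obtain ⟨f, -, hf⟩ := (SmoothBumpFunction.nhds_basis_tsupport (I := 𝓡 n) q).mem_iff.1 hu
  exact ⟨⟨f, f.contMDiff⟩, f.eventuallyEq_one, hf⟩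

/-- A function smooth on an open set agrees near each of its points with a global smooth
function. -/
theorem exists_fn_eventuallyEq {g : M → ℝ} {u : Set M} (hu : IsOpen u)
    (hg : ContMDiffOn (𝓡 n) 𝓘(ℝ) ∞ g u) {q : M} (hq : q ∈ u) :
    ∃ f : Fn n M, f =ᶠ[nhds q] g := by
  obtain ⟨χ, h1, h2⟩ := exists_cutoff (n := n) (hu.mem_nhds hq)
  refine ⟨⟨fun p => χ p * g p, contMDiff_of_tsupport fun p hp => ?_⟩, ?_⟩
  · have : p ∈ u := h2 (closure_mono (Function.support_mul_subset_left _ _) hp)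
    exact χ.contMDiff.contMDiffAt.mul (hg.contMDiffAt (hu.mem_nhds this))
  · filter_upwards [h1] with p hp
    change χ p * g p = g p
    rw [hp]; simp

variable {d : ℕ} {E : M → Type*} [TopologicalSpace (TotalSpace (Rn d) E)]
  [∀ x, AddCommGroup (E x)] [∀ x, Module ℝ (E x)] [∀ x, TopologicalSpace (E x)]
  [FiberBundle (Rn d) E] [VectorBundle ℝ (Rn d) E]
  [ContMDiffVectorBundle ∞ (Rn d) E (𝓡 n)]

/-- The standard basis of `ℝᵈ`. -/
abbrev stdBasis (d : ℕ) : Basis (Fin d) ℝ (Rn d) := (EuclideanSpace.basisFun (Fin d) ℝ).toBasis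

theorem stdBasis_apply (d : ℕ) (m : Fin d) : stdBasis d m = EuclideanSpace.single m 1 := by
  simp [stdBasis]

/-- The members of a local frame agree near each point with global sections. -/
theorem exists_section_eventuallyEq {p₀ q : M} (hq : q ∈ (trivializationAt (Rn d) E p₀).baseSet)
    (m : Fin d) : ∃ s : Cₛ^∞⟮𝓡 n; Rn d, E⟯, ∀ᶠ p in nhds q,
      s p = (trivializationAt (Rn d) E p₀).symm p (EuclideanSpace.single m 1) := by
  let e := trivializationAt (Rn d) E p₀
  obtain ⟨χ, h1, h2⟩ := exists_cutoff (n := n) (e.open_baseSet.mem_nhds hq)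
  have hs := ContMDiffOn.smul_section_of_tsupport (I := 𝓡 n) (F := Rn d) (V := E)
    (χ.contMDiff.contMDiffOn (s := e.baseSet)) e.open_baseSet h2
    (s := e.localFrame (stdBasis d) m) fun p hp =>
      (contMDiffAt_localFrame_of_mem (I := 𝓡 n) ∞ e (stdBasis d) m hp).contMDiffWithinAt
  refine ⟨⟨_, hs⟩, ?_⟩
  filter_upwards [h1, e.open_baseSet.mem_nhds hq] with p hp hpe
  change χ p • e.localFrame (stdBasis d) m p = _
  rw [hp, e.localFrame_apply_of_mem_baseSet _ hpe, Pi.one_apply, one_smul]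
  simp [Trivialization.basisAt, e]

/-- Sections expand in a local frame with smooth coefficients. -/
theorem exists_local_coeffs (p₀ : M) (s : Cₛ^∞⟮𝓡 n; Rn d, E⟯) :
    ∃ a : Fin d → M → ℝ,
      (∀ m, ContMDiffOn (𝓡 n) 𝓘(ℝ) ∞ (a m) (trivializationAt (Rn d) E p₀).baseSet) ∧
      ∀ p ∈ (trivializationAt (Rn d) E p₀).baseSet, s p = ∑ m, a m p •
        (trivializationAt (Rn d) E p₀).symm p (EuclideanSpace.single m 1) := by
  let e := trivializationAt (Rn d) E p₀
  let b := stdBasis d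
  have : ContMDiffVectorBundle 1 (Rn d) E (𝓡 n) :=
    ContMDiffVectorBundle.of_le (n := ∞) (by simp)
  refine ⟨fun m p => e.localFrameCoeff (𝓡 n) b m p (s p), fun m p hp => ?_, fun p hp => ?_⟩
  · exact (contMDiffAt_localFrameCoeff (e := e) b hp s.contMDiff.contMDiffAt m).contMDiffWithinAt
  · have := e.eq_sum_localFrameCoeff_smul (I := 𝓡 n) (b := b) (s := fun x => s x) hp
    refine this.trans (Finset.sum_congr rfl fun m _ => ?_)
    rw [e.localFrame_apply_of_mem_baseSet b hp]
    simp [Trivialization.basisAt, e, b]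

theorem exists_section_eventuallyEq_symm {p₀ q : M}
    (hq : q ∈ (trivializationAt (Rn d) E p₀).baseSet) (v : Rn d) :
    ∃ s : Cₛ^∞⟮𝓡 n; Rn d, E⟯, ∀ᶠ p in nhds q, s p = (trivializationAt (Rn d) E p₀).symm p v := by
  let e := trivializationAt (Rn d) E p₀
  choose s hs using fun m => exists_section_eventuallyEq (n := n) (E := E) hq m
  refine ⟨∑ m, v m • s m, ?_⟩
  filter_upwards [Filter.eventually_all.2 hs, e.open_baseSet.mem_nhds hq] with p hp hpe
  have h2 : (∑ m, v m • s m) p = ∑ m, v m • s m p := by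
    have := congrFun (map_sum (ContMDiffSection.coeAddHom (𝓡 n) (Rn d) ∞ E)
      (fun m => v m • s m) Finset.univ) p
    rw [Finset.sum_apply] at this
    exact this
  rw [h2, ← e.symmₗ_apply (R := ℝ) hpe]
  conv_rhs => rw [← (stdBasis d).sum_repr v, map_sum]
  refine Finset.sum_congr rfl fun m _ => ?_
  rw [hp m, map_smul, stdBasis_apply, e.symmₗ_apply hpe]
  simp [stdBasis, e]

/-- Every vector of a fibre is the value of a global section. -/
theorem exists_section_apply_eq (p : M) (v : E p) : ∃ s : Cₛ^∞⟮𝓡 n; Rn d, E⟯, s p = v := by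
  let e := trivializationAt (Rn d) E p
  have hp : p ∈ e.baseSet := FiberBundle.mem_baseSet_trivializationAt' p
  obtain ⟨s, hs⟩ := exists_section_eventuallyEq_symm (n := n) (E := E) hp (e.linearMapAt ℝ p v)
  refine ⟨s, hs.self_of_nhds.trans ?_⟩
  rw [← e.symmₗ_apply (R := ℝ) hp, e.symmₗ_linearMapAt hp]

end Sections

/-! ### Partial derivatives of components as functionals. -/

section Frames

variable {n : ℕ} {M : Type*} [TopologicalSpace M] [ChartedSpace (Rn n) M] [IsManifold (𝓡 n) ∞ M]
  {d : ℕ} {E : M → Type*} [TopologicalSpace (TotalSpace (Rn d) E)]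
  [∀ x, AddCommGroup (E x)] [∀ x, Module ℝ (E x)] [∀ x, TopologicalSpace (E x)]
  [∀ x, IsTopologicalAddGroup (E x)] [∀ x, ContinuousSMul ℝ (E x)]
  [FiberBundle (Rn d) E] [VectorBundle ℝ (Rn d) E]

/-- The component `η_K`, read in the chart at `p₀`. -/
def compFn {k : ℕ} (p₀ : M) (K : Fin k → Fin d) (η : Form n d E k) : Rn n → ℝ := fun x =>
  η.1 ((chartAt (Rn n) p₀).symm x) fun l =>
    (trivializationAt (Rn d) E p₀).symm ((chartAt (Rn n) p₀).symm x) (EuclideanSpace.single (K l) 1)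

/-- The partial derivative `∂_w η_K` at `p` for an arbitrary word `w`. -/
def wordD {k j : ℕ} (p₀ : M) (K : Fin k → Fin d) (w : Fin j → Fin n) (p : M) (η : Form n d E k) :
    ℝ :=
  iteratedFDeriv ℝ j (compFn p₀ K η) (chartAt (Rn n) p₀ p) fun m => EuclideanSpace.single (w m) 1

theorem frame_eq_wordD {r k : ℕ} (p₀ : M) (i : Idx n d r k) (p : M) (η : Form n d E k) :
    frame p₀ i p η = wordD p₀ i.2 i.1.2 p η := rfl

theorem isOpen_dom (p₀ : M) : IsOpen (dom n d E p₀) :=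
  (chartAt (Rn n) p₀).open_source.inter (trivializationAt (Rn d) E p₀).open_baseSet

theorem mem_dom_self (p₀ : M) : p₀ ∈ dom n d E p₀ :=
  ⟨mem_chart_source _ p₀, FiberBundle.mem_baseSet_trivializationAt' p₀⟩

variable {k j : ℕ} {p₀ p : M}

theorem eventually_contDiffAt_compFn (hp : p ∈ dom n d E p₀) (K : Fin k → Fin d)
    (η : Form n d E k) :
    ∀ᶠ y in nhds (chartAt (Rn n) p₀ p), ContDiffAt ℝ ∞ (compFn p₀ K η) y := by
  let φ := chartAt (Rn n) p₀
  let u := φ.target ∩ φ.symm ⁻¹' (trivializationAt (Rn d) E p₀).baseSet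
  have hu : IsOpen u := φ.isOpen_inter_preimage_symm (trivializationAt (Rn d) E p₀).open_baseSet
  have hs : ContDiffOn ℝ ∞ (compFn p₀ K η) u := by
    rw [← contMDiffOn_iff_contDiffOn]
    exact (η.2 p₀ fun l => EuclideanSpace.single (K l) 1).comp
      ((contMDiffOn_chart_symm (x := p₀) (n := ∞)).mono fun x hx => hx.1) fun x hx => hx.2
  have hpu : φ p ∈ u := ⟨φ.map_source hp.1, by simpa [φ.left_inv hp.1] using hp.2⟩
  filter_upwards [hu.mem_nhds hpu] with y hy
  exact hs.contDiffAt (hu.mem_nhds hy)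

theorem contDiffAt_compFn (hp : p ∈ dom n d E p₀) (K : Fin k → Fin d) (η : Form n d E k) :
    ContDiffAt ℝ ∞ (compFn p₀ K η) (chartAt (Rn n) p₀ p) :=
  (eventually_contDiffAt_compFn hp K η).self_of_nhds

theorem contMDiffAt_wordD (hp : p ∈ dom n d E p₀) (K : Fin k → Fin d) (w : Fin j → Fin n)
    (η : Form n d E k) : ContMDiffAt (𝓡 n) 𝓘(ℝ) ∞ (fun q => wordD p₀ K w q η) p := by
  have h1 := contDiffAt_iteratedFDeriv_apply (contDiffAt_compFn hp K η)
    (fun m => EuclideanSpace.single (w m) (1 : ℝ))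
  exact h1.contMDiffAt.comp p (contMDiffAt_of_mem_maximalAtlas (n := ∞)
    (IsManifold.chart_mem_maximalAtlas p₀) hp.1)

theorem mfderiv_chart_symm (hp : p ∈ (chartAt (Rn n) p₀).source) (v : Rn n) :
    mfderiv (𝓡 n) 𝓘(ℝ, Rn n) (chartAt (Rn n) p₀) p
      ((trivializationAt (Rn n) (TangentSpace (𝓡 n)) p₀).symm p v) = v := by
  have h1 := TangentBundle.continuousLinearMapAt_trivializationAt (I := 𝓡 n) hp
  have h2 : (extChartAt (𝓡 n) p₀ : M → Rn n) = chartAt (Rn n) p₀ := by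
    ext1 q; simp [extChartAt]
  rw [h2] at h1
  have hb : p ∈ (trivializationAt (Rn n) (TangentSpace (𝓡 n)) p₀).baseSet := hp
  have h3 := (trivializationAt (Rn n) (TangentSpace (𝓡 n)) p₀).continuousLinearMapAt_symmL
    (R := ℝ) hb v
  rw [h1] at h3
  rw [← Trivialization.symmL_apply (R := ℝ) _ hb]
  exact h3

/-- The tangent trivialization at `p₀` is the derivative of the chart, so its frame vectors are the
coordinate vector fields; differentiating along one of them prepends its letter. -/
theorem mvfderiv_wordD (hp : p ∈ dom n d E p₀) (K : Fin k → Fin d) (w : Fin j → Fin n)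
    (η : Form n d E k) (m : Fin n) :
    mvfderiv (𝓡 n) (fun q => wordD p₀ K w q η) p
      ((trivializationAt (Rn n) (TangentSpace (𝓡 n)) p₀).symm p (EuclideanSpace.single m 1)) =
      wordD p₀ K (Fin.cons m w : Fin (j + 1) → Fin n) p η := by
  let G : Rn n → ℝ := fun x =>
    iteratedFDeriv ℝ j (compFn p₀ K η) x fun m => EuclideanSpace.single (w m) 1
  have hG : ContDiffAt ℝ ∞ G (chartAt (Rn n) p₀ p) :=
    contDiffAt_iteratedFDeriv_apply (contDiffAt_compFn hp K η) _
  have hφ : MDifferentiableAt (𝓡 n) 𝓘(ℝ, Rn n) (chartAt (Rn n) p₀) p :=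
    (contMDiffAt_of_mem_maximalAtlas (n := ∞)
      (IsManifold.chart_mem_maximalAtlas p₀) hp.1).mdifferentiableAt (by simp)
  have h1 := mvfderiv_comp_apply (g := G) (f := chartAt (Rn n) p₀) p
    (hG.differentiableAt (by simp)).mdifferentiableAt hφ
    ((trivializationAt (Rn n) (TangentSpace (𝓡 n)) p₀).symm p (EuclideanSpace.single m 1))
  rw [mfderiv_chart_symm hp.1] at h1
  refine h1.trans ?_
  unfold wordD
  rw [(differentiableAt_iteratedFDeriv (contDiffAt_compFn hp K η) j).iteratedFDeriv_succ_apply_left']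
  change (mfderiv 𝓘(ℝ, Rn n) 𝓘(ℝ) G _) _ = _
  rw [mfderiv_eq_fderiv]
  rfl

theorem compFn_add (K : Fin k → Fin d) (η θ : Form n d E k) :
    compFn p₀ K (η + θ) = compFn p₀ K η + compFn p₀ K θ := rfl

theorem compFn_smul (K : Fin k → Fin d) (c : ℝ) (η : Form n d E k) :
    compFn p₀ K (c • η) = c • compFn p₀ K η := rfl

open Classical in
/-- The functional `η ↦ ∂_w η_K (p)`, with the value `0` outside the domain of the frame. -/
def wordL (p₀ : M) (K : Fin k → Fin d) (w : Fin j → Fin n) (p : M) : Form n d E k →ₗ[ℝ] ℝ :=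
  if hp : p ∈ dom n d E p₀ then
    { toFun := wordD p₀ K w p
      map_add' := fun η θ => by
        have h : ∀ η : Form n d E k, ContDiffAt ℝ j (compFn p₀ K η) (chartAt (Rn n) p₀ p) :=
          fun η => (contDiffAt_compFn hp K η).of_le (mod_cast le_top)
        unfold wordD
        rw [compFn_add, iteratedFDeriv_add_apply (h η) (h θ)]
        rfl
      map_smul' := fun c η => by
        have h : ContDiffAt ℝ j (compFn p₀ K η) (chartAt (Rn n) p₀ p) :=
          (contDiffAt_compFn hp K η).of_le (mod_cast le_top)
        unfold wordD
        rw [compFn_smul, iteratedFDeriv_const_smul_apply h]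
        rfl }
  else 0

theorem wordL_apply (hp : p ∈ dom n d E p₀) (K : Fin k → Fin d) (w : Fin j → Fin n)
    (η : Form n d E k) : wordL p₀ K w p η = wordD p₀ K w p η := by
  simp [wordL, hp]

/-- The local frame as linear functionals. -/
def frameL {r : ℕ} (p₀ : M) (i : Idx n d r k) (p : M) : Form n d E k →ₗ[ℝ] ℝ :=
  wordL p₀ i.2 i.1.2 p

theorem frameL_apply {r : ℕ} (hp : p ∈ dom n d E p₀) (i : Idx n d r k) (η : Form n d E k) :
    frameL p₀ i p η = frame p₀ i p η := wordL_apply hp _ _ η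

theorem wordL_comp_perm (hp : p ∈ dom n d E p₀) (K : Fin k → Fin d) (w : Fin j → Fin n)
    (σ : Equiv.Perm (Fin j)) : (wordL p₀ K (w ∘ σ) p : Form n d E k →ₗ[ℝ] ℝ) = wordL p₀ K w p := by
  ext η
  rw [wordL_apply hp, wordL_apply hp]
  exact iteratedFDeriv_comp_perm_of_smooth σ (eventually_contDiffAt_compFn hp K η)
    fun m => EuclideanSpace.single (w m) 1

theorem wordL_comp_perm_right (hp : p ∈ dom n d E p₀) (K : Fin k → Fin d) (w : Fin j → Fin n)
    (σ : Equiv.Perm (Fin k)) : (wordL p₀ (K ∘ σ) w p : Form n d E k →ₗ[ℝ] ℝ) =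
      (((Equiv.Perm.sign σ : ℤˣ) : ℤ) : ℝ) • wordL p₀ K w p := by
  ext η
  have hc : compFn p₀ (K ∘ σ) η = (((Equiv.Perm.sign σ : ℤˣ) : ℤ) : ℝ) • compFn p₀ K η := by
    funext x
    have := (η.1 ((chartAt (Rn n) p₀).symm x)).map_perm (fun l =>
      (trivializationAt (Rn d) E p₀).symm ((chartAt (Rn n) p₀).symm x)
        (EuclideanSpace.single (K l) 1)) σ
    refine this.trans ?_
    rw [Units.smul_def, ← Int.cast_smul_eq_zsmul ℝ]
    rfl
  rw [LinearMap.smul_apply, wordL_apply hp, wordL_apply hp]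
  unfold wordD
  rw [hc, iteratedFDeriv_const_smul_apply
    ((contDiffAt_compFn hp K η).of_le (mod_cast le_top))]
  rfl

theorem wordL_eq_zero (hp : p ∈ dom n d E p₀) {K : Fin k → Fin d} (hK : ¬ Function.Injective K)
    (w : Fin j → Fin n) : (wordL p₀ K w p : Form n d E k →ₗ[ℝ] ℝ) = 0 := by
  ext η
  have hc : compFn p₀ K η = 0 := by
    funext x
    refine AlternatingMap.map_eq_zero_of_not_injective _ _ fun h => hK fun a b hab => h ?_
    simp [hab]
  rw [wordL_apply hp]
  unfold wordD
  have : iteratedFDeriv ℝ j (0 : Rn n → ℝ) (chartAt (Rn n) p₀ p) = 0 := by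
    rw [Pi.zero_def, iteratedFDeriv_fun_zero]; rfl
  rw [hc, this]
  rfl

/-- Symmetry of derivatives sorts the word, and alternation sorts `K` up to a sign, or gives zero
when an index repeats. -/
theorem wordL_mem_span {r : ℕ} (hp : p ∈ dom n d E p₀) (hj : j ≤ r) (K : Fin k → Fin d)
    (w : Fin j → Fin n) : (wordL p₀ K w p : Form n d E k →ₗ[ℝ] ℝ) ∈
      Submodule.span ℝ (Set.range fun i : Idx n d r k => frameL p₀ i p) := by
  by_cases hK : Function.Injective K
  · have hsK : StrictMono (K ∘ Tuple.sort K) :=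
      (Tuple.monotone_sort K).strictMono_of_injective (hK.comp (Tuple.sort K).injective)
    have h1 : (frameL p₀ (r := r) (⟨⟨j, by omega⟩, ⟨w ∘ Tuple.sort w, Tuple.monotone_sort w⟩⟩,
        OrderEmbedding.ofStrictMono _ hsK) p : Form n d E k →ₗ[ℝ] ℝ) =
        (((Equiv.Perm.sign (Tuple.sort K) : ℤˣ) : ℤ) : ℝ) • wordL p₀ K w p := by
      rw [← wordL_comp_perm_right hp, ← wordL_comp_perm hp (K ∘ Tuple.sort K) w (Tuple.sort w)]
      rfl
    have h2 : (wordL p₀ K w p : Form n d E k →ₗ[ℝ] ℝ) =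
        (((Equiv.Perm.sign (Tuple.sort K) : ℤˣ) : ℤ) : ℝ) • frameL p₀ (r := r)
          (⟨⟨j, by omega⟩, ⟨w ∘ Tuple.sort w, Tuple.monotone_sort w⟩⟩,
            OrderEmbedding.ofStrictMono _ hsK) p := by
      rw [h1, smul_smul, ← Int.cast_mul, ← Units.val_mul, Int.units_mul_self]
      simp
    rw [h2]
    exact Submodule.smul_mem _ _ (Submodule.subset_span ⟨_, rfl⟩)
  · rw [wordL_eq_zero hp hK]
    exact zero_mem _

end Frames

/-! ### Covariant derivatives and partial derivatives span the same fibres. -/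

section LocalOperators

variable {n : ℕ} {M : Type*} [TopologicalSpace M] [ChartedSpace (Rn n) M] [IsManifold (𝓡 n) ∞ M]
  {d : ℕ} {E : M → Type*} [TopologicalSpace (TotalSpace (Rn d) E)]
  [∀ x, AddCommGroup (E x)] [∀ x, Module ℝ (E x)] [∀ x, TopologicalSpace (E x)]
  [∀ x, IsTopologicalAddGroup (E x)] [∀ x, ContinuousSMul ℝ (E x)]
  [FiberBundle (Rn d) E] [VectorBundle ℝ (Rn d) E]
  [ContMDiffVectorBundle ∞ (Rn d) E (𝓡 n)] [T2Space M]

theorem mvfderiv_congr_of_eventuallyEq {f g : M → ℝ} {p : M} (h : f =ᶠ[nhds p] g)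
    (v : TangentSpace (𝓡 n) p) : mvfderiv (𝓡 n) f p v = mvfderiv (𝓡 n) g p v :=
  DFunLike.congr_fun (h.mfderiv_eq (I := 𝓡 n) (I' := 𝓘(ℝ))) v

theorem wordD_zero {k : ℕ} {p₀ p : M} (hp : p ∈ dom n d E p₀) (K : Fin k → Fin d)
    (w : Fin 0 → Fin n) (η : Form n d E k) : wordD p₀ K w p η =
      η.1 p fun l => (trivializationAt (Rn d) E p₀).symm p (EuclideanSpace.single (K l) 1) := by
  have : ∀ x, x = p → (η.1 x fun l => (trivializationAt (Rn d) E p₀).symm x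
      (EuclideanSpace.single (K l) 1)) =
      η.1 p fun l => (trivializationAt (Rn d) E p₀).symm p (EuclideanSpace.single (K l) 1) := by
    rintro x rfl; rfl
  exact this _ ((chartAt (Rn n) p₀).left_inv hp.1)

/-- Operators of order at most `r` that are written in the frame around `p₀` with coefficients
smooth on its domain. -/
def LocOp (p₀ : M) (r k : ℕ) : Submodule ℝ (Form n d E k → M → ℝ) :=
  Submodule.span ℝ {R | ∃ a : M → ℝ, ContMDiffOn (𝓡 n) 𝓘(ℝ) ∞ a (dom n d E p₀) ∧
    ∃ j ≤ r, ∃ (w : Fin j → Fin n) (K : Fin k → Fin d), R = fun η p => a p * wordD p₀ K w p η}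

variable {k r : ℕ} {p₀ p : M}

theorem mul_wordD_mem_LocOp {a : M → ℝ} (ha : ContMDiffOn (𝓡 n) 𝓘(ℝ) ∞ a (dom n d E p₀)) {j : ℕ}
    (hj : j ≤ r) (w : Fin j → Fin n) (K : Fin k → Fin d) :
    (fun η p => a p * wordD p₀ K w p η : Form n d E k → M → ℝ) ∈ LocOp p₀ r k :=
  Submodule.subset_span ⟨a, ha, j, hj, w, K, rfl⟩

theorem LocOp_mono {r' : ℕ} (h : r ≤ r') : (LocOp p₀ r k : Submodule ℝ (Form n d E k → M → ℝ)) ≤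
    LocOp p₀ r' k :=
  Submodule.span_mono fun _ ⟨a, ha, j, hj, w, K, e⟩ => ⟨a, ha, j, hj.trans h, w, K, e⟩

theorem contMDiffAt_LocOp {R : Form n d E k → M → ℝ} (hR : R ∈ LocOp p₀ r k)
    (hp : p ∈ dom n d E p₀) (η : Form n d E k) : ContMDiffAt (𝓡 n) 𝓘(ℝ) ∞ (R η) p := by
  induction hR using Submodule.span_induction with
  | mem R h =>
    obtain ⟨a, ha, j, hj, w, K, rfl⟩ := h
    exact (ha.contMDiffAt ((isOpen_dom p₀).mem_nhds hp)).mul (contMDiffAt_wordD hp K w η)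
  | zero => exact contMDiffAt_const
  | add R S _ _ hR hS => exact hR.add hS
  | smul c R _ hR => exact contMDiffAt_const.mul hR

theorem mvfderiv_LocOp (X : VF n M) {R : Form n d E k → M → ℝ} (hR : R ∈ LocOp p₀ r k) :
    ∃ R' ∈ (LocOp p₀ (r + 1) k : Submodule ℝ (Form n d E k → M → ℝ)), ∀ η, ∀ p ∈ dom n d E p₀,
      mvfderiv (𝓡 n) (R η) p (X p) = R' η p := by
  have hmd : ∀ {R : Form n d E k → M → ℝ}, R ∈ LocOp p₀ r k → ∀ η, ∀ p ∈ dom n d E p₀,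
      MDifferentiableAt (𝓡 n) 𝓘(ℝ) (R η) p := fun hR η p hp =>
    (contMDiffAt_LocOp hR hp η).mdifferentiableAt (by simp)
  induction hR using Submodule.span_induction with
  | mem R h =>
    obtain ⟨a, ha, j, hj, w, K, rfl⟩ := h
    obtain ⟨c, hc, hX⟩ := exists_local_coeffs p₀ X
    have ho := isOpen_dom (n := n) (d := d) (E := E) p₀
    -- The coefficient is smooth only on the domain, so near each point it is replaced by a global
    -- function to which `contMDiff_lie` applies.
    have hda : ContMDiffOn (𝓡 n) 𝓘(ℝ) ∞ (fun p => mvfderiv (𝓡 n) a p (X p)) (dom n d E p₀) := by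
      intro p hp
      obtain ⟨f, hf⟩ := exists_fn_eventuallyEq ho ha hp
      refine ContMDiffAt.contMDiffWithinAt ?_
      refine ((contMDiff_lie X f) p).congr_of_eventuallyEq ?_
      filter_upwards [hf.eventuallyEq_nhds] with q hq
      exact mvfderiv_congr_of_eventuallyEq hq.symm (X q)
    refine ⟨(fun η p => mvfderiv (𝓡 n) a p (X p) * wordD p₀ K w p η) +
      ∑ m : Fin n, fun η p => (a p * c m p) *
        wordD p₀ K (Fin.cons m w : Fin (j + 1) → Fin n) p η, ?_, fun η p hp => ?_⟩
    · refine add_mem (mul_wordD_mem_LocOp hda (by omega) w K) (sum_mem fun m _ =>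
        mul_wordD_mem_LocOp (ha.mul ((hc m).mono fun q hq => hq.1)) (by omega) _ K)
    · have h1 := mvfderiv_mul (I := 𝓡 n)
        ((ha.contMDiffAt (ho.mem_nhds hp)).mdifferentiableAt (by simp))
        ((contMDiffAt_wordD hp K w η).mdifferentiableAt (by simp))
      have h2 := DFunLike.congr_fun h1 (X p)
      have h3 : mvfderiv (𝓡 n) (fun q => wordD p₀ K w q η) p (X p) =
          ∑ m, c m p * wordD p₀ K (Fin.cons m w : Fin (j + 1) → Fin n) p η := by
        rw [hX p hp.1, map_sum]
        refine Finset.sum_congr rfl fun m _ => ?_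
        rw [map_smul, mvfderiv_wordD hp, smul_eq_mul]
      refine h2.trans ?_
      change a p * mvfderiv (𝓡 n) (fun q => wordD p₀ K w q η) p (X p) +
        wordD p₀ K w p η * mvfderiv (𝓡 n) a p (X p) = _
      rw [h3, Pi.add_apply, Pi.add_apply, Finset.sum_apply, Finset.sum_apply, Finset.mul_sum,
        add_comm, mul_comm]
      congr 1
      exact Finset.sum_congr rfl fun m _ => by ring
  | zero =>
    refine ⟨0, zero_mem _, fun η p _ => ?_⟩
    change mvfderiv (𝓡 n) (0 : M → ℝ) p (X p) = 0
    rw [mvfderiv_zero]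
    rfl
  | add R S hRm hSm hR hS =>
    obtain ⟨R', hR', h1⟩ := hR
    obtain ⟨S', hS', h2⟩ := hS
    refine ⟨R' + S', add_mem hR' hS', fun η p hp => ?_⟩
    change mvfderiv (𝓡 n) (R η + S η) p (X p) = R' η p + S' η p
    rw [mvfderiv_add (hmd hRm η p hp) (hmd hSm η p hp), ← h1 η p hp, ← h2 η p hp]
    rfl
  | smul c R hRm hR =>
    obtain ⟨R', hR', h1⟩ := hR
    refine ⟨c • R', Submodule.smul_mem _ _ hR', fun η p hp => ?_⟩
    change mvfderiv (𝓡 n) ((fun _ : M => c) • R η) p (X p) = c * R' η p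
    rw [mvfderiv_smul mdifferentiableAt_const (hmd hRm η p hp), mvfderiv_const, ← h1 η p hp]
    simp

theorem pair_LocOp (p₀ : M) (s : Fin k → Cₛ^∞⟮𝓡 n; Rn d, E⟯) :
    ∃ R ∈ (LocOp p₀ 0 k : Submodule ℝ (Form n d E k → M → ℝ)), ∀ η, ∀ p ∈ dom n d E p₀,
      pair s η p = R η p := by
  choose a ha hs using fun i => exists_local_coeffs (n := n) p₀ (s i)
  refine ⟨∑ K : Fin k → Fin d, fun η p => (∏ i, a i (K i) p) * wordD p₀ K Fin.elim0 p η,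
    sum_mem fun K _ => mul_wordD_mem_LocOp ?_ le_rfl _ K, fun η p hp => ?_⟩
  · intro p hp
    exact (contMDiffAt_finsetProd fun i _ => ((ha i (K i)).mono fun q hq => hq.2).contMDiffAt
      ((isOpen_dom p₀).mem_nhds hp)).contMDiffWithinAt
  · rw [Finset.sum_apply, Finset.sum_apply]
    have h2 : (fun i => s i p) = fun i => ∑ m, a i m p •
        (trivializationAt (Rn d) E p₀).symm p (EuclideanSpace.single m 1) :=
      funext fun i => hs i p hp.2
    change η.1 p (fun i => s i p) = _
    rw [h2]
    have h3 := (η.1 p).toMultilinearMap.map_sum (fun i m => a i m p •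
        (trivializationAt (Rn d) E p₀).symm p (EuclideanSpace.single m 1))
    refine h3.trans (Finset.sum_congr rfl fun K _ => ?_)
    refine ((η.1 p).toMultilinearMap.map_smul_univ _ _).trans ?_
    rw [smul_eq_mul]
    congr 1
    rw [wordD_zero hp]
    rfl

variable (D₀ : CovariantDerivative (𝓡 n) (Rn n) (TangentSpace (𝓡 n) : M → Type _))
  [D₀.ContMDiffCovariantDerivative ∞]
  (D : CovariantDerivative (𝓡 n) (Rn d) E) [D.ContMDiffCovariantDerivative ∞]

/-- In the recursion only the derivative along `X 0` raises the order, and by one; the connection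
terms stay at order `j`. The base case expands the sections multilinearly in the frame. -/
theorem higherCov_LocOp (p₀ : M) (j : ℕ) (X : Fin j → VF n M) (s : Fin k → Cₛ^∞⟮𝓡 n; Rn d, E⟯) :
    ∃ R ∈ (LocOp p₀ j k : Submodule ℝ (Form n d E k → M → ℝ)), ∀ η, ∀ p ∈ dom n d E p₀,
      higherCov D₀ D j X s η p = R η p := by
  induction j generalizing s with
  | zero => exact pair_LocOp p₀ s
  | succ j ih =>
    obtain ⟨R, hR, h⟩ := ih (Fin.tail X) s
    obtain ⟨R', hR', h'⟩ := mvfderiv_LocOp (X 0) hR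
    choose A hA hA' using fun l => ih (Fin.tail X) (Function.update s l (cov D (X 0) (s l)))
    choose B hB hB' using fun i : Fin j =>
      ih (Function.update (Fin.tail X) i (cov D₀ (X 0) (Fin.tail X i))) s
    refine ⟨R' - ∑ l, A l - ∑ i, B i, ?_, fun η p hp => ?_⟩
    · exact sub_mem (sub_mem hR' (sum_mem fun l _ => LocOp_mono (Nat.le_succ j) (hA l)))
        (sum_mem fun i _ => LocOp_mono (Nat.le_succ j) (hB i))
    · have h1 : lie (X 0) (higherCov D₀ D j (Fin.tail X) s η) p = R' η p := by
        rw [← h' η p hp]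
        refine mvfderiv_congr_of_eventuallyEq ?_ (X 0 p)
        filter_upwards [(isOpen_dom p₀).mem_nhds hp] with q hq
        exact h η q hq
      have h2 : higherCov D₀ D (j + 1) X s η p = evalAt p (higherCov D₀ D (j + 1) X s η) := rfl
      rw [h2]
      simp only [higherCov, LinearMap.sub_apply, LinearMap.comp_apply, LinearMap.sum_apply, map_sub,
        map_sum]
      simp only [evalAt, LinearMap.coe_mk, AddHom.coe_mk, Pi.sub_apply, Finset.sum_apply]
      rw [h1, Finset.sum_congr rfl fun l _ => hA' l η p hp,
        Finset.sum_congr rfl fun l _ => hB' l η p hp]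

theorem U_le_span_frameL (hp : p ∈ dom n d E p₀) : U D₀ D r k p ≤
    Submodule.span ℝ (Set.range fun i : Idx n d r k => frameL p₀ i p) := by
  refine Submodule.span_le.2 ?_
  rintro T ⟨j, hj, X, s, rfl⟩
  obtain ⟨R, hR, h⟩ := higherCov_LocOp D₀ D p₀ j X s
  have key : ∀ R : Form n d E k → M → ℝ, R ∈ LocOp p₀ j k → ∃ S ∈
      Submodule.span ℝ (Set.range fun i : Idx n d r k => frameL (E := E) p₀ i p),
      ∀ η, S η = R η p := by
    intro R hR
    induction hR using Submodule.span_induction with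
    | mem R h =>
      obtain ⟨a, ha, j', hj', w, K, rfl⟩ := h
      exact ⟨_, Submodule.smul_mem _ (a p) (wordL_mem_span hp (hj'.trans hj) K w), fun η => by
        rw [LinearMap.smul_apply, wordL_apply hp, smul_eq_mul]⟩
    | zero => exact ⟨0, zero_mem _, fun _ => rfl⟩
    | add R S _ _ hR hS =>
      obtain ⟨R', hR', h1⟩ := hR
      obtain ⟨S', hS', h2⟩ := hS
      exact ⟨_, add_mem hR' hS', fun η => by simp [h1, h2]⟩
    | smul c R _ hR =>
      obtain ⟨R', hR', h1⟩ := hR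
      exact ⟨_, Submodule.smul_mem _ c hR', fun η => by simp [h1]⟩
  obtain ⟨S, hS, h'⟩ := key R hR
  have : Phi D₀ D p j X s = S := LinearMap.ext fun η => (h η p hp).trans (h' η).symm
  rw [this]
  exact hS

/-- Partial derivatives agree near each point with global operators. -/
theorem exists_Op_eq_wordD {q : M} (hq : q ∈ dom n d E p₀) {j : ℕ} (w : Fin j → Fin n)
    (K : Fin k → Fin d) : ∃ P ∈ Op D₀ D j k, ∀ᶠ p in nhds q, ∀ η, P η p = wordD p₀ K w p η := by
  induction j with
  | zero =>
    choose s hs using fun l => exists_section_eventuallyEq (n := n) hq.2 (K l)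
    refine ⟨_, Op_mem D₀ D le_rfl Fin.elim0 s, ?_⟩
    filter_upwards [Filter.eventually_all.2 hs, (isOpen_dom p₀).mem_nhds hq] with p hp hpd η
    change η.1 p (fun i => s i p) = _
    rw [wordD_zero hpd, funext hp]
  | succ j ih =>
    obtain ⟨P, hP, h⟩ := ih (Fin.tail w)
    obtain ⟨X, hX⟩ := exists_section_eventuallyEq (n := n)
      (E := (TangentSpace (𝓡 n) : M → Type _)) (p₀ := p₀) (q := q) hq.1 (w 0)
    -- A global field equal to the coordinate field near `q` adds the next letter. Agreement is kept
    -- on a neighbourhood so that it can be differentiated again.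
    refine ⟨_, lie_Op D₀ D X hP, ?_⟩
    filter_upwards [h.eventually_nhds, hX, (isOpen_dom p₀).mem_nhds hq] with p hp hXp hpd η
    have h1 : lie X (P η) p = mvfderiv (𝓡 n) (fun q => wordD p₀ K (Fin.tail w) q η) p (X p) := by
      refine mvfderiv_congr_of_eventuallyEq ?_ (X p)
      filter_upwards [hp] with q hq using hq η
    rw [h1, hXp, mvfderiv_wordD hpd, Fin.cons_self_tail]

theorem wordL_mem_U (hp : p ∈ dom n d E p₀) {j : ℕ} (hj : j ≤ r) (w : Fin j → Fin n)
    (K : Fin k → Fin d) : wordL p₀ K w p ∈ U D₀ D r k p := by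
  obtain ⟨P, hP, h⟩ := exists_Op_eq_wordD D₀ D hp w K
  obtain ⟨T, hT, hT'⟩ := Op_apply_mem D₀ D p (Op_mono D₀ D hj hP)
  have : wordL p₀ K w p = T := LinearMap.ext fun η => by
    rw [wordL_apply hp, hT', h.self_of_nhds]
  rwa [this]

theorem frameL_mem_U (hp : p ∈ dom n d E p₀) (i : Idx n d r k) :
    frameL p₀ i p ∈ U D₀ D r k p :=
  wordL_mem_U D₀ D hp (by have := i.1.1.2; omega) _ _

end LocalOperators

/-! ### Linear independence of the frame. -/

section Independence

variable {n : ℕ} {M : Type*} [TopologicalSpace M] [ChartedSpace (Rn n) M] [IsManifold (𝓡 n) ∞ M]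
  {d : ℕ} {E : M → Type*} [TopologicalSpace (TotalSpace (Rn d) E)]
  [∀ x, AddCommGroup (E x)] [∀ x, Module ℝ (E x)] [∀ x, TopologicalSpace (E x)]
  [∀ x, IsTopologicalAddGroup (E x)] [∀ x, ContinuousSMul ℝ (E x)]
  [FiberBundle (Rn d) E] [VectorBundle ℝ (Rn d) E]
  [ContMDiffVectorBundle ∞ (Rn d) E (𝓡 n)] [T2Space M]

theorem contMDiffAt_det {ι : Type*} [Fintype ι] [DecidableEq ι] {A : M → Matrix ι ι ℝ} {p : M}
    (hA : ∀ a b, ContMDiffAt (𝓡 n) 𝓘(ℝ) ∞ (fun q => A q a b) p) :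
    ContMDiffAt (𝓡 n) 𝓘(ℝ) ∞ (fun q => (A q).det) p := by
  simp only [Matrix.det_apply]
  refine ContMDiffAt.sum fun σ _ => ?_
  have h : ContMDiffAt (𝓡 n) 𝓘(ℝ) ∞ (fun q => ∏ i, A q (σ i) i) p :=
    contMDiffAt_finsetProd fun i _ => hA _ _
  simp only [Units.smul_def, ← Int.cast_smul_eq_zsmul ℝ]
  exact (contMDiffAt_const (c := (((Equiv.Perm.sign σ : ℤˣ) : ℤ) : ℝ))).mul h

/-- The alternating form on `ℝᵈ` given by the minor with columns `K`. -/
def minor {k : ℕ} (K : Fin k ↪o Fin d) : Rn d [⋀^Fin k]→ₗ[ℝ] ℝ :=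
  Matrix.detRowAlternating.compLinearMap
    { toFun := fun v b => v (K b)
      map_add' := fun _ _ => rfl
      map_smul' := fun _ _ => rfl }

theorem minor_apply {k : ℕ} (K : Fin k ↪o Fin d) (v : Fin k → Rn d) :
    minor K v = (Matrix.of fun a b => v a (K b)).det := rfl

/-- For `K ≠ K'` some index of `K` is missing from `K'`, by equality of cardinalities, and its row
of the matrix vanishes. -/
theorem minor_single {k : ℕ} (K K' : Fin k ↪o Fin d) :
    minor K' (fun a => EuclideanSpace.single (K a) 1) = if K = K' then 1 else 0 := by
  rw [minor_apply]
  split_ifs with h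
  · subst h
    have : (Matrix.of fun a b => (EuclideanSpace.single (K a) (1 : ℝ) : Rn d) (K b)) = 1 := by
      ext a b
      simp [Matrix.one_apply, eq_comm]
    rw [this, Matrix.det_one]
  · have : ∃ a, ∀ b, K' b ≠ K a := by
      by_contra! hc
      refine h (RelEmbedding.ext fun a => ?_)
      have hr : Set.range K = Set.range K' := by
        refine Set.eq_of_subset_of_ncard_le ?_ ?_
        · rintro _ ⟨a, rfl⟩
          exact hc a
        · rw [Set.ncard_range_of_injective K'.injective, Set.ncard_range_of_injective K.injective]
      exact DFunLike.congr_fun (OrderEmbedding.range_inj.1 hr) a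
    obtain ⟨a, ha⟩ := this
    exact Matrix.det_eq_zero_of_row_eq_zero a fun b => by simp [ha b]

variable {k r : ℕ} {p₀ p : M}

theorem contMDiffAt_transition {p₁ q : M} (hq : q ∈ (trivializationAt (Rn d) E p₀).baseSet)
    (hq₁ : q ∈ (trivializationAt (Rn d) E p₁).baseSet) (v : Rn d) (m : Fin d) :
    ContMDiffAt (𝓡 n) 𝓘(ℝ) ∞ (fun p => ((trivializationAt (Rn d) E p₀).linearMapAt ℝ p
      ((trivializationAt (Rn d) E p₁).symm p v)) m) q := by
  let e := trivializationAt (Rn d) E p₀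
  obtain ⟨s, hs⟩ := exists_section_eventuallyEq_symm (n := n) (E := E) hq₁ v
  obtain ⟨a, ha, hsa⟩ := exists_local_coeffs (n := n) p₀ s
  refine ((ha m).contMDiffAt (e.open_baseSet.mem_nhds hq)).congr_of_eventuallyEq ?_
  filter_upwards [hs, e.open_baseSet.mem_nhds hq] with p hp hpe
  rw [← hp, hsa p hpe, map_sum]
  have : ∀ i, e.linearMapAt ℝ p (a i p • e.symm p (EuclideanSpace.single i 1)) =
      a i p • EuclideanSpace.single i 1 := by
    intro i
    rw [map_smul, ← e.symmₗ_apply (R := ℝ) hpe, e.linearMapAt_symmₗ hpe]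
  rw [Finset.sum_congr rfl fun i _ => this i]
  simp [Pi.single_apply]

/-- A form with exponential components near `p`. -/
theorem exists_exp_form (hp : p ∈ dom n d E p₀) (K : Fin k ↪o Fin d) (ξ : Fin n → ℝ) :
    ∃ η : Form n d E k, ∀ {r : ℕ} (i : Idx n d r k), frame p₀ i p η =
      if i.2 = K then ∏ m, ξ (i.1.2 m) else 0 := by
  let e := trivializationAt (Rn d) E p₀
  let φ := chartAt (Rn n) p₀
  let L : Rn n →L[ℝ] ℝ := ∑ m, ξ m • EuclideanSpace.proj m
  have hL : ∀ m, L (EuclideanSpace.single m 1) = ξ m := by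
    intro m
    simp [L]
  obtain ⟨χ, h1, h2⟩ := exists_cutoff (n := n) ((isOpen_dom (E := E) p₀).mem_nhds hp)
  -- The shift makes the exponential equal to `1` at `p`, so its derivatives there are exactly the
  -- monomials in `ξ`; the cutoff is `1` near `p` and does not affect them.
  let h : M → ℝ := fun q => Real.exp (L (φ q) - L (φ p))
  have hh : ∀ q ∈ φ.source, ContMDiffAt (𝓡 n) 𝓘(ℝ) ∞ h q := by
    intro q hq
    have h3 : ContDiff ℝ ∞ fun x => Real.exp (L x - L (φ p)) :=
      (L.contDiff.sub contDiff_const).exp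
    exact h3.contDiffAt.contMDiffAt.comp q (contMDiffAt_of_mem_maximalAtlas (n := ∞)
      (IsManifold.chart_mem_maximalAtlas p₀) hq)
  let η : ∀ q : M, E q [⋀^Fin k]→ₗ[ℝ] ℝ := fun q =>
    (χ q * h q) • (minor K).compLinearMap (e.linearMapAt ℝ q)
  have hη : η ∈ Form n d E k := by
    intro p₁ v q hq
    refine ContMDiffAt.contMDiffWithinAt ?_
    by_cases hqs : q ∈ tsupport χ
    · have hqd := h2 hqs
      refine (χ.contMDiff.contMDiffAt.mul (hh q hqd.1)).mul ?_
      refine contMDiffAt_det (A := fun q => Matrix.of fun a b =>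
        (e.linearMapAt ℝ q ((trivializationAt (Rn d) E p₁).symm q (v a))) (K b)) fun a b => ?_
      exact contMDiffAt_transition hqd.2 hq (v a) (K b)
    · refine (contMDiffAt_const (c := (0 : ℝ))).congr_of_eventuallyEq ?_
      filter_upwards [(isClosed_tsupport χ).isOpen_compl.mem_nhds hqs] with q' hq'
      have : χ q' = 0 := image_eq_zero_of_notMem_tsupport hq'
      simp [η, this]
  refine ⟨⟨η, hη⟩, fun {r} i => ?_⟩
  have hc : compFn p₀ i.2 ⟨η, hη⟩ =ᶠ[nhds (φ p)]
      (if i.2 = K then (1 : ℝ) else 0) • fun x => Real.exp (L x - L (φ p)) := by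
    have hsymm : Filter.Tendsto φ.symm (nhds (φ p)) (nhds p) := by
      have := (φ.continuousAt_symm (φ.map_source hp.1)).tendsto
      rwa [φ.left_inv hp.1] at this
    filter_upwards [hsymm.eventually h1, hsymm.eventually ((isOpen_dom (E := E) p₀).mem_nhds hp),
      φ.open_target.mem_nhds (φ.map_source hp.1)] with x hx1 hx2 hx3
    change (χ (φ.symm x) * h (φ.symm x)) * minor K (fun a => e.linearMapAt ℝ (φ.symm x)
      (e.symm (φ.symm x) (EuclideanSpace.single (i.2 a) 1))) = _
    have : ∀ a, e.linearMapAt ℝ (φ.symm x)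
        (e.symm (φ.symm x) (EuclideanSpace.single (i.2 a) 1)) = EuclideanSpace.single (i.2 a) 1 := by
      intro a
      rw [← e.symmₗ_apply (R := ℝ) hx2.2, e.linearMapAt_symmₗ hx2.2]
    rw [funext this, minor_single, hx1]
    simp only [h, φ.right_inv hx3, Pi.one_apply, one_mul, Pi.smul_apply, smul_eq_mul]
    ring
  rw [frame_eq_wordD]
  unfold wordD
  rw [(Filter.EventuallyEq.iteratedFDeriv ℝ hc _).self_of_nhds, iteratedFDeriv_const_smul_apply
    (((L.contDiff.sub contDiff_const).exp).contDiffAt)]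
  change (if i.2 = K then (1 : ℝ) else 0) * iteratedFDeriv ℝ _ (fun x => Real.exp (L x - L (φ p)))
    (φ p) _ = _
  rw [iteratedFDeriv_exp_clm]
  simp [hL]

/-- The exponent of the monomial of a word. -/
def wordExp {j : ℕ} (w : Fin j → Fin n) : Fin n →₀ ℕ := ∑ m, Finsupp.single (w m) 1

/-- The exponent records the multiset of letters, and a nondecreasing word is the sorted list of its
letters. -/
theorem wordExp_injective {r : ℕ} : Function.Injective
    fun I : Σ j : Fin (r + 1), Fin j →o Fin n => wordExp (I.2 : Fin I.1 → Fin n) := by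
  rintro ⟨j, w⟩ ⟨j', w'⟩ h
  have hm : ∀ {j : ℕ} (w : Fin j → Fin n), Finsupp.toMultiset (wordExp w) =
      (List.ofFn w : Multiset (Fin n)) := by
    intro j w
    rw [wordExp, map_sum]
    simp only [Finsupp.toMultiset_single, one_smul]
    rw [← Multiset.sum_map_singleton (List.ofFn w : Multiset (Fin n)), Multiset.map_coe,
      Multiset.sum_coe, List.map_ofFn, List.sum_ofFn]
    rfl
  have h' : (List.ofFn (w : Fin j → Fin n) : Multiset (Fin n)) =
      (List.ofFn (w' : Fin j' → Fin n) : Multiset (Fin n)) := by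
    rw [← hm, ← hm]
    exact congrArg _ h
  have hperm := Multiset.coe_eq_coe.1 h'
  have hlist := List.Perm.eq_of_sortedLE (List.sortedLE_ofFn_iff.2 w.monotone)
    (List.sortedLE_ofFn_iff.2 w'.monotone) hperm
  have hlen : (j : ℕ) = j' := by simpa using congrArg List.length hlist
  obtain ⟨j, hj⟩ := j
  obtain ⟨j', hj'⟩ := j'
  obtain rfl : j = j' := hlen
  congr 1
  exact OrderHom.ext _ _ (List.ofFn_injective hlist)

/-- Testing a relation on forms that are exponential in the direction `K` turns it into a polynomial
in `ξ` that vanishes everywhere. Distinct words give distinct monomials, so all coefficients are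
zero. -/
theorem linearIndependent_frameL (hp : p ∈ dom n d E p₀) :
    LinearIndependent ℝ fun i : Idx n d r k => (frameL p₀ i p : Form n d E k →ₗ[ℝ] ℝ) := by
  classical
  rw [Fintype.linearIndependent_iff]
  rintro c hc ⟨I₀, K⟩
  have : Fintype (Σ j : Fin (r + 1), Fin j →o Fin n) :=
    @Fintype.ofFinite _ (by
      have : ∀ j : Fin (r + 1), Finite (Fin j →o Fin n) := fun j => DFunLike.finite _
      infer_instance)
  have : Fintype (Fin k ↪o Fin d) := @Fintype.ofFinite _ (DFunLike.finite _)
  let Q : MvPolynomial (Fin n) ℝ := ∑ I : Σ j : Fin (r + 1), Fin j →o Fin n,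
    MvPolynomial.monomial (wordExp (I.2 : Fin I.1 → Fin n)) (c (I, K))
  have hQ : Q = 0 := by
    refine MvPolynomial.funext fun ξ => ?_
    obtain ⟨η, hη⟩ := exists_exp_form hp K ξ
    have h1 := LinearMap.congr_fun hc η
    simp only [LinearMap.sum_apply, LinearMap.smul_apply, smul_eq_mul, frameL_apply hp, hη,
      LinearMap.zero_apply] at h1
    rw [map_zero, ← h1, map_sum]
    have h2 : ∀ f : Idx n d r k → ℝ, ∑ i, f i = ∑ I, ∑ K, f (I, K) := by
      intro f
      convert! Fintype.sum_prod_type f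
    rw [h2]
    refine Finset.sum_congr rfl fun I _ => ?_
    rw [Finset.sum_eq_single K]
    · have h3 : MvPolynomial.monomial (wordExp (I.2 : Fin I.1 → Fin n)) (c (I, K)) =
          MvPolynomial.C (c (I, K)) * ∏ m, MvPolynomial.X (I.2 m) := by
        rw [← mul_one (c (I, K)), ← MvPolynomial.C_mul_monomial, wordExp,
          MvPolynomial.monomial_sum_one, mul_one]
        rfl
      rw [h3]
      simp
    · intro K' _ hK'
      simp [hK']
    · simp
  have h4 := congrArg (MvPolynomial.coeff (wordExp (I₀.2 : Fin I₀.1 → Fin n))) hQ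
  rw [MvPolynomial.coeff_sum, Finset.sum_eq_single I₀] at h4
  · simpa using h4
  · intro I _ hI
    rw [MvPolynomial.coeff_monomial, if_neg]
    exact fun h => hI (wordExp_injective h)
  · simp

end Independence

/-! ### Fibre coordinates, and smoothness tested on forms. -/

section SmoothSections

variable {n : ℕ} {M : Type*} [TopologicalSpace M] [ChartedSpace (Rn n) M] [IsManifold (𝓡 n) ∞ M]
  {d : ℕ} {E : M → Type*} [TopologicalSpace (TotalSpace (Rn d) E)]
  [∀ x, AddCommGroup (E x)] [∀ x, Module ℝ (E x)] [∀ x, TopologicalSpace (E x)]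
  [∀ x, IsTopologicalAddGroup (E x)] [∀ x, ContinuousSMul ℝ (E x)]
  [FiberBundle (Rn d) E] [VectorBundle ℝ (Rn d) E]
  [ContMDiffVectorBundle ∞ (Rn d) E (𝓡 n)] [T2Space M]
  (D₀ : CovariantDerivative (𝓡 n) (Rn n) (TangentSpace (𝓡 n) : M → Type _))
  [D₀.ContMDiffCovariantDerivative ∞]
  (D : CovariantDerivative (𝓡 n) (Rn d) E) [D.ContMDiffCovariantDerivative ∞]

variable {r k : ℕ} {p₀ p : M}

/-- The basis of the fibre of `𝒰_k^r(E)` given by the local frame around `p₀`. -/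
def basisAt (hp : p ∈ dom n d E p₀) : Basis (Idx n d r k) ℝ (U D₀ D r k p) :=
  Basis.mk (v := fun i => ⟨frameL p₀ i p, frameL_mem_U D₀ D hp i⟩)
    (LinearIndependent.of_comp (U D₀ D r k p).subtype (linearIndependent_frameL hp)) (by
      rintro ⟨T, hT⟩ -
      have h := U_le_span_frameL D₀ D hp hT
      obtain ⟨c, rfl⟩ := (Submodule.mem_span_range_iff_exists_fun ℝ).1 h
      refine (Submodule.mem_span_range_iff_exists_fun ℝ).2 ⟨c, Subtype.ext ?_⟩
      simp)

theorem coe_basisAt (hp : p ∈ dom n d E p₀) (i : Idx n d r k) :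
    (basisAt D₀ D hp i : Form n d E k →ₗ[ℝ] ℝ) = frameL p₀ i p := by
  simp [basisAt]

open Classical in
/-- Coordinates in the local frame around `p₀`, with the value `0` outside its domain. -/
def ucoord (p₀ p : M) : U D₀ D r k p →ₗ[ℝ] (Idx n d r k → ℝ) :=
  if hp : p ∈ dom n d E p₀ then (basisAt D₀ D hp).equivFun.toLinearMap else 0

theorem ucoord_eq_repr (hp : p ∈ dom n d E p₀) (T : U D₀ D r k p) (i : Idx n d r k) :
    ucoord D₀ D p₀ p T i = (basisAt D₀ D hp).repr T i := by
  simp [ucoord, hp]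

theorem sum_ucoord (hp : p ∈ dom n d E p₀) (T : U D₀ D r k p) :
    ∑ i, ucoord D₀ D p₀ p T i • basisAt D₀ D hp i = T := by
  simp only [ucoord_eq_repr D₀ D hp]
  exact (basisAt D₀ D hp).sum_repr T

theorem ucoord_sum (hp : p ∈ dom n d E p₀) (c : Idx n d r k → ℝ) :
    ucoord D₀ D p₀ p (∑ i, c i • basisAt D₀ D hp i) = c := by
  funext i
  rw [ucoord_eq_repr D₀ D hp, Basis.repr_sum_self]

theorem ucoord_basisAt (hp : p ∈ dom n d E p₀) (i i' : Idx n d r k) [Decidable (i = i')] :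
    ucoord D₀ D p₀ p (basisAt D₀ D hp i) i' = if i = i' then 1 else 0 := by
  rw [ucoord_eq_repr D₀ D hp, Basis.repr_self, Finsupp.single_apply]

theorem ext_ucoord (hp : p ∈ dom n d E p₀) {S T : U D₀ D r k p}
    (h : ucoord D₀ D p₀ p S = ucoord D₀ D p₀ p T) : S = T := by
  rw [← sum_ucoord D₀ D hp S, ← sum_ucoord D₀ D hp T, h]

theorem apply_eq_sum_ucoord (hp : p ∈ dom n d E p₀) (T : U D₀ D r k p) (η : Form n d E k) :
    T.1 η = ∑ i, ucoord D₀ D p₀ p T i * frame p₀ i p η := by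
  conv_lhs => rw [← sum_ucoord D₀ D hp T]
  rw [Submodule.coe_sum, LinearMap.sum_apply]
  refine Finset.sum_congr rfl fun i _ => ?_
  rw [Submodule.coe_smul, coe_basisAt, LinearMap.smul_apply, frameL_apply hp, smul_eq_mul]

theorem hasCoords_iff (hp : p ∈ dom n d E p₀) (T : U D₀ D r k p) (c : Idx n d r k → ℝ) :
    HasCoords p₀ p T.1 c ↔ ucoord D₀ D p₀ p T = c := by
  constructor
  · intro h
    have : T = ∑ i, c i • basisAt D₀ D hp i := by
      refine Subtype.ext (LinearMap.ext fun η => ?_)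
      rw [h η, Submodule.coe_sum, LinearMap.sum_apply]
      refine Finset.sum_congr rfl fun i _ => ?_
      rw [Submodule.coe_smul, coe_basisAt, LinearMap.smul_apply, frameL_apply hp, smul_eq_mul]
    rw [this, ucoord_sum]
  · rintro rfl η
    exact apply_eq_sum_ucoord D₀ D hp T η

theorem contMDiffAt_frame (hp : p ∈ dom n d E p₀) (i : Idx n d r k) (η : Form n d E k) :
    ContMDiffAt (𝓡 n) 𝓘(ℝ) ∞ (fun q => frame p₀ i q η) p :=
  contMDiffAt_wordD hp _ _ η

theorem contMDiff_apply_of_mem_USec {T : ∀ p : M, U D₀ D r k p} (hT : T ∈ USec D₀ D r k)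
    (η : Form n d E k) : ContMDiff (𝓡 n) 𝓘(ℝ) ∞ fun p => (T p).1 η := by
  intro q
  obtain ⟨a, ha, h⟩ := hT q
  have hq := mem_dom_self (n := n) (d := d) (E := E) q
  have ho := (isOpen_dom (n := n) (d := d) (E := E) q).mem_nhds hq
  refine ContMDiffAt.congr_of_eventuallyEq (f := fun p => ∑ i, a i p * frame q i p η) ?_ ?_
  · exact ContMDiffAt.sum fun i _ => ((ha i).contMDiffAt ho).mul (contMDiffAt_frame hq i η)
  · filter_upwards [ho] with p hp using h p hp η

/-- Linearly independent functionals have a dual system. -/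
theorem exists_dual_system {V ι : Type*} [AddCommMonoid V] [Module ℝ V] [Fintype ι] [DecidableEq ι]
    {f : ι → V →ₗ[ℝ] ℝ} (hf : LinearIndependent ℝ f) :
    ∃ v : ι → V, ∀ i l, f i (v l) = if l = i then 1 else 0 := by
  have hsurj : LinearMap.range (LinearMap.pi f) = ⊤ := by
    by_contra hne
    -- A nonzero functional vanishing on the range would have as coefficients a nontrivial relation
    -- between the `f i`.
    obtain ⟨g, hg0, hg⟩ := Submodule.exists_le_ker_of_lt_top _ (lt_top_iff_ne_top.2 hne)
    refine hg0 (LinearMap.pi_ext' fun i => LinearMap.ext_ring ?_)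
    have := Fintype.linearIndependent_iff.1 hf (fun i => g (Pi.single i 1)) (by
      refine LinearMap.ext fun v => ?_
      have h1 : g (LinearMap.pi f v) = 0 := hg ⟨v, rfl⟩
      rw [LinearMap.pi_apply_eq_sum_univ] at h1
      have h2 : ∀ i : ι, (fun j => if i = j then (1 : ℝ) else 0) = Pi.single i 1 := fun i => by
        funext j
        simp [Pi.single_apply, eq_comm]
      simpa [mul_comm, h2] using h1) i
    simpa using this
  have h := LinearMap.range_eq_top.1 hsurj
  choose v hv using fun l : ι => h (Pi.single l 1)
  refine ⟨v, fun i l => ?_⟩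
  have := congrFun (hv l) i
  simp only [LinearMap.pi_apply] at this
  rw [this, Pi.single_apply]
  simp [eq_comm]

/-- Forms dual to the frame at `q` give a matrix of frame values that is the identity at `q` and
stays invertible nearby. Cramer's rule then writes the coordinates as quotients of smooth
determinants. -/
theorem contMDiffAt_ucoord {T : ∀ p : M, U D₀ D r k p}
    (hT : ∀ η, ContMDiff (𝓡 n) 𝓘(ℝ) ∞ fun p => (T p).1 η) {q : M} (hq : q ∈ dom n d E p₀)
    (i : Idx n d r k) : ContMDiffAt (𝓡 n) 𝓘(ℝ) ∞ (fun p => ucoord D₀ D p₀ p (T p) i) q := by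
  classical
  obtain ⟨η, hη⟩ := exists_dual_system
    (f := fun i : Idx n d r k => (frameL p₀ i q : Form n d E k →ₗ[ℝ] ℝ))
    (linearIndependent_frameL hq)
  let B : M → Matrix (Idx n d r k) (Idx n d r k) ℝ := fun p => Matrix.of fun l i =>
    frame p₀ i p (η l)
  have hB : ∀ l i, ContMDiffAt (𝓡 n) 𝓘(ℝ) ∞ (fun p => B p l i) q := fun l i =>
    contMDiffAt_frame hq i (η l)
  have hB1 : B q = 1 := by
    ext l i
    change frame p₀ i q (η l) = _
    rw [← frameL_apply hq, hη, Matrix.one_apply]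
  have hdet := contMDiffAt_det hB
  have hne : (B q).det ≠ 0 := by rw [hB1, Matrix.det_one]; exact one_ne_zero
  let C : M → Matrix (Idx n d r k) (Idx n d r k) ℝ := fun p =>
    (B p).updateCol i fun l => (T p).1 (η l)
  have hC : ∀ l i', ContMDiffAt (𝓡 n) 𝓘(ℝ) ∞ (fun p => C p l i') q := by
    intro l i'
    simp only [C, Matrix.updateCol_apply]
    split_ifs
    · exact hT (η l) q
    · exact hB l i'
  have hinv : ContMDiffAt (𝓡 n) 𝓘(ℝ) ∞ (fun p => ((B p).det)⁻¹) q :=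
    ((contDiffAt_inv ℝ hne).contMDiffAt).comp q hdet
  refine (hinv.mul (contMDiffAt_det hC)).congr_of_eventuallyEq ?_
  filter_upwards [(isOpen_dom p₀).mem_nhds hq, hdet.continuousAt.eventually_ne hne] with p hp hpne
  have h1 : (fun l => (T p).1 (η l)) = (B p).mulVec (ucoord D₀ D p₀ p (T p)) := by
    funext l
    rw [apply_eq_sum_ucoord D₀ D hp]
    simp only [Matrix.mulVec, dotProduct, B, Matrix.of_apply]
    exact Finset.sum_congr rfl fun i _ => mul_comm _ _
  have h2 : (C p).det = (B p).det * ucoord D₀ D p₀ p (T p) i := by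
    change ((B p).updateCol i fun l => (T p).1 (η l)).det = _
    rw [← Matrix.cramer_apply, h1, Matrix.cramer_eq_adjugate_mulVec, Matrix.mulVec_mulVec,
      Matrix.adjugate_mul, Matrix.smul_mulVec, Matrix.one_mulVec]
    rfl
  change _ = ((B p).det)⁻¹ * (C p).det
  rw [h2, inv_mul_cancel_left₀ hpne]

/-- A family of functionals is a smooth section if and only if its values on forms are smooth. -/
theorem mem_USec_iff {T : ∀ p : M, U D₀ D r k p} :
    T ∈ USec D₀ D r k ↔ ∀ η, ContMDiff (𝓡 n) 𝓘(ℝ) ∞ fun p => (T p).1 η := by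
  refine ⟨contMDiff_apply_of_mem_USec D₀ D, fun hT p₀ =>
    ⟨fun i p => ucoord D₀ D p₀ p (T p) i, fun i q hq =>
      (contMDiffAt_ucoord D₀ D hT hq i).contMDiffWithinAt, fun p hp => ?_⟩⟩
  rw [hasCoords_iff D₀ D hp]

theorem contMDiffOn_ucoord {T : ∀ p : M, U D₀ D r k p} (hT : T ∈ USec D₀ D r k) (p₀ : M)
    (i : Idx n d r k) :
    ContMDiffOn (𝓡 n) 𝓘(ℝ) ∞ (fun p => ucoord D₀ D p₀ p (T p) i) (dom n d E p₀) := fun _ hq =>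
  (contMDiffAt_ucoord D₀ D ((mem_USec_iff D₀ D).1 hT) hq i).contMDiffWithinAt

/-- The section of `𝒰_k^r(E)` defined by an operator. -/
theorem exists_USec_of_Op {P : Form n d E k → Fn n M} (hP : P ∈ Op D₀ D r k) :
    ∃ T ∈ USec D₀ D r k, ∀ p η, (T p).1 η = P η p := by
  choose T hT hT' using fun p => Op_apply_mem D₀ D p hP
  refine ⟨fun p => ⟨T p, hT p⟩, (mem_USec_iff D₀ D).2 fun η => ?_, hT'⟩
  have : (fun p => T p η) = P η := funext fun p => hT' p η
  change ContMDiff (𝓡 n) 𝓘(ℝ) ∞ fun p => T p η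
  rw [this]
  exact (P η).contMDiff

theorem exists_Op_eq_frame (i : Idx n d r k) {q : M} (hq : q ∈ dom n d E p₀) :
    ∃ P ∈ Op D₀ D r k, ∀ᶠ p in nhds q, ∀ η, P η p = frame p₀ i p η := by
  obtain ⟨P, hP, h⟩ := exists_Op_eq_wordD D₀ D hq (i.1.2 : Fin i.1.1 → Fin n) (i.2 : Fin k → Fin d)
  exact ⟨P, Op_mono D₀ D (by have := i.1.1.2; omega) hP, h⟩

/-- Smooth sections agree locally with global operators. -/
theorem exists_Op_eventuallyEq {T : ∀ p : M, U D₀ D r k p} (hT : T ∈ USec D₀ D r k) (q : M) :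
    ∃ P ∈ Op D₀ D r k, ∀ᶠ p in nhds q, ∀ η, (T p).1 η = P η p := by
  have hq := mem_dom_self (n := n) (d := d) (E := E) q
  choose P hP h using fun i : Idx n d r k => exists_Op_eq_frame D₀ D i hq
  choose f hf using fun i : Idx n d r k =>
    exists_fn_eventuallyEq (isOpen_dom q) (contMDiffOn_ucoord D₀ D hT q i) hq
  refine ⟨∑ i, f i • P i, sum_mem fun i _ => Submodule.smul_mem _ _ (hP i), ?_⟩
  filter_upwards [Filter.eventually_all.2 h, Filter.eventually_all.2 hf,
    (isOpen_dom (n := n) (d := d) (E := E) q).mem_nhds hq] with p h1 h2 hp η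
  have h3 : (∑ i, f i • P i) η p = ∑ i, f i p * P i η p := by
    rw [Finset.sum_apply]
    change evalAt p (∑ i, (f i • P i) η) = _
    rw [map_sum]
    rfl
  rw [h3, apply_eq_sum_ucoord D₀ D hp]
  exact Finset.sum_congr rfl fun i _ => by rw [h2 i, h1 i]

/-- Every element of a fibre is the value of a global operator. -/
theorem exists_Op_apply_eq (T : U D₀ D r k p) :
    ∃ P ∈ Op D₀ D r k, ∀ η, T.1 η = P η p := by
  have hp := mem_dom_self (n := n) (d := d) (E := E) p
  choose P hP h using fun i : Idx n d r k => exists_Op_eq_frame D₀ D i hp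
  refine ⟨∑ i, algebraMap ℝ (Fn n M) (ucoord D₀ D p p T i) • P i,
    sum_mem fun i _ => Submodule.smul_mem _ _ (hP i), fun η => ?_⟩
  have h3 : (∑ i, algebraMap ℝ (Fn n M) (ucoord D₀ D p p T i) • P i) η p =
      ∑ i, ucoord D₀ D p p T i * P i η p := by
    rw [Finset.sum_apply]
    change evalAt p (∑ i, (algebraMap ℝ (Fn n M) (ucoord D₀ D p p T i) • P i) η) = _
    rw [map_sum]
    rfl
  rw [h3, apply_eq_sum_ucoord D₀ D hp]
  exact Finset.sum_congr rfl fun i _ => by rw [(h i).self_of_nhds]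

end SmoothSections

/-! ### The order filtration and the module of sections. -/

section Filtration

variable {n : ℕ} {M : Type*} [TopologicalSpace M] [ChartedSpace (Rn n) M] [IsManifold (𝓡 n) ∞ M]
  {d : ℕ} {E : M → Type*} [TopologicalSpace (TotalSpace (Rn d) E)]
  [∀ x, AddCommGroup (E x)] [∀ x, Module ℝ (E x)] [∀ x, TopologicalSpace (E x)]
  [∀ x, IsTopologicalAddGroup (E x)] [∀ x, ContinuousSMul ℝ (E x)]
  [FiberBundle (Rn d) E] [VectorBundle ℝ (Rn d) E]
  [ContMDiffVectorBundle ∞ (Rn d) E (𝓡 n)] [T2Space M]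
  (D₀ : CovariantDerivative (𝓡 n) (Rn n) (TangentSpace (𝓡 n) : M → Type _))
  [D₀.ContMDiffCovariantDerivative ∞]
  (D : CovariantDerivative (𝓡 n) (Rn d) E) [D.ContMDiffCovariantDerivative ∞]

variable {r k : ℕ} {p₀ p : M}

/-- The functionals of order less than `t`. -/
def Ult (t k : ℕ) (p : M) : Submodule ℝ (Form n d E k →ₗ[ℝ] ℝ) :=
  match t with
  | 0 => ⊥
  | t + 1 => U D₀ D t k p

/-- The operators of order less than `t`. -/
def Oplt (t k : ℕ) : Submodule (Fn n M) (Form n d E k → Fn n M) :=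
  match t with
  | 0 => ⊥
  | t + 1 => Op D₀ D t k

theorem U_mono {r r' : ℕ} (h : r ≤ r') : U D₀ D r k p ≤ U D₀ D r' k p :=
  Submodule.span_mono fun _ ⟨j, hj, X, s, e⟩ => ⟨j, hj.trans h, X, s, e⟩

theorem Ult_mono {t t' : ℕ} (h : t ≤ t') : Ult D₀ D t k p ≤ Ult D₀ D t' k p := by
  match t, t', h with
  | 0, _, _ => exact bot_le
  | t + 1, t' + 1, h => exact U_mono D₀ D (Nat.le_of_succ_le_succ h)

theorem Oplt_mono {t t' : ℕ} (h : t ≤ t') : Oplt D₀ D t k ≤ Oplt D₀ D t' k := by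
  match t, t', h with
  | 0, _, _ => exact bot_le
  | t + 1, t' + 1, h => exact Op_mono D₀ D (Nat.le_of_succ_le_succ h)

theorem lie_Oplt {t : ℕ} (X : VF n M) {P : Form n d E k → Fn n M} (hP : P ∈ Oplt D₀ D t k) :
    (fun η => lie X (P η)) ∈ Oplt D₀ D (t + 1) k := by
  match t with
  | 0 =>
    have : P = 0 := hP
    subst this
    have : (fun η : Form n d E k => lie X ((0 : Form n d E k → Fn n M) η)) = 0 := by
      funext η
      simp
    rw [this]
    exact zero_mem _
  | t + 1 => exact lie_Op D₀ D X hP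

theorem Oplt_apply_mem {t : ℕ} (p : M) {P : Form n d E k → Fn n M} (hP : P ∈ Oplt D₀ D t k) :
    ∃ T ∈ Ult D₀ D t k p, ∀ η, T η = P η p := by
  match t with
  | 0 =>
    have : P = 0 := hP
    subst this
    exact ⟨0, zero_mem _, fun _ => rfl⟩
  | t + 1 => exact Op_apply_mem D₀ D p hP

/-- The commutator of an operator of order `j` with multiplication by `f` has order below `j`. In
the induction the only new term is `lie (X 0) f` times an operator one order lower. -/
theorem higherCov_mulForm_sub (f : Fn n M) (j : ℕ) (X : Fin j → VF n M)
    (s : Fin k → Cₛ^∞⟮𝓡 n; Rn d, E⟯) :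
    (fun η => higherCov D₀ D j X s (mulForm f η)) - f • ⇑(higherCov D₀ D j X s) ∈
      Oplt D₀ D j k := by
  induction j generalizing s with
  | zero =>
    have : (fun η => higherCov D₀ D 0 X s (mulForm f η)) - f • ⇑(higherCov D₀ D 0 X s) = 0 :=
      sub_eq_zero.2 rfl
    rw [this]
    exact zero_mem _
  | succ j ih =>
    let R : (Fin j → VF n M) → (Fin k → Cₛ^∞⟮𝓡 n; Rn d, E⟯) → Form n d E k → Fn n M :=
      fun X s => (fun η => higherCov D₀ D j X s (mulForm f η)) - f • ⇑(higherCov D₀ D j X s)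
    have hR : ∀ X s η, higherCov D₀ D j X s (mulForm f η) =
        R X s η + f * higherCov D₀ D j X s η := by
      intro X s η
      simp [R]
    have : (fun η => higherCov D₀ D (j + 1) X s (mulForm f η)) -
        f • ⇑(higherCov D₀ D (j + 1) X s) =
        lie (X 0) f • ⇑(higherCov D₀ D j (Fin.tail X) s)
        + (fun η => lie (X 0) (R (Fin.tail X) s η))
        - ∑ l : Fin k, R (Fin.tail X) (Function.update s l (cov D (X 0) (s l)))
        - ∑ i : Fin j, R (Function.update (Fin.tail X) i (cov D₀ (X 0) (Fin.tail X i))) s := by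
      funext η
      simp only [Pi.sub_apply, Pi.add_apply, Pi.smul_apply, smul_eq_mul, Finset.sum_apply,
        higherCov, LinearMap.sub_apply, LinearMap.comp_apply, LinearMap.sum_apply, hR, map_add,
        lie_mul, Finset.sum_add_distrib, ← Finset.mul_sum]
      ring
    rw [this]
    refine sub_mem (sub_mem (add_mem (Submodule.smul_mem _ _ (Op_mem D₀ D le_rfl _ _))
      (lie_Oplt D₀ D _ (ih _ _))) ?_) ?_ <;>
    exact sum_mem fun _ _ => Oplt_mono D₀ D (Nat.le_succ j) (ih _ _)

/-- The action of a function on functionals is multiplication by its value up to lower order. -/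
theorem corner_add_neg_smul_mem (f : Fn n M) {t : ℕ} {T : Form n d E k →ₗ[ℝ] ℝ}
    (hT : T ∈ U D₀ D t k p) : T ∘ₗ mulForm f + (-f p) • T ∈ Ult D₀ D t k p := by
  induction hT using Submodule.span_induction with
  | mem T h =>
    obtain ⟨j, hj, X, s, rfl⟩ := h
    obtain ⟨S, hS, hS'⟩ := Oplt_apply_mem D₀ D p
      (Oplt_mono D₀ D hj (higherCov_mulForm_sub D₀ D f j X s))
    have : Phi D₀ D p j X s ∘ₗ mulForm f + (-f p) • Phi D₀ D p j X s = S := by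
      refine LinearMap.ext fun η => ?_
      rw [hS' η]
      change higherCov D₀ D j X s (mulForm f η) p + -f p * higherCov D₀ D j X s η p =
        higherCov D₀ D j X s (mulForm f η) p - f p * higherCov D₀ D j X s η p
      ring
    rwa [this]
  | zero =>
    rw [LinearMap.zero_comp, smul_zero, add_zero]
    exact zero_mem _
  | add S T _ _ hS hT =>
    have : (S + T) ∘ₗ mulForm f + (-f p) • (S + T) =
        (S ∘ₗ mulForm f + (-f p) • S) + (T ∘ₗ mulForm f + (-f p) • T) := by
      rw [LinearMap.add_comp, smul_add]; abel
    rw [this]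
    exact add_mem hS hT
  | smul c T _ hT =>
    have : (c • T) ∘ₗ mulForm f + (-f p) • (c • T) = c • (T ∘ₗ mulForm f + (-f p) • T) := by
      rw [LinearMap.smul_comp, smul_add, smul_comm]
    rw [this]
    exact Submodule.smul_mem _ _ hT

theorem ucoord_eq_zero_of_mem_U (hp : p ∈ dom n d E p₀) {t : ℕ} {T : U D₀ D r k p}
    (hT : T.1 ∈ U D₀ D t k p) {i : Idx n d r k} (hi : t < i.1.1) : ucoord D₀ D p₀ p T i = 0 := by
  classical
  have htr : t < r := by have := i.1.1.2; omega
  obtain ⟨c, hc⟩ := (Submodule.mem_span_range_iff_exists_fun ℝ).1 (U_le_span_frameL D₀ D hp hT)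
  let ι : Idx n d t k → Idx n d r k := fun i => (⟨⟨i.1.1, by have := i.1.1.2; omega⟩, i.1.2⟩, i.2)
  have hT' : T = ∑ i', c i' • basisAt D₀ D hp (ι i') := by
    refine Subtype.ext ?_
    rw [← hc, Submodule.coe_sum]
    refine Finset.sum_congr rfl fun i' _ => ?_
    rw [Submodule.coe_smul, coe_basisAt]
    rfl
  rw [hT', map_sum, Finset.sum_apply]
  refine Finset.sum_eq_zero fun i' _ => ?_
  rw [map_smul, Pi.smul_apply, ucoord_basisAt, if_neg, smul_zero]
  intro hι
  rw [← hι] at hi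
  have := i'.1.1.2
  simp only [ι] at hi
  omega

/-- The order of a functional is read off from its coordinates. -/
theorem mem_Ult_iff (hp : p ∈ dom n d E p₀) {t : ℕ} {T : U D₀ D r k p} :
    T.1 ∈ Ult D₀ D t k p ↔ ∀ i : Idx n d r k, t ≤ i.1.1 → ucoord D₀ D p₀ p T i = 0 := by
  constructor
  · intro hT i hi
    cases t with
    | zero =>
      have h0 : T = 0 := Subtype.ext hT
      rw [h0, map_zero]
      rfl
    | succ t => exact ucoord_eq_zero_of_mem_U D₀ D hp hT hi
  · intro h
    rw [← sum_ucoord D₀ D hp T, Submodule.coe_sum]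
    refine sum_mem fun i _ => ?_
    rw [Submodule.coe_smul, coe_basisAt]
    by_cases hi : t ≤ i.1.1
    · rw [h i hi, zero_smul]
      exact zero_mem _
    · cases t with
      | zero => exact absurd (Nat.zero_le _) hi
      | succ t =>
        exact Submodule.smul_mem _ _ (wordL_mem_U D₀ D hp (by omega) _ _)

/-- With no coordinate of longer word, `T` has order at most that of `i`. Hence `f⌟T - f(p)T` has
smaller order and no coordinate at `i`. -/
theorem ucoord_corner (hp : p ∈ dom n d E p₀) (f : Fn n M) {T : U D₀ D r k p} {i : Idx n d r k}
    (h : ∀ i' : Idx n d r k, (i.1.1 : ℕ) < i'.1.1 → ucoord D₀ D p₀ p T i' = 0) :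
    ucoord D₀ D p₀ p (corner D₀ D f p T) i = f p * ucoord D₀ D p₀ p T i := by
  have hT : T.1 ∈ U D₀ D i.1.1 k p := (mem_Ult_iff D₀ D hp (t := i.1.1 + 1)).2 fun i' hi' => h i' hi'
  have h1 : (corner D₀ D f p T + (-f p) • T).1 ∈ Ult D₀ D i.1.1 k p :=
    corner_add_neg_smul_mem D₀ D f hT
  have h2 := (mem_Ult_iff D₀ D hp).1 h1 i le_rfl
  rw [map_add, map_smul] at h2
  change _ + -f p * _ = 0 at h2
  linarith

theorem corner_one : corner (r := r) (k := k) D₀ D (1 : Fn n M) p = LinearMap.id := by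
  refine LinearMap.ext fun T => Subtype.ext (LinearMap.ext fun η => ?_)
  change T.1 (mulForm 1 η) = T.1 η
  congr 1
  ext q v
  exact one_mul _

theorem corner_mul (f g : Fn n M) : corner (r := r) (k := k) D₀ D (f * g) p =
    corner D₀ D f p ∘ₗ corner D₀ D g p := by
  refine LinearMap.ext fun T => Subtype.ext (LinearMap.ext fun η => ?_)
  change T.1 (mulForm (f * g) η) = T.1 (mulForm g (mulForm f η))
  congr 1
  ext q v
  change f q * g q * _ = g q * (f q * _)
  ring

theorem corner_add (f g : Fn n M) : corner (r := r) (k := k) D₀ D (f + g) p =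
    corner D₀ D f p + corner D₀ D g p := by
  refine LinearMap.ext fun T => Subtype.ext (LinearMap.ext fun η => ?_)
  change T.1 (mulForm (f + g) η) = T.1 (mulForm f η) + T.1 (mulForm g η)
  rw [← map_add]
  congr 1
  ext q v
  exact add_mul _ _ _

theorem corner_zero : corner (r := r) (k := k) D₀ D (0 : Fn n M) p = 0 := by
  refine LinearMap.ext fun T => Subtype.ext (LinearMap.ext fun η => ?_)
  change T.1 (mulForm 0 η) = 0
  rw [← map_zero T.1]
  congr 1
  ext q v
  exact zero_mul _

theorem corner_mem_USec (f : Fn n M) {T : ∀ p : M, U D₀ D r k p} (hT : T ∈ USec D₀ D r k) :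
    (fun p => corner D₀ D f p (T p)) ∈ USec D₀ D r k :=
  (mem_USec_iff D₀ D).2 fun η => (mem_USec_iff D₀ D).1 hT (mulForm f η)

/-- The module structure on the sections of `𝒰_k^r(E)` given by `f⌟`. -/
@[reducible]
def cornerModule (r k : ℕ) : Module (Fn n M) (USec D₀ D r k) where
  smul f T := ⟨fun p => corner D₀ D f p (T.1 p), corner_mem_USec D₀ D f T.2⟩
  one_smul T := Subtype.ext <| funext fun p => LinearMap.congr_fun (corner_one D₀ D) (T.1 p)
  mul_smul f g T := Subtype.ext <| funext fun p => LinearMap.congr_fun (corner_mul D₀ D f g) (T.1 p)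
  smul_zero f := Subtype.ext <| funext fun p => map_zero (corner D₀ D f p)
  smul_add f S T := Subtype.ext <| funext fun p => map_add (corner D₀ D f p) (S.1 p) (T.1 p)
  add_smul f g T := Subtype.ext <| funext fun p => LinearMap.congr_fun (corner_add D₀ D f g) (T.1 p)
  zero_smul T := Subtype.ext <| funext fun p => LinearMap.congr_fun (corner_zero D₀ D) (T.1 p)

open Classical in
/-- The family with prescribed coordinates on `W` in the frames selected by `σ`, and zero
elsewhere. -/
def glueU (W : Set M) (σ : M → M) (a : Idx n d r k → Fn n M) (p : M) : U D₀ D r k p :=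
  if h : p ∈ W ∧ p ∈ dom n d E (σ p) then ∑ i, a i p • basisAt D₀ D h.2 i else 0

/-- Smoothness of a function that is locally described on an open set and vanishes outside the
supports of finitely many functions. -/
theorem contMDiff_of_forall_mem {ι : Type*} [Finite ι] {W : Set M} {a : ι → Fn n M}
    (ha : ∀ i, tsupport (a i) ⊆ W) {g : M → ℝ}
    (hW : ∀ p ∈ W, ContMDiffAt (𝓡 n) 𝓘(ℝ) ∞ g p) (h0 : ∀ p, (∀ i, a i p = 0) → g p = 0) :
    ContMDiff (𝓡 n) 𝓘(ℝ) ∞ g := by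
  intro q
  by_cases hq : q ∈ W
  · exact hW q hq
  · refine (contMDiffAt_const (c := (0 : ℝ))).congr_of_eventuallyEq ?_
    have : ∀ i, ∀ᶠ p in nhds q, a i p = 0 := fun i =>
      Filter.mem_of_superset ((isClosed_tsupport (a i)).isOpen_compl.mem_nhds
        fun h => hq (ha i h)) fun p hp => image_eq_zero_of_notMem_tsupport hp
    filter_upwards [Filter.eventually_all.2 this] with p hp using h0 p hp

/-- Near a point of `W` a single frame is in use; near any other point all the coefficients vanish,
since their closed supports lie in `W`. -/
theorem glueU_mem_USec {W : Set M} {σ : M → M} (hWo : IsOpen W)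
    (hσ : ∀ p ∈ W, p ∈ dom n d E (σ p)) (hσc : ∀ p ∈ W, ∀ᶠ q in nhds p, σ q = σ p)
    {a : Idx n d r k → Fn n M} (ha : ∀ i, tsupport (a i) ⊆ W) :
    glueU D₀ D W σ a ∈ USec D₀ D r k := by
  rw [mem_USec_iff]
  intro η
  refine contMDiff_of_forall_mem ha (fun q hq => ?_) fun p hp => ?_
  · refine ContMDiffAt.congr_of_eventuallyEq (f := fun p => ∑ i, a i p * frame (σ q) i p η) ?_ ?_
    · exact ContMDiffAt.sum fun i _ => (a i).contMDiff.contMDiffAt.mul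
        (contMDiffAt_frame (hσ q hq) i η)
    · filter_upwards [hσc q hq, hWo.mem_nhds hq] with p hp hpW
      have hpd := hσ p hpW
      rw [glueU, dif_pos ⟨hpW, hpd⟩, apply_eq_sum_ucoord D₀ D hpd]
      rw [ucoord_sum D₀ D hpd, hp]
  · unfold glueU
    split_ifs with h
    · simp [hp]
    · rfl

/-- The graded coordinates of the module of sections of `𝒰_k^r(E)`. -/
def uCoords (r k : ℕ) : @GradedCoords n M _ _ (USec D₀ D r k) _ (cornerModule D₀ D r k)
    (Idx n d r k) :=
  letI := cornerModule D₀ D r k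
  { dom := dom n d E
    isOpen_dom := isOpen_dom
    mem_dom := mem_dom_self
    deg := fun i => i.1.1
    coord := fun p₀ T i p => ucoord D₀ D p₀ p (T.1 p) i
    coord_add := fun p₀ p _ T T' i =>
      congrFun (map_add (ucoord D₀ D p₀ p) (T.1 p) (T'.1 p)) i
    smooth := fun p₀ T i => contMDiffOn_ucoord D₀ D T.2 p₀ i
    vanish_congr := fun t T p p₀ p₁ hp₀ hp₁ h =>
      (mem_Ult_iff D₀ D hp₁).1 ((mem_Ult_iff D₀ D hp₀).2 h)
    eq_zero := fun T h => Subtype.ext <| funext fun p => by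
      refine ext_ucoord D₀ D (mem_dom_self p) ?_
      rw [funext (h p)]
      exact (map_zero (ucoord D₀ D p p)).symm
    realize := fun W σ hWo hσ hσc a ha => by
      refine ⟨⟨_, glueU_mem_USec D₀ D hWo hσ hσc ha⟩, fun p hp i => ?_, fun p hp i => ?_⟩
      · change ucoord D₀ D (σ p) p (glueU D₀ D W σ a p) i = _
        rw [glueU, dif_pos ⟨hp, hσ p hp⟩, ucoord_sum]
      · change ucoord D₀ D p p (glueU D₀ D W σ a p) i = _
        rw [glueU, dif_neg fun h => hp h.1, map_zero]
        rfl
    coord_smul := fun f T p₀ p hp i h => ucoord_corner D₀ D hp f h }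

end Filtration

/-! ### The two module structures on homomorphisms and their gradings. -/

section HomModules

variable {n : ℕ} {M : Type*} [TopologicalSpace M] [ChartedSpace (Rn n) M] [IsManifold (𝓡 n) ∞ M]
  [T2Space M]
  {d : ℕ} {E : M → Type*} [TopologicalSpace (TotalSpace (Rn d) E)]
  [∀ x, AddCommGroup (E x)] [∀ x, Module ℝ (E x)] [∀ x, TopologicalSpace (E x)]
  [∀ x, IsTopologicalAddGroup (E x)] [∀ x, ContinuousSMul ℝ (E x)]
  [FiberBundle (Rn d) E] [VectorBundle ℝ (Rn d) E] [ContMDiffVectorBundle ∞ (Rn d) E (𝓡 n)]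
  {d' : ℕ} {F : M → Type*} [TopologicalSpace (TotalSpace (Rn d') F)]
  [∀ x, AddCommGroup (F x)] [∀ x, Module ℝ (F x)] [∀ x, TopologicalSpace (F x)]
  [∀ x, IsTopologicalAddGroup (F x)] [∀ x, ContinuousSMul ℝ (F x)]
  [FiberBundle (Rn d') F] [VectorBundle ℝ (Rn d') F] [ContMDiffVectorBundle ∞ (Rn d') F (𝓡 n)]
  (D₀ : CovariantDerivative (𝓡 n) (Rn n) (TangentSpace (𝓡 n) : M → Type _))
  [D₀.ContMDiffCovariantDerivative ∞]
  (D : CovariantDerivative (𝓡 n) (Rn d) E) [D.ContMDiffCovariantDerivative ∞]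
  (D' : CovariantDerivative (𝓡 n) (Rn d') F) [D'.ContMDiffCovariantDerivative ∞]

variable {r k s j : ℕ} {p₀ p : M}

open Classical in
/-- The element of the local frame around `p₀` with index `i`, with the value `0` outside its
domain. -/
def frameU (p₀ : M) (i : Idx n d r k) (p : M) : U D₀ D r k p :=
  if hp : p ∈ dom n d E p₀ then basisAt D₀ D hp i else 0

theorem frameU_eq (hp : p ∈ dom n d E p₀) (i : Idx n d r k) :
    frameU D₀ D p₀ i p = basisAt D₀ D hp i := dif_pos hp

theorem sum_ucoord_frameU (hp : p ∈ dom n d E p₀) (T : U D₀ D r k p) :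
    ∑ i, ucoord D₀ D p₀ p T i • frameU D₀ D p₀ i p = T := by
  simp only [frameU_eq D₀ D hp]
  exact sum_ucoord D₀ D hp T

theorem ucoord_frameU (hp : p ∈ dom n d E p₀) (i i' : Idx n d r k) [Decidable (i = i')] :
    ucoord D₀ D p₀ p (frameU D₀ D p₀ i p) i' = if i = i' then 1 else 0 := by
  rw [frameU_eq D₀ D hp, ucoord_basisAt]

theorem frameU_apply (hp : p ∈ dom n d E p₀) (i : Idx n d r k) (η : Form n d E k) :
    (frameU D₀ D p₀ i p).1 η = frame p₀ i p η := by
  rw [frameU_eq D₀ D hp, coe_basisAt, frameL_apply hp]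

theorem exists_USec_eq_frameU (i : Idx n d r k) {q : M} (hq : q ∈ dom n d E p₀) :
    ∃ T ∈ USec D₀ D r k, ∀ᶠ p in nhds q, T p = frameU D₀ D p₀ i p := by
  obtain ⟨P, hP, h⟩ := exists_Op_eq_frame D₀ D i hq
  obtain ⟨T, hT, hTP⟩ := exists_USec_of_Op D₀ D hP
  refine ⟨T, hT, ?_⟩
  filter_upwards [h, (isOpen_dom p₀).mem_nhds hq] with p h hp
  refine Subtype.ext (LinearMap.ext fun η => ?_)
  rw [hTP, h, frameU_apply D₀ D hp]

variable (n d E d' F) in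
/-- The common domain of the frames of both bundles around `p₀`. -/
def dom₂ (p₀ : M) : Set M := dom n d E p₀ ∩ dom n d' F p₀

theorem isOpen_dom₂ (p₀ : M) : IsOpen (dom₂ n d E d' F p₀) := (isOpen_dom p₀).inter (isOpen_dom p₀)

theorem mem_dom₂_self (p₀ : M) : p₀ ∈ dom₂ n d E d' F p₀ := ⟨mem_dom_self p₀, mem_dom_self p₀⟩

/-- The matrix entries of a homomorphism in the local frames around `p₀`. -/
def hcoord (p₀ p : M) (H : U D₀ D r k p →ₗ[ℝ] U D₀ D' s j p)
    (x : Idx n d' s j × Idx n d r k) : ℝ :=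
  ucoord D₀ D' p₀ p (H (frameU D₀ D p₀ x.2 p)) x.1

theorem ucoord_apply (hp : p ∈ dom n d E p₀) (H : U D₀ D r k p →ₗ[ℝ] U D₀ D' s j p)
    (S : U D₀ D r k p) (i' : Idx n d' s j) : ucoord D₀ D' p₀ p (H S) i' =
      ∑ i, hcoord D₀ D D' p₀ p H (i', i) * ucoord D₀ D p₀ p S i := by
  conv_lhs => rw [← sum_ucoord_frameU D₀ D hp S]
  rw [map_sum, map_sum, Finset.sum_apply]
  refine Finset.sum_congr rfl fun i _ => ?_
  rw [map_smul, map_smul, Pi.smul_apply, smul_eq_mul, mul_comm]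
  rfl

theorem HomSec_apply_mem {H : ∀ p : M, U D₀ D r k p →ₗ[ℝ] U D₀ D' s j p}
    (hH : H ∈ HomSec D₀ D D' r k s j) {T : ∀ p : M, U D₀ D r k p} (hT : T ∈ USec D₀ D r k) :
    (fun p => H p (T p)) ∈ USec D₀ D' s j := by
  refine (mem_USec_iff D₀ D').2 fun θ q => ?_
  obtain ⟨A, hA, hA'⟩ := hH q
  obtain ⟨a, ha, ha'⟩ := hT q
  have hq := mem_dom₂_self (n := n) (d := d) (E := E) (d' := d') (F := F) q
  have ho := (isOpen_dom₂ (n := n) (d := d) (E := E) (d' := d') (F := F) q).mem_nhds hq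
  have ho' := (isOpen_dom (n := n) (d := d) (E := E) q).mem_nhds hq.1
  refine ContMDiffAt.congr_of_eventuallyEq
    (f := fun p => ∑ i', (∑ i, A i' i p * a i p) * frame q i' p θ) ?_ ?_
  · exact ContMDiffAt.sum fun i' _ => (ContMDiffAt.sum fun i _ =>
      ((hA i' i).contMDiffAt ho).mul ((ha i).contMDiffAt ho')).mul (contMDiffAt_frame hq.2 i' θ)
  · filter_upwards [ho] with p hp using hA' p hp _ _ (ha' p hp.1) θ

/-- A column of the matrix is the image of a frame element, which agrees locally with a global
smooth section. -/
theorem contMDiffOn_hcoord {H : ∀ p : M, U D₀ D r k p →ₗ[ℝ] U D₀ D' s j p}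
    (hH : ∀ T ∈ USec D₀ D r k, (fun p => H p (T p)) ∈ USec D₀ D' s j) (p₀ : M)
    (x : Idx n d' s j × Idx n d r k) : ContMDiffOn (𝓡 n) 𝓘(ℝ) ∞
      (fun p => hcoord D₀ D D' p₀ p (H p) x) (dom₂ n d E d' F p₀) := by
  intro q hq
  obtain ⟨T, hT, h⟩ := exists_USec_eq_frameU D₀ D x.2 hq.1
  refine (ContMDiffAt.congr_of_eventuallyEq
    (contMDiffAt_ucoord D₀ D' ((mem_USec_iff D₀ D').1 (hH T hT)) hq.2 x.1) ?_).contMDiffWithinAt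
  filter_upwards [h] with p hp
  rw [hp]
  rfl

/-- A family of homomorphisms is smooth if and only if it maps smooth sections to smooth
sections. -/
theorem mem_HomSec_iff {H : ∀ p : M, U D₀ D r k p →ₗ[ℝ] U D₀ D' s j p} :
    H ∈ HomSec D₀ D D' r k s j ↔
      ∀ T ∈ USec D₀ D r k, (fun p => H p (T p)) ∈ USec D₀ D' s j := by
  refine ⟨fun hH T hT => HomSec_apply_mem D₀ D D' hH hT, fun h p₀ =>
    ⟨fun i' i p => hcoord D₀ D D' p₀ p (H p) (i', i),
      fun i' i => contMDiffOn_hcoord D₀ D D' h p₀ (i', i), fun p hp S c hc => ?_⟩⟩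
  rw [hasCoords_iff D₀ D hp.1] at hc
  rw [hasCoords_iff D₀ D' hp.2]
  funext i'
  rw [ucoord_apply D₀ D D' hp.1, hc]

theorem comp_corner_mem_HomSec (f : Fn n M) {H : ∀ p : M, U D₀ D r k p →ₗ[ℝ] U D₀ D' s j p}
    (hH : H ∈ HomSec D₀ D D' r k s j) :
    (fun p => H p ∘ₗ corner D₀ D f p) ∈ HomSec D₀ D D' r k s j :=
  (mem_HomSec_iff D₀ D D').2 fun _ hT =>
    (mem_HomSec_iff D₀ D D').1 hH _ (corner_mem_USec D₀ D f hT)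

theorem corner_comp_mem_HomSec (f : Fn n M) {H : ∀ p : M, U D₀ D r k p →ₗ[ℝ] U D₀ D' s j p}
    (hH : H ∈ HomSec D₀ D D' r k s j) :
    (fun p => corner D₀ D' f p ∘ₗ H p) ∈ HomSec D₀ D D' r k s j :=
  (mem_HomSec_iff D₀ D D').2 fun _ hT =>
    corner_mem_USec D₀ D' f ((mem_HomSec_iff D₀ D D').1 hH _ hT)

/-- The module structure on homomorphisms given by precomposition with `f⌟`. -/
@[reducible]
def preModule (r k s j : ℕ) : Module (Fn n M) (HomSec D₀ D D' r k s j) where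
  smul f H := ⟨fun p => H.1 p ∘ₗ corner D₀ D f p, comp_corner_mem_HomSec D₀ D D' f H.2⟩
  one_smul H := Subtype.ext <| funext fun p => LinearMap.ext fun S =>
    congrArg (H.1 p) (LinearMap.congr_fun (corner_one D₀ D) S)
  mul_smul f g H := Subtype.ext <| funext fun p => LinearMap.ext fun S =>
    -- Precomposition reverses the order of the factors; commutativity of the functions restores it.
    congrArg (H.1 p) (LinearMap.congr_fun
      ((congrArg (fun h => corner D₀ D h p) (mul_comm f g)).trans (corner_mul D₀ D g f)) S)
  smul_zero _ := rfl
  smul_add _ _ _ := rfl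
  add_smul f g H := Subtype.ext <| funext fun p => LinearMap.ext fun S =>
    (congrArg (H.1 p) (LinearMap.congr_fun (corner_add D₀ D f g) S)).trans (map_add (H.1 p) _ _)
  zero_smul H := Subtype.ext <| funext fun p => LinearMap.ext fun S =>
    (congrArg (H.1 p) (LinearMap.congr_fun (corner_zero D₀ D) S)).trans (map_zero (H.1 p))

/-- The module structure on homomorphisms given by postcomposition with `f⌟`. -/
@[reducible]
def postModule (r k s j : ℕ) : Module (Fn n M) (HomSec D₀ D D' r k s j) where
  smul f H := ⟨fun p => corner D₀ D' f p ∘ₗ H.1 p, corner_comp_mem_HomSec D₀ D D' f H.2⟩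
  one_smul H := Subtype.ext <| funext fun p => LinearMap.ext fun S =>
    LinearMap.congr_fun (corner_one D₀ D') (H.1 p S)
  mul_smul f g H := Subtype.ext <| funext fun p => LinearMap.ext fun S =>
    LinearMap.congr_fun (corner_mul D₀ D' f g) (H.1 p S)
  smul_zero f := Subtype.ext <| funext fun p => LinearMap.ext fun _ => map_zero (corner D₀ D' f p)
  smul_add f G H := Subtype.ext <| funext fun p => LinearMap.ext fun S =>
    map_add (corner D₀ D' f p) (G.1 p S) (H.1 p S)
  add_smul f g H := Subtype.ext <| funext fun p => LinearMap.ext fun S =>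
    LinearMap.congr_fun (corner_add D₀ D' f g) (H.1 p S)
  zero_smul H := Subtype.ext <| funext fun p => LinearMap.ext fun S =>
    LinearMap.congr_fun (corner_zero D₀ D') (H.1 p S)

/-- The family of homomorphisms with prescribed matrices in the frames selected by `σ`. -/
def glueHom (σ : M → M) (a : Idx n d' s j × Idx n d r k → Fn n M) (p : M) :
    U D₀ D r k p →ₗ[ℝ] U D₀ D' s j p where
  toFun S := ∑ x, (a x p * ucoord D₀ D (σ p) p S x.2) • frameU D₀ D' (σ p) x.1 p
  map_add' S T := by
    simp only [map_add, Pi.add_apply, mul_add, add_smul, Finset.sum_add_distrib]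
  map_smul' c S := by
    simp only [map_smul, Pi.smul_apply, smul_eq_mul, mul_left_comm _ c, mul_smul, Finset.smul_sum,
      RingHom.id_apply]

theorem glueHom_apply (σ : M → M) (a : Idx n d' s j × Idx n d r k → Fn n M) (S : U D₀ D r k p)
    (θ : Form n d' F j) : (glueHom D₀ D D' σ a p S).1 θ =
      ∑ x, (a x p * ucoord D₀ D (σ p) p S x.2) * (frameU D₀ D' (σ p) x.1 p).1 θ := by
  change (∑ x, (a x p * ucoord D₀ D (σ p) p S x.2) • frameU D₀ D' (σ p) x.1 p).1 θ = _
  rw [Submodule.coe_sum, LinearMap.sum_apply]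
  rfl

theorem glueHom_mem_HomSec {W : Set M} {σ : M → M} (hWo : IsOpen W)
    (hσ : ∀ p ∈ W, p ∈ dom₂ n d E d' F (σ p)) (hσc : ∀ p ∈ W, ∀ᶠ q in nhds p, σ q = σ p)
    {a : Idx n d' s j × Idx n d r k → Fn n M} (ha : ∀ x, tsupport (a x) ⊆ W) :
    glueHom D₀ D D' σ a ∈ HomSec D₀ D D' r k s j := by
  refine (mem_HomSec_iff D₀ D D').2 fun T hT => (mem_USec_iff D₀ D').2 fun θ => ?_
  refine contMDiff_of_forall_mem ha (fun q hq => ?_) fun p hp => ?_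
  · refine ContMDiffAt.congr_of_eventuallyEq (f := fun p =>
      ∑ x, (a x p * ucoord D₀ D (σ q) p (T p) x.2) * frame (σ q) x.1 p θ) ?_ ?_
    · exact ContMDiffAt.sum fun x _ => ((a x).contMDiff.contMDiffAt.mul
        (contMDiffAt_ucoord D₀ D ((mem_USec_iff D₀ D).1 hT) (hσ q hq).1 x.2)).mul
        (contMDiffAt_frame (hσ q hq).2 x.1 θ)
    · filter_upwards [hσc q hq, hWo.mem_nhds hq] with p hp hpW
      rw [glueHom_apply, hp]
      refine Finset.sum_congr rfl fun x _ => ?_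
      rw [frameU_apply D₀ D' (hp ▸ (hσ p hpW).2)]
  · rw [glueHom_apply]
    exact Finset.sum_eq_zero fun x _ => by rw [hp, zero_mul, zero_mul]

theorem hcoord_glueHom {σ : M → M} (hσ : p ∈ dom₂ n d E d' F (σ p))
    (a : Idx n d' s j × Idx n d r k → Fn n M) (x : Idx n d' s j × Idx n d r k) :
    hcoord D₀ D D' (σ p) p (glueHom D₀ D D' σ a p) x = a x p := by
  classical
  change ucoord D₀ D' (σ p) p (∑ y, (a y p * ucoord D₀ D (σ p) p (frameU D₀ D (σ p) x.2 p) y.2) •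
    frameU D₀ D' (σ p) y.1 p) x.1 = _
  rw [map_sum, Finset.sum_apply, Finset.sum_eq_single x]
  · rw [map_smul, Pi.smul_apply, ucoord_frameU D₀ D hσ.1, ucoord_frameU D₀ D' hσ.2]
    simp
  · intro y _ hy
    rw [map_smul, Pi.smul_apply, ucoord_frameU D₀ D hσ.1, ucoord_frameU D₀ D' hσ.2]
    by_cases h1 : x.2 = y.2
    · rw [if_neg (c := y.1 = x.1) fun h => hy (Prod.ext h h1.symm), smul_zero]
    · rw [if_neg h1, mul_zero, zero_smul]
  · simp

theorem hom_eq_zero (hp : p ∈ dom₂ n d E d' F p₀) {H : U D₀ D r k p →ₗ[ℝ] U D₀ D' s j p}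
    (h : ∀ x, hcoord D₀ D D' p₀ p H x = 0) (S : U D₀ D r k p) : H S = 0 := by
  refine ext_ucoord D₀ D' hp.2 (funext fun i' => ?_)
  rw [ucoord_apply D₀ D D' hp.1, map_zero]
  exact Finset.sum_eq_zero fun i _ => by rw [h, zero_mul]

/-- Matrix entries as graded coordinates, for a module structure and a grading that are compatible
with each other. -/
def homCoords (m : Module (Fn n M) (HomSec D₀ D D' r k s j))
    (deg : Idx n d' s j × Idx n d r k → ℕ)
    (hdeg : ∀ t (p p₀ p₁ : M) (H : U D₀ D r k p →ₗ[ℝ] U D₀ D' s j p), p ∈ dom₂ n d E d' F p₀ →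
      p ∈ dom₂ n d E d' F p₁ → (∀ x, t ≤ deg x → hcoord D₀ D D' p₀ p H x = 0) →
      ∀ x, t ≤ deg x → hcoord D₀ D D' p₁ p H x = 0)
    (hm : ∀ (f : Fn n M) (H : HomSec D₀ D D' r k s j) p₀, ∀ p ∈ dom₂ n d E d' F p₀, ∀ x,
      (∀ y, deg x < deg y → hcoord D₀ D D' p₀ p (H.1 p) y = 0) →
      hcoord D₀ D D' p₀ p ((f • H).1 p) x = f p * hcoord D₀ D D' p₀ p (H.1 p) x) :
    GradedCoords n M (HomSec D₀ D D' r k s j) (Idx n d' s j × Idx n d r k) where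
  dom := dom₂ n d E d' F
  isOpen_dom := isOpen_dom₂
  mem_dom := mem_dom₂_self
  deg := deg
  coord p₀ H x p := hcoord D₀ D D' p₀ p (H.1 p) x
  coord_add p₀ p _ G H x :=
    congrFun (map_add (ucoord D₀ D' p₀ p) (G.1 p (frameU D₀ D p₀ x.2 p)) (H.1 p _)) x.1
  smooth p₀ H x := contMDiffOn_hcoord D₀ D D' ((mem_HomSec_iff D₀ D D').1 H.2) p₀ x
  vanish_congr t H p p₀ p₁ hp₀ hp₁ h := hdeg t p p₀ p₁ (H.1 p) hp₀ hp₁ h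
  eq_zero H h := Subtype.ext <| funext fun p => LinearMap.ext fun S =>
    hom_eq_zero D₀ D D' (mem_dom₂_self p) (h p) S
  realize W σ hWo hσ hσc a ha := by
    refine ⟨⟨_, glueHom_mem_HomSec D₀ D D' hWo hσ hσc ha⟩, fun p hp x =>
      hcoord_glueHom D₀ D D' (hσ p hp) a x, fun p hp x => ?_⟩
    have h0 : glueHom D₀ D D' σ a p (frameU D₀ D p x.2 p) = 0 :=
      Finset.sum_eq_zero fun y _ => by
        rw [image_eq_zero_of_notMem_tsupport fun h => hp (ha y h), zero_mul, zero_smul]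
    change ucoord D₀ D' p p (glueHom D₀ D D' σ a p (frameU D₀ D p x.2 p)) x.1 = 0
    rw [h0, map_zero]
    rfl
  coord_smul := hm

theorem frameU_mem_Ult (p₀ p : M) {i : Idx n d r k} {t : ℕ} (hi : i.1.1 < t) :
    (frameU D₀ D p₀ i p).1 ∈ Ult D₀ D t k p := by
  classical
  by_cases hp : p ∈ dom n d E p₀
  · refine (mem_Ult_iff D₀ D hp).2 fun i' hi' => ?_
    rw [ucoord_frameU D₀ D hp, if_neg]
    rintro rfl
    omega
  · rw [frameU, dif_neg hp]
    exact zero_mem _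

/-- The matrix entries of high target order vanish if and only if all values have low order. -/
theorem hcoord_eq_zero_iff_mem_Ult (hp : p ∈ dom₂ n d E d' F p₀) {t : ℕ}
    {H : U D₀ D r k p →ₗ[ℝ] U D₀ D' s j p} :
    (∀ x : Idx n d' s j × Idx n d r k, t ≤ x.1.1.1 → hcoord D₀ D D' p₀ p H x = 0) ↔
      ∀ S, (H S).1 ∈ Ult D₀ D' t j p := by
  refine ⟨fun h S => (mem_Ult_iff D₀ D' hp.2).2 fun i' hi' => ?_, fun h x hx =>
    (mem_Ult_iff D₀ D' hp.2).1 (h _) x.1 hx⟩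
  rw [ucoord_apply D₀ D D' hp.1]
  exact Finset.sum_eq_zero fun i _ => by rw [h (i', i) hi', zero_mul]

/-- The matrix entries of low source order vanish if and only if elements of low order are mapped
to zero. -/
theorem hcoord_eq_zero_iff_apply_eq_zero (hp : p ∈ dom₂ n d E d' F p₀) {t : ℕ}
    {H : U D₀ D r k p →ₗ[ℝ] U D₀ D' s j p} :
    (∀ x : Idx n d' s j × Idx n d r k, x.2.1.1 < t → hcoord D₀ D D' p₀ p H x = 0) ↔
      ∀ S : U D₀ D r k p, S.1 ∈ Ult D₀ D t k p → H S = 0 := by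
  refine ⟨fun h S hS => ext_ucoord D₀ D' hp.2 (funext fun i' => ?_), fun h x hx => ?_⟩
  · rw [ucoord_apply D₀ D D' hp.1, map_zero]
    refine Finset.sum_eq_zero fun i _ => ?_
    by_cases hi : i.1.1 < t
    · rw [h (i', i) hi, zero_mul]
    · rw [(mem_Ult_iff D₀ D hp.1).1 hS i (not_lt.1 hi), mul_zero]
  · rw [hcoord, h _ (frameU_mem_Ult D₀ D p₀ p hx), map_zero]
    rfl

/-- The graded coordinates for the action by postcomposition. -/
def postCoords (r k s j : ℕ) : @GradedCoords n M _ _ (HomSec D₀ D D' r k s j) _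
    (postModule D₀ D D' r k s j) (Idx n d' s j × Idx n d r k) :=
  homCoords D₀ D D' (postModule D₀ D D' r k s j) (fun x => x.1.1.1)
    (fun _ _ _ _ _ hp₀ hp₁ h => (hcoord_eq_zero_iff_mem_Ult D₀ D D' hp₁).2
      ((hcoord_eq_zero_iff_mem_Ult D₀ D D' hp₀).1 h))
    (fun f _ _ _ hp x h => ucoord_corner D₀ D' hp.2 f fun i' hi' => h (i', x.2) hi')

/-- The graded coordinates for the action by precomposition. -/
def preCoords (r k s j : ℕ) : @GradedCoords n M _ _ (HomSec D₀ D D' r k s j) _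
    (preModule D₀ D D' r k s j) (Idx n d' s j × Idx n d r k) :=
  -- Precomposition with `f⌟ - f(p)` involves values of `H` on lower source orders, so entries of
  -- low source order must count as leading: the degree is reversed.
  homCoords D₀ D D' (preModule D₀ D D' r k s j) (fun x => r - x.2.1.1)
    (fun t p p₀ p₁ H hp₀ hp₁ h x hx => by
      have h1 : ∀ x : Idx n d' s j × Idx n d r k, t ≤ r - x.2.1.1 ↔ x.2.1.1 < r + 1 - t :=
        fun x => by have := x.2.1.1.2; omega
      simp only [h1] at h hx
      exact (hcoord_eq_zero_iff_apply_eq_zero D₀ D D' hp₁).2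
        ((hcoord_eq_zero_iff_apply_eq_zero D₀ D D' hp₀).1 h) x hx)
    (fun f H p₀ p hp x h => by
      have h1 := (hcoord_eq_zero_iff_apply_eq_zero D₀ D D' hp (t := x.2.1.1) (H := H.1 p)).1
        fun y hy => h y (by have := x.2.1.1.2; omega)
      have h2 : H.1 p (corner D₀ D f p (frameU D₀ D p₀ x.2 p) + (-f p) • frameU D₀ D p₀ x.2 p) = 0 :=
        h1 _ (corner_add_neg_smul_mem D₀ D f
          (frameU_mem_Ult D₀ D p₀ p (t := x.2.1.1 + 1) (Nat.lt_succ_self _)))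
      have h3 : ucoord D₀ D' p₀ p (H.1 p (corner D₀ D f p (frameU D₀ D p₀ x.2 p))) x.1 +
          -f p * ucoord D₀ D' p₀ p (H.1 p (frameU D₀ D p₀ x.2 p)) x.1 = 0 := by
        have := congrFun (congrArg (ucoord D₀ D' p₀ p) h2) x.1
        rw [map_add, map_smul, map_add, map_smul, map_zero] at this
        exact this
      change ucoord D₀ D' p₀ p (H.1 p (corner D₀ D f p (frameU D₀ D p₀ x.2 p))) x.1 =
        f p * ucoord D₀ D' p₀ p (H.1 p (frameU D₀ D p₀ x.2 p)) x.1
      linarith)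

/-- The correction has order below zero, hence vanishes. This makes the action by precomposition
fibrewise on homomorphisms out of order zero, so that any frame-independent grading is admissible
there. -/
theorem corner_eq_smul (f : Fn n M) (S : U D₀ D 0 k p) : corner D₀ D f p S = f p • S := by
  have h : S.1 ∘ₗ mulForm f + (-f p) • S.1 = 0 := corner_add_neg_smul_mem D₀ D f S.2
  refine Subtype.ext (LinearMap.ext fun η => ?_)
  have := LinearMap.congr_fun h η
  change S.1 (mulForm f η) + -f p * S.1 η = 0 at this
  change S.1 (mulForm f η) = f p * S.1 η
  linarith

/-- The coordinates graded by the target order, for the action by precomposition on homomorphisms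
from functionals of order zero. -/
def preCoordsZero (k s j : ℕ) : @GradedCoords n M _ _ (HomSec D₀ D D' 0 k s j) _
    (preModule D₀ D D' 0 k s j) (Idx n d' s j × Idx n d 0 k) :=
  homCoords D₀ D D' (preModule D₀ D D' 0 k s j) (fun x => x.1.1.1)
    (fun _ _ _ _ _ hp₀ hp₁ h => (hcoord_eq_zero_iff_mem_Ult D₀ D D' hp₁).2
      ((hcoord_eq_zero_iff_mem_Ult D₀ D D' hp₀).1 h))
    (fun f H p₀ p _ x _ => by
      change ucoord D₀ D' p₀ p (H.1 p (corner D₀ D f p (frameU D₀ D p₀ x.2 p))) x.1 =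
        f p * ucoord D₀ D' p₀ p (H.1 p (frameU D₀ D p₀ x.2 p)) x.1
      rw [corner_eq_smul, map_smul, map_smul]
      rfl)

end HomModules

/-! ### Differentiation raises the order of the leading part; functionals of order zero. -/

section Symbol

variable {n : ℕ} {M : Type*} [TopologicalSpace M] [ChartedSpace (Rn n) M] [IsManifold (𝓡 n) ∞ M]
  {d : ℕ} {E : M → Type*} [TopologicalSpace (TotalSpace (Rn d) E)]
  [∀ x, AddCommGroup (E x)] [∀ x, Module ℝ (E x)] [∀ x, TopologicalSpace (E x)]
  [∀ x, IsTopologicalAddGroup (E x)] [∀ x, ContinuousSMul ℝ (E x)]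
  [FiberBundle (Rn d) E] [VectorBundle ℝ (Rn d) E]
  [ContMDiffVectorBundle ∞ (Rn d) E (𝓡 n)] [T2Space M]
  (D₀ : CovariantDerivative (𝓡 n) (Rn n) (TangentSpace (𝓡 n) : M → Type _))
  [D₀.ContMDiffCovariantDerivative ∞]
  (D : CovariantDerivative (𝓡 n) (Rn d) E) [D.ContMDiffCovariantDerivative ∞]

variable {r k : ℕ} {p₀ p : M}

/-- Prepending the first coordinate to a nondecreasing word. -/
def Idx.cons (hn : 0 < n) (i : Idx n d r k) : Idx n d (r + 1) k :=
  (⟨⟨i.1.1 + 1, Nat.succ_lt_succ i.1.1.2⟩,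
    ⟨(Fin.cons ⟨0, hn⟩ i.1.2 : Fin (i.1.1 + 1) → Fin n), by
      intro a b hab
      induction a using Fin.cases with
      | zero => exact Nat.zero_le _
      | succ a =>
        induction b using Fin.cases with
        | zero => exact absurd hab (by simp)
        | succ b => simpa using i.1.2.monotone (Fin.succ_le_succ_iff.1 hab)⟩⟩, i.2)

theorem Idx.cons_injective (hn : 0 < n) :
    Function.Injective (Idx.cons hn : Idx n d r k → Idx n d (r + 1) k) := by
  rintro ⟨⟨⟨a, ha⟩, w⟩, K⟩ ⟨⟨⟨b, hb⟩, w'⟩, K'⟩ h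
  have h1 := congrArg Prod.fst h
  have h2 : K = K' := congrArg Prod.snd h
  have h3 : a = b := Nat.succ_injective (congrArg (fun x => (x.1 : ℕ)) h1)
  subst h3 h2
  have h4 := eq_of_heq (Sigma.mk.inj h1).2
  have h5 : w = w' := by
    ext l
    have := congrArg (fun u : Fin (a + 1) →o Fin n => (u l.succ : ℕ)) h4
    exact this
  rw [h5]

theorem basisAt_cons (hp : p ∈ dom n d E p₀) (hn : 0 < n) (i : Idx n d r k) (η : Form n d E k) :
    (basisAt D₀ D hp (i.cons hn)).1 η =
      wordD p₀ i.2 (Fin.cons ⟨0, hn⟩ i.1.2 : Fin (i.1.1 + 1) → Fin n) p η := by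
  rw [coe_basisAt, frameL_apply hp]
  rfl

theorem mvfderiv_sum_apply {ι : Type*} (s : Finset ι) {f : ι → M → ℝ}
    (hf : ∀ i, MDifferentiableAt (𝓡 n) 𝓘(ℝ) (f i) p) (v : TangentSpace (𝓡 n) p) :
    mvfderiv (𝓡 n) (fun q => ∑ i ∈ s, f i q) p v = ∑ i ∈ s, mvfderiv (𝓡 n) (f i) p v := by
  classical
  have h : MDifferentiableAt (𝓡 n) 𝓘(ℝ) (fun q => ∑ i ∈ s, f i q) p ∧
      mvfderiv (𝓡 n) (fun q => ∑ i ∈ s, f i q) p v = ∑ i ∈ s, mvfderiv (𝓡 n) (f i) p v := by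
    induction s using Finset.induction_on with
    | empty =>
      simp only [Finset.sum_empty]
      exact ⟨mdifferentiableAt_const, by rw [mvfderiv_const]; rfl⟩
    | insert a s ha ih =>
      simp only [Finset.sum_insert ha]
      refine ⟨(hf a).add ih.1, ?_⟩
      rw [mvfderiv_fun_add (hf a) ih.1, ← ih.2]
      rfl
  exact h.2

/-- A section of functionals of order at most `r` has order less than `r` at a point where all its
derivatives have order at most `r`. -/
theorem mem_Ult_of_forall_lie (hn : 0 < n) {T : ∀ p : M, U D₀ D r k p} (hT : T ∈ USec D₀ D r k)
    {q : M} (h : ∀ X : VF n M, ∃ S ∈ U D₀ D r k q, ∀ η,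
      S η = mvfderiv (𝓡 n) (fun p => (T p).1 η) q (X q)) : (T q).1 ∈ Ult D₀ D r k q := by
  classical
  have hq := mem_dom_self (n := n) (d := d) (E := E) q
  -- Differentiation along the first coordinate is chosen because prepending the smallest letter
  -- keeps words nondecreasing and therefore sends frame elements to frame elements.
  obtain ⟨X, hX⟩ := exists_section_apply_eq (n := n) (d := n)
    (E := (TangentSpace (𝓡 n) : M → Type _)) q ((trivializationAt (Rn n) (TangentSpace (𝓡 n)) q).symm q (EuclideanSpace.single ⟨0, hn⟩ 1))
  obtain ⟨S, hS, hSX⟩ := h X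
  let a : Idx n d r k → M → ℝ := fun i p => ucoord D₀ D q p (T p) i
  have ha : ∀ i, MDifferentiableAt (𝓡 n) 𝓘(ℝ) (a i) q := fun i =>
    (contMDiffAt_ucoord D₀ D ((mem_USec_iff D₀ D).1 hT) hq i).mdifferentiableAt (by simp)
  have hf : ∀ (i : Idx n d r k) (η : Form n d E k),
      MDifferentiableAt (𝓡 n) 𝓘(ℝ) (fun p => frame q i p η) q := fun i η =>
    (contMDiffAt_frame hq i η).mdifferentiableAt (by simp)
  let V : U D₀ D (r + 1) k q := ∑ i, a i q • basisAt D₀ D hq (i.cons hn)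
  have hV : V.1 + ∑ i, mvfderiv (𝓡 n) (a i) q (X q) • frameL q i q = S := by
    refine LinearMap.ext fun η => ?_
    have h1 : (fun p => (T p).1 η) =ᶠ[nhds q] fun p => ∑ i, a i p * frame q i p η := by
      filter_upwards [(isOpen_dom (n := n) (d := d) (E := E) q).mem_nhds hq] with p hp
      exact apply_eq_sum_ucoord D₀ D hp (T p) η
    have h2 : mvfderiv (𝓡 n) (fun p => ∑ i, a i p * frame q i p η) q (X q) =
        ∑ i, (mvfderiv (𝓡 n) (a i) q (X q) * frame q i q η +
          a i q * (basisAt D₀ D hq (i.cons hn)).1 η) := by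
      rw [mvfderiv_sum_apply (f := fun i p => a i p * frame q i p η) _ fun i => (ha i).mul (hf i η)]
      refine Finset.sum_congr rfl fun i _ => ?_
      rw [mvfderiv_fun_mul (ha i) (hf i η), basisAt_cons, ← mvfderiv_wordD hq, ← hX]
      change a i q * mvfderiv (𝓡 n) (fun p => frame q i p η) q (X q) +
        frame q i q η * mvfderiv (𝓡 n) (a i) q (X q) = _
      rw [add_comm, mul_comm (frame q i q η)]
      rfl
    rw [hSX, mvfderiv_congr_of_eventuallyEq h1, h2, Finset.sum_add_distrib, add_comm,
      LinearMap.add_apply, LinearMap.sum_apply, Submodule.coe_sum, LinearMap.sum_apply]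
    congr 1
    exact Finset.sum_congr rfl fun i _ => by
      rw [LinearMap.smul_apply, frameL_apply hq, smul_eq_mul]
  have hVU : V.1 ∈ Ult D₀ D (r + 1) k q := by
    rw [eq_sub_of_add_eq hV]
    exact sub_mem hS (sum_mem fun i _ => Submodule.smul_mem _ _ (frameL_mem_U D₀ D hq i))
  refine (mem_Ult_iff D₀ D hq).2 fun i hi => ?_
  -- The coefficient of the lengthened word in the derivative is the old coefficient at `q`, as
  -- `Idx.cons` is injective. It vanishes because the derivative has order at most `r`.
  have h3 := (mem_Ult_iff D₀ D hq).1 hVU (i.cons hn) (Nat.succ_le_succ hi)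
  rw [map_sum, Finset.sum_apply, Finset.sum_eq_single i, map_smul, Pi.smul_apply, ucoord_basisAt,
    if_pos rfl, smul_eq_mul, mul_one] at h3
  · exact h3
  · intro i' _ hi'
    rw [map_smul, Pi.smul_apply, ucoord_basisAt, if_neg ((Idx.cons_injective hn).ne hi'), smul_zero]
  · simp

/-- The derivative of a section of functionals of order at most `r` has order at most `r + 1`. -/
theorem exists_mem_U_eq_lie {T : ∀ p : M, U D₀ D r k p} (hT : T ∈ USec D₀ D r k) (X : VF n M)
    (q : M) : ∃ S ∈ U D₀ D (r + 1) k q, ∀ η,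
      S η = mvfderiv (𝓡 n) (fun p => (T p).1 η) q (X q) := by
  obtain ⟨P, hP, h⟩ := exists_Op_eventuallyEq D₀ D hT q
  obtain ⟨S, hS, hS'⟩ := Op_apply_mem D₀ D q (lie_Op D₀ D X hP)
  refine ⟨S, hS, fun η => (hS' η).trans (mvfderiv_congr_of_eventuallyEq ?_ (X q)).symm⟩
  filter_upwards [h] with p hp using hp η

/-- Evaluation of forms on vectors of a fibre. -/
def evL (v : Fin k → E p) : Form n d E k →ₗ[ℝ] ℝ where
  toFun η := η.1 p v
  map_add' _ _ := rfl
  map_smul' _ _ := rfl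

theorem evL_mem_U (v : Fin k → E p) : evL (n := n) (d := d) v ∈ U D₀ D r k p := by
  choose s hs using fun i => exists_section_apply_eq (n := n) (d := d) p (v i)
  obtain rfl : (fun i => s i p) = v := funext hs
  exact Phi_mem D₀ D (Nat.zero_le r) p Fin.elim0 s

/-- A vector of `⋀ᵏ(E_p)` as a functional of order zero. -/
def evU (v : Fin k → E p) : U D₀ D r k p := ⟨evL v, evL_mem_U D₀ D v⟩

theorem evU_mem_USec (t : Fin k → Cₛ^∞⟮𝓡 n; Rn d, E⟯) :
    (fun p => evU D₀ D fun i => t i p) ∈ USec D₀ D r k :=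
  (mem_USec_iff D₀ D).2 fun η => contMDiff_apply t η

/-- A linear form on functionals that is evaluation at `η` on the vectors of `⋀ᵏ(E_p)` is so on all
functionals of order zero. -/
theorem apply_eq_of_mem_U_zero (L : U D₀ D r k p →ₗ[ℝ] ℝ) (η : Form n d E k)
    (h : ∀ v : Fin k → E p, L (evU D₀ D v) = η.1 p v) (S : U D₀ D r k p)
    (hS : S.1 ∈ U D₀ D 0 k p) : L S = S.1 η := by
  obtain ⟨S, hSr⟩ := S
  change S ∈ _ at hS
  have hle : U D₀ D 0 k p ≤ U D₀ D r k p := U_mono D₀ D (Nat.zero_le r)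
  change L ⟨S, hSr⟩ = S η
  induction hS using Submodule.span_induction with
  | mem S hS =>
    obtain ⟨j, hj, X, s, rfl⟩ := hS
    obtain rfl := Nat.le_zero.1 hj
    exact h fun i => s i p
  | zero => exact map_zero L
  | add S T hS hT ihS ihT =>
    exact (map_add L ⟨S, hle hS⟩ ⟨T, hle hT⟩).trans (congrArg₂ (· + ·) (ihS _) (ihT _))
  | smul c S hS ihS =>
    exact (map_smul L c ⟨S, hle hS⟩).trans (congrArg (c * ·) (ihS _))

/-- Over an empty alphabet the only word is the empty one. -/
theorem mem_U_zero_of_isEmpty (hn : n = 0) (S : U D₀ D r k p) : S.1 ∈ U D₀ D 0 k p := by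
  refine (mem_Ult_iff D₀ D (mem_dom_self p) (t := 1)).2 fun i hi => ?_
  have h := (i.1.2 ⟨0, hi⟩).2
  omega

end Symbol

/-! ### Consistent homomorphisms. -/

section Consistent

variable {n : ℕ} {M : Type*} [TopologicalSpace M] [ChartedSpace (Rn n) M] [IsManifold (𝓡 n) ∞ M]
  [T2Space M]
  {d : ℕ} {E : M → Type*} [TopologicalSpace (TotalSpace (Rn d) E)]
  [∀ x, AddCommGroup (E x)] [∀ x, Module ℝ (E x)] [∀ x, TopologicalSpace (E x)]
  [∀ x, IsTopologicalAddGroup (E x)] [∀ x, ContinuousSMul ℝ (E x)]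
  [FiberBundle (Rn d) E] [VectorBundle ℝ (Rn d) E] [ContMDiffVectorBundle ∞ (Rn d) E (𝓡 n)]
  {d' : ℕ} {F : M → Type*} [TopologicalSpace (TotalSpace (Rn d') F)]
  [∀ x, AddCommGroup (F x)] [∀ x, Module ℝ (F x)] [∀ x, TopologicalSpace (F x)]
  [∀ x, IsTopologicalAddGroup (F x)] [∀ x, ContinuousSMul ℝ (F x)]
  [FiberBundle (Rn d') F] [VectorBundle ℝ (Rn d') F] [ContMDiffVectorBundle ∞ (Rn d') F (𝓡 n)]
  (D₀ : CovariantDerivative (𝓡 n) (Rn n) (TangentSpace (𝓡 n) : M → Type _))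
  [D₀.ContMDiffCovariantDerivative ∞]
  (D : CovariantDerivative (𝓡 n) (Rn d) E) [D.ContMDiffCovariantDerivative ∞]
  (D' : CovariantDerivative (𝓡 n) (Rn d') F) [D'.ContMDiffCovariantDerivative ∞]

variable {r k s j : ℕ} {p₀ p : M}

/-- The alternating form `α ↦ H(α)(θ)` on `E_p`. -/
def dualAt (H : U D₀ D r k p →ₗ[ℝ] U D₀ D' s j p) (θ : Form n d' F j) :
    E p [⋀^Fin k]→ₗ[ℝ] ℝ where
  toFun v := (H (evU D₀ D v)).1 θ
  map_update_add' v i x y := by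
    have h : (evU D₀ D (Function.update v i (x + y)) : U D₀ D r k p) =
        evU D₀ D (Function.update v i x) + evU D₀ D (Function.update v i y) :=
      Subtype.ext (LinearMap.ext fun η => (η.1 p).map_update_add v i x y)
    rw [h, map_add]
    rfl
  map_update_smul' v i c x := by
    have h : (evU D₀ D (Function.update v i (c • x)) : U D₀ D r k p) =
        c • evU D₀ D (Function.update v i x) :=
      Subtype.ext (LinearMap.ext fun η => (η.1 p).map_update_smul v i c x)
    rw [h, map_smul]
    rfl
  map_eq_zero_of_eq' v i i' hv hi := by
    have h : (evU D₀ D v : U D₀ D r k p) = 0 :=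
      Subtype.ext (LinearMap.ext fun η => (η.1 p).map_eq_zero_of_eq v hv hi)
    rw [h, map_zero]
    rfl

theorem contMDiffOn_dualAt (H : HomSec D₀ D D' r k s j) (θ : Form n d' F j) (p₀ : M)
    (v : Fin k → Rn d) : ContMDiffOn (𝓡 n) 𝓘(ℝ) ∞
      (fun p => dualAt D₀ D D' (H.1 p) θ fun i => (trivializationAt (Rn d) E p₀).symm p (v i))
      (trivializationAt (Rn d) E p₀).baseSet := by
  intro q hq
  choose t ht using fun i => exists_section_eventuallyEq_symm (n := n) (E := E) hq (v i)
  refine (ContMDiffAt.congr_of_eventuallyEq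
    ((mem_USec_iff D₀ D').1 ((mem_HomSec_iff D₀ D D').1 H.2 _ (evU_mem_USec D₀ D t)) θ q)
    ?_).contMDiffWithinAt
  filter_upwards [Filter.eventually_all.2 ht] with p hp
  have h : (fun i => (trivializationAt (Rn d) E p₀).symm p (v i)) = fun i => t i p :=
    funext fun i => (hp i).symm
  rw [h]
  rfl

/-- The operator `H* : C^∞(⋀ʲ(F*)) → C^∞(⋀ᵏ(E*))`. -/
def dualOp (H : HomSec D₀ D D' r k s j) : Form n d' F j →ₗ[ℝ] Form n d E k where
  toFun θ := ⟨fun p => dualAt D₀ D D' (H.1 p) θ, contMDiffOn_dualAt D₀ D D' H θ⟩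
  map_add' θ θ' := Subtype.ext <| funext fun p => AlternatingMap.ext fun v =>
    map_add (H.1 p (evU D₀ D v)).1 θ θ'
  map_smul' c θ := Subtype.ext <| funext fun p => AlternatingMap.ext fun v =>
    map_smul (H.1 p (evU D₀ D v)).1 c θ

/-- The formula defining `H*` is the consistency equation on functionals of order zero, so any
operator satisfying that equation throughout must be `H*`. -/
theorem isConsistent_iff_exists {H : ∀ p : M, U D₀ D r k p →ₗ[ℝ] U D₀ D' s j p} :
    IsConsistent D₀ D D' H ↔ ∃ Hstar : Form n d' F j → Form n d E k,
      ∀ (p : M) (S : U D₀ D r k p) (θ : Form n d' F j), (H p S).1 θ = S.1 (Hstar θ) :=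
  ⟨fun ⟨Hstar, _, h⟩ => ⟨Hstar, h⟩, fun ⟨Hstar, h⟩ => ⟨Hstar, fun θ p t =>
    (h p ⟨Phi D₀ D p 0 Fin.elim0 t, Phi_mem D₀ D (Nat.zero_le r) p _ t⟩ θ).symm, h⟩⟩

theorem isConsistent_iff (H : HomSec D₀ D D' r k s j) : IsConsistent D₀ D D' H.1 ↔
    ∀ (p : M) (S : U D₀ D r k p) (θ : Form n d' F j),
      (H.1 p S).1 θ = S.1 (dualOp D₀ D D' H θ) := by
  rw [isConsistent_iff_exists]
  refine ⟨fun ⟨Hstar, h⟩ p S θ => ?_, fun h => ⟨_, h⟩⟩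
  have : Hstar θ = dualOp D₀ D D' H θ := Subtype.ext <| funext fun p => AlternatingMap.ext fun v =>
    (h p (evU D₀ D v) θ).symm
  rw [h, this]

/-- On functionals of order zero every homomorphism is given by its dual operator. -/
theorem apply_eq_dualOp (H : HomSec D₀ D D' r k s j) {S : U D₀ D r k p} (hS : S.1 ∈ U D₀ D 0 k p)
    (θ : Form n d' F j) : (H.1 p S).1 θ = S.1 (dualOp D₀ D D' H θ) :=
  apply_eq_of_mem_U_zero D₀ D (LinearMap.applyₗ θ ∘ₗ (U D₀ D' s j p).subtype ∘ₗ H.1 p) _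
    (fun _ => rfl) S hS

/-- A consistent homomorphism maps low orders to low orders. -/
theorem apply_mem_Ult (hn : 0 < n) {H : HomSec D₀ D D' r k s j}
    (hH : IsConsistent D₀ D D' H.1) (m : ℕ) (hm : m ≤ r) (p : M) (S : U D₀ D r k p)
    (hS : S.1 ∈ Ult D₀ D (r + 1 - m) k p) : (H.1 p S).1 ∈ Ult D₀ D' (s + 1 - m) j p := by
  rw [isConsistent_iff] at hH
  induction m generalizing p with
  | zero => exact (H.1 p S).2
  | succ m ih =>
    obtain ⟨ρ, rfl⟩ : ∃ ρ, r = ρ + 1 + m := ⟨r - 1 - m, by omega⟩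
    have e1 : ρ + 1 + m + 1 - m = (ρ + 1) + 1 := by omega
    have e2 : ρ + 1 + m + 1 - (m + 1) = ρ + 1 := by omega
    have ih' := fun p S hS => ih (by omega) p S hS
    rw [e1] at ih'
    rw [e2] at hS
    have hle : U D₀ D (ρ + 1) k p ≤ U D₀ D (ρ + 1 + m) k p := U_mono D₀ D (by omega)
    -- Here the truncated bounds on the target order are already zero and the claim is that the
    -- image vanishes, which the previous step gives.
    by_cases hms : s + 1 ≤ m
    · have h0 := ih' p S (Ult_mono D₀ D (Nat.le_succ _) hS)
      rw [Nat.sub_eq_zero_of_le hms] at h0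
      rwa [Nat.sub_eq_zero_of_le (by omega : s + 1 ≤ m + 1)]
    · obtain ⟨σ, rfl⟩ : ∃ σ, s = σ + m := ⟨s - m, by omega⟩
      have e3 : σ + m + 1 - m = σ + 1 := by omega
      have e4 : σ + m + 1 - (m + 1) = σ := by omega
      rw [e3] at ih'
      rw [e4]
      -- Extend `S` to a section `T` of order at most `ρ`, so that its image under `H` can be
      -- differentiated.
      obtain ⟨P, hP, hPS⟩ := exists_Op_apply_eq D₀ D (r := ρ) ⟨S.1, hS⟩
      obtain ⟨T, hT, hTP⟩ := exists_USec_of_Op D₀ D hP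
      have hTr : ∀ q, (T q).1 ∈ U D₀ D (ρ + 1 + m) k q := fun q => U_mono D₀ D (by omega) (T q).2
      have hTS : (⟨(T p).1, hTr p⟩ : U D₀ D (ρ + 1 + m) k p) = S :=
        Subtype.ext (LinearMap.ext fun η => (hTP p η).trans (hPS η).symm)
      have hval : ∀ q θ, (H.1 q ⟨(T q).1, hTr q⟩).1 θ = P (dualOp D₀ D D' H θ) q := fun q θ =>
        (hH q _ θ).trans (hTP q _)
      let G : ∀ q, U D₀ D' σ j q := fun q =>
        ⟨(H.1 q ⟨(T q).1, hTr q⟩).1, ih' q _ (U_mono D₀ D (Nat.le_succ ρ) (T q).2)⟩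
      have hG : ∀ θ, (fun q => (G q).1 θ) = P (dualOp D₀ D D' H θ) := fun θ =>
        funext fun q => hval q θ
      have hGs : G ∈ USec D₀ D' σ j := (mem_USec_iff D₀ D').2 fun θ => by
        rw [hG]
        exact (P _).contMDiff
      -- By consistency, the derivative of the image of `T` is the image of the derivative of `T`.
      -- The latter has order at most `ρ + 1`, so by induction its image has order at most `σ`;
      -- hence the image of `T` has order below `σ` at `p`.
      have key := mem_Ult_of_forall_lie D₀ D' hn hGs (q := p) fun X => by
        obtain ⟨V, hV, hVP⟩ := Op_apply_mem D₀ D p (lie_Op D₀ D X hP)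
        refine ⟨_, ih' p ⟨V, hle hV⟩ hV, fun θ => ?_⟩
        rw [hH, hG]
        exact hVP _
      rw [← hTS]
      exact key

/-- The restriction of a homomorphism to functionals of order zero. -/
def restrict (H : HomSec D₀ D D' r k s j) : HomSec D₀ D D' 0 k s j :=
  ⟨fun p => H.1 p ∘ₗ Submodule.inclusion (U_mono D₀ D (Nat.zero_le r)),
    (mem_HomSec_iff D₀ D D').2 fun T hT => (mem_HomSec_iff D₀ D D').1 H.2
      (fun p => Submodule.inclusion (U_mono D₀ D (Nat.zero_le r)) (T p))
      ((mem_USec_iff D₀ D).2 fun η => (mem_USec_iff D₀ D).1 hT η)⟩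

theorem dualOp_restrict (H : HomSec D₀ D D' r k s j) :
    dualOp D₀ D D' (restrict D₀ D D' H) = dualOp D₀ D D' H := rfl

/-- A consistent homomorphism is composition with its dual operator, which sees only functionals of
order zero. -/
theorem eq_of_restrict_eq {G H : HomSec D₀ D D' r k s j} (hG : IsConsistent D₀ D D' G.1)
    (hH : IsConsistent D₀ D D' H.1) (h : restrict D₀ D D' G = restrict D₀ D D' H) : G = H := by
  rw [isConsistent_iff] at hG hH
  refine Subtype.ext <| funext fun p => LinearMap.ext fun S => Subtype.ext <| LinearMap.ext fun θ => ?_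
  rw [hG, hH, ← dualOp_restrict, h, dualOp_restrict]

/-- The composition of a functional with the dual operator of a homomorphism of low order. -/
theorem comp_dualOp_mem_U {G : HomSec D₀ D D' 0 k s j} {σ : ℕ}
    (hG : ∀ p S, (G.1 p S).1 ∈ U D₀ D' σ j p) (i : ℕ) (X : Fin i → VF n M)
    (t : Fin k → Cₛ^∞⟮𝓡 n; Rn d, E⟯) (p : M) :
    Phi D₀ D p i X t ∘ₗ dualOp D₀ D D' G ∈ U D₀ D' (σ + i) j p := by
  induction i generalizing t p with
  | zero => exact hG p (evU D₀ D fun l => t l p)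
  | succ i ih =>
    have hle : U D₀ D' (σ + i) j p ≤ U D₀ D' (σ + (i + 1)) j p := U_mono D₀ D' (by omega)
    let T : ∀ q, U D₀ D' (σ + i) j q := fun q => ⟨_, ih (Fin.tail X) t q⟩
    have hT : T ∈ USec D₀ D' (σ + i) j := (mem_USec_iff D₀ D').2 fun θ =>
      (higherCov D₀ D i (Fin.tail X) t (dualOp D₀ D D' G θ)).contMDiff
    -- The derivative along `X 0` costs one order on the target side; the connection terms cost
    -- none.
    obtain ⟨V, hV, hV'⟩ := exists_mem_U_eq_lie D₀ D' hT (X 0) p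
    have h : Phi D₀ D p (i + 1) X t ∘ₗ dualOp D₀ D D' G = V
        - ∑ l : Fin k, Phi D₀ D p i (Fin.tail X) (Function.update t l (cov D (X 0) (t l))) ∘ₗ
          dualOp D₀ D D' G
        - ∑ l : Fin i, Phi D₀ D p i
          (Function.update (Fin.tail X) l (cov D₀ (X 0) (Fin.tail X l))) t ∘ₗ
          dualOp D₀ D D' G := by
      refine LinearMap.ext fun θ => ?_
      rw [LinearMap.sub_apply, LinearMap.sub_apply, hV', LinearMap.sum_apply, LinearMap.sum_apply]
      simp only [Phi, higherCov, LinearMap.comp_apply, LinearMap.sub_apply, LinearMap.sum_apply,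
        map_sub, map_sum]
      rfl
    rw [h]
    exact sub_mem (sub_mem hV (sum_mem fun _ _ => hle (ih _ _ _)))
      (sum_mem fun _ _ => hle (ih _ _ _))

/-- A homomorphism of low order on functionals of order zero extends consistently. -/
theorem exists_isConsistent_restrict_eq (hrs : r ≤ s) {G : HomSec D₀ D D' 0 k s j}
    (hG : ∀ p S, (G.1 p S).1 ∈ Ult D₀ D' (s + 1 - r) j p) :
    ∃ H : HomSec D₀ D D' r k s j, IsConsistent D₀ D D' H.1 ∧ restrict D₀ D D' H = G := by
  obtain ⟨σ, rfl⟩ : ∃ σ, s = σ + r := ⟨s - r, by omega⟩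
  rw [show σ + r + 1 - r = σ + 1 by omega] at hG
  have hmem : ∀ p, ∀ S : U D₀ D r k p, S.1 ∘ₗ dualOp D₀ D D' G ∈ U D₀ D' (σ + r) j p := by
    rintro p ⟨S, hS⟩
    change S ∘ₗ dualOp D₀ D D' G ∈ _
    induction hS using Submodule.span_induction with
    | mem S h =>
      obtain ⟨i, hi, X, t, rfl⟩ := h
      exact U_mono D₀ D' (by omega) (comp_dualOp_mem_U D₀ D D' hG i X t p)
    | zero =>
      rw [LinearMap.zero_comp]
      exact zero_mem _
    | add S T _ _ hS hT =>
      rw [LinearMap.add_comp]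
      exact add_mem hS hT
    | smul c S _ hS =>
      rw [LinearMap.smul_comp]
      exact Submodule.smul_mem _ c hS
  let H : ∀ p, U D₀ D r k p →ₗ[ℝ] U D₀ D' (σ + r) j p := fun p =>
    { toFun := fun S => ⟨S.1 ∘ₗ dualOp D₀ D D' G, hmem p S⟩
      map_add' := fun _ _ => rfl
      map_smul' := fun _ _ => rfl }
  have hH : H ∈ HomSec D₀ D D' r k (σ + r) j := (mem_HomSec_iff D₀ D D').2 fun T hT =>
    (mem_USec_iff D₀ D').2 fun θ => (mem_USec_iff D₀ D).1 hT (dualOp D₀ D D' G θ)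
  refine ⟨⟨H, hH⟩, (isConsistent_iff_exists D₀ D D').2 ⟨dualOp D₀ D D' G, fun _ _ _ => rfl⟩, ?_⟩
  refine Subtype.ext <| funext fun p => LinearMap.ext fun S => Subtype.ext <| LinearMap.ext fun θ => ?_
  -- The extension restricts to `G` because on order zero every homomorphism is already composition
  -- with its dual operator.
  exact (apply_eq_dualOp D₀ D D' G S.2 θ).symm

theorem restrict_mem_Ult (hn : 0 < n) {H : HomSec D₀ D D' r k s j}
    (hH : IsConsistent D₀ D D' H.1) (p : M) (S : U D₀ D 0 k p) :
    ((restrict D₀ D D' H).1 p S).1 ∈ Ult D₀ D' (s + 1 - r) j p := by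
  refine apply_mem_Ult D₀ D D' hn hH r le_rfl p _ ?_
  rw [Nat.add_sub_cancel_left]
  exact S.2

theorem isConsistent_of_eq_zero (hn : n = 0) (H : HomSec D₀ D D' r k s j) :
    IsConsistent D₀ D D' H.1 :=
  (isConsistent_iff D₀ D D' H).2 fun _ S θ =>
    apply_eq_dualOp D₀ D D' H (mem_U_zero_of_isEmpty D₀ D hn S) θ

theorem isConsistent_zero : IsConsistent D₀ D D' (0 : HomSec D₀ D D' r k s j).1 :=
  (isConsistent_iff_exists D₀ D D').2 ⟨fun _ => 0, fun _ S _ => (map_zero S.1).symm⟩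

/-- The order bound `s + 1 - r` truncates to zero, so the restriction to order zero vanishes, and
with it the homomorphism. -/
theorem eq_zero_of_lt (hn : 0 < n) (hsr : s < r) {H : HomSec D₀ D D' r k s j}
    (hH : IsConsistent D₀ D D' H.1) : H = 0 := by
  refine eq_of_restrict_eq D₀ D D' hH (isConsistent_zero D₀ D D') ?_
  refine Subtype.ext <| funext fun p => LinearMap.ext fun S => Subtype.ext ?_
  have := restrict_mem_Ult D₀ D D' hn hH p S
  rw [Nat.sub_eq_zero_of_le hsr] at this
  exact this

/-- The submodule of consistent homomorphisms. -/
def consistentSubmodule (m : Module (Fn n M) (HomSec D₀ D D' r k s j))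
    (hm : ∀ (f : Fn n M) (H : HomSec D₀ D D' r k s j), IsConsistent D₀ D D' H.1 →
      IsConsistent D₀ D D' (f • H).1) : Submodule (Fn n M) (HomSec D₀ D D' r k s j) where
  carrier := {H | IsConsistent D₀ D D' H.1}
  zero_mem' := isConsistent_zero D₀ D D'
  add_mem' {G H} hG hH := by
    obtain ⟨g, hg⟩ := (isConsistent_iff_exists D₀ D D').1 hG
    obtain ⟨h, hh⟩ := (isConsistent_iff_exists D₀ D D').1 hH
    refine (isConsistent_iff_exists D₀ D D').2 ⟨g + h, fun p S θ => ?_⟩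
    exact (congrArg₂ (· + ·) (hg p S θ) (hh p S θ)).trans (map_add S.1 _ _).symm
  smul_mem' f H hH := hm f H hH

theorem isConsistent_comp_corner (f : Fn n M) {H : ∀ p : M, U D₀ D r k p →ₗ[ℝ] U D₀ D' s j p}
    (hH : IsConsistent D₀ D D' H) : IsConsistent D₀ D D' fun p => H p ∘ₗ corner D₀ D f p := by
  obtain ⟨h, hh⟩ := (isConsistent_iff_exists D₀ D D').1 hH
  exact (isConsistent_iff_exists D₀ D D').2 ⟨fun θ => mulForm f (h θ), fun p S θ => hh p _ θ⟩

theorem isConsistent_corner_comp (f : Fn n M) {H : ∀ p : M, U D₀ D r k p →ₗ[ℝ] U D₀ D' s j p}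
    (hH : IsConsistent D₀ D D' H) : IsConsistent D₀ D D' fun p => corner D₀ D' f p ∘ₗ H p := by
  obtain ⟨h, hh⟩ := (isConsistent_iff_exists D₀ D D').1 hH
  exact (isConsistent_iff_exists D₀ D D').2 ⟨fun θ => h (mulForm f θ), fun p S θ => hh p S _⟩

/-- The consistent homomorphisms form a direct summand as soon as the homomorphisms of bounded order
on functionals of order zero do. -/
theorem exists_isCompl_consistent (m : Module (Fn n M) (HomSec D₀ D D' r k s j))
    (m₀ : Module (Fn n M) (HomSec D₀ D D' 0 k s j))
    (hR : ∀ (f : Fn n M) (H : HomSec D₀ D D' r k s j),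
      restrict D₀ D D' (f • H) = f • restrict D₀ D D' H)
    (hQ : ∀ t, ∃ Q Q' : Submodule (Fn n M) (HomSec D₀ D D' 0 k s j), IsCompl Q Q' ∧
      ∀ G, G ∈ Q ↔ ∀ p S, (G.1 p S).1 ∈ Ult D₀ D' t j p)
    {N : Submodule (Fn n M) (HomSec D₀ D D' r k s j)}
    (hN : ∀ H, H ∈ N ↔ IsConsistent D₀ D D' H.1) : ∃ N', IsCompl N N' := by
  rcases Nat.eq_zero_or_pos n with hn | hn
  · have : N = ⊤ := eq_top_iff.2 fun H _ => (hN H).2 (isConsistent_of_eq_zero D₀ D D' hn H)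
    exact ⟨⊥, this ▸ isCompl_top_bot⟩
  rcases lt_or_ge s r with hsr | hrs
  · have : N = ⊥ := eq_bot_iff.2 fun H hH => eq_zero_of_lt D₀ D D' hn hsr ((hN H).1 hH)
    exact ⟨⊤, this ▸ isCompl_bot_top⟩
  obtain ⟨Q, Q', hc, hQ⟩ := hQ (s + 1 - r)
  let R : HomSec D₀ D D' r k s j →ₗ[Fn n M] HomSec D₀ D D' 0 k s j :=
    { toFun := restrict D₀ D D'
      map_add' := fun _ _ => rfl
      map_smul' := hR }
  -- Restriction maps the consistent homomorphisms bijectively onto those out of order zero whose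
  -- values have order at most `s - r`.
  refine exists_isCompl_of_bijOn R N hc ⟨fun H hH => ?_, fun G hG H hH h => ?_, fun G hG => ?_⟩
  · exact (hQ _).2 (restrict_mem_Ult D₀ D D' hn ((hN H).1 hH))
  · exact eq_of_restrict_eq D₀ D D' ((hN G).1 hG) ((hN H).1 hH) h
  · obtain ⟨H, hH, rfl⟩ := exists_isConsistent_restrict_eq D₀ D D' hrs ((hQ G).1 hG)
    exact ⟨H, (hN H).2 hH, rfl⟩

theorem mem_filt_homCoords_iff (m : Module (Fn n M) (HomSec D₀ D D' r k s j))
    (hdeg hm) {t : ℕ} {G : HomSec D₀ D D' r k s j} :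
    G ∈ (homCoords D₀ D D' m (fun x => x.1.1.1) hdeg hm).filt t ↔
      ∀ p S, (G.1 p S).1 ∈ Ult D₀ D' t j p := by
  rw [GradedCoords.mem_filt]
  exact ⟨fun h p => (hcoord_eq_zero_iff_mem_Ult D₀ D D' (mem_dom₂_self p)).1
    (h p p (mem_dom₂_self p)), fun h p _ hp => (hcoord_eq_zero_iff_mem_Ult D₀ D D' hp).2 (h p)⟩

/-- The complement is taken for the target-order grading `preCoordsZero`, since the source-order
grading of `preCoords` would not exhibit the relevant submodule as a filtration step. -/
theorem exists_isCompl_consistent_pre [SecondCountableTopology M] (r k s j : ℕ) :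
    letI := preModule D₀ D D' r k s j
    ∃ N : Submodule (Fn n M) (HomSec D₀ D D' r k s j),
      (∀ H, H ∈ N ↔ IsConsistent D₀ D D' H.1) ∧ ∃ N', IsCompl N N' := by
  refine ⟨consistentSubmodule D₀ D D' (preModule D₀ D D' r k s j) fun f H => isConsistent_comp_corner D₀ D D' f,
    fun _ => Iff.rfl, ?_⟩
  refine exists_isCompl_consistent D₀ D D' (preModule D₀ D D' r k s j) (preModule D₀ D D' 0 k s j)
    (fun _ _ => rfl) (fun t => ?_) fun _ => Iff.rfl
  obtain ⟨Q', hQ⟩ := @GradedCoords.exists_isCompl_filt _ _ _ _ _ _ (preModule D₀ D D' 0 k s j) _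
    (preCoordsZero D₀ D D' k s j) _ _ _ _ t
  exact ⟨_, Q', hQ, fun _ => mem_filt_homCoords_iff D₀ D D' (preModule D₀ D D' 0 k s j) _ _⟩

theorem exists_isCompl_consistent_post [SecondCountableTopology M] (r k s j : ℕ) :
    letI := postModule D₀ D D' r k s j
    ∃ N : Submodule (Fn n M) (HomSec D₀ D D' r k s j),
      (∀ H, H ∈ N ↔ IsConsistent D₀ D D' H.1) ∧ ∃ N', IsCompl N N' := by
  refine ⟨consistentSubmodule D₀ D D' (postModule D₀ D D' r k s j) fun f H => isConsistent_corner_comp D₀ D D' f,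
    fun _ => Iff.rfl, ?_⟩
  refine exists_isCompl_consistent D₀ D D' (postModule D₀ D D' r k s j) (postModule D₀ D D' 0 k s j)
    (fun _ _ => rfl) (fun t => ?_) fun _ => Iff.rfl
  obtain ⟨Q', hQ⟩ := @GradedCoords.exists_isCompl_filt _ _ _ _ _ _ (postModule D₀ D D' 0 k s j) _
    (postCoords D₀ D D' 0 k s j) _ _ _ _ t
  exact ⟨_, Q', hQ, fun _ => mem_filt_homCoords_iff D₀ D D' (postModule D₀ D D' 0 k s j) _ _⟩

end Consistent

end UBundle

end

/-! ### The main theorem. -/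

open UBundle in
theorem mainTheorem10 {n d d' : ℕ}
    {M : Type*} [TopologicalSpace M] [T2Space M] [SecondCountableTopology M]
    [ChartedSpace (Rn n) M] [IsManifold (𝓡 n) ∞ M]
    {E : M → Type*} [TopologicalSpace (TotalSpace (Rn d) E)]
    [∀ x, AddCommGroup (E x)] [∀ x, Module ℝ (E x)] [∀ x, TopologicalSpace (E x)]
    [∀ x, IsTopologicalAddGroup (E x)] [∀ x, ContinuousSMul ℝ (E x)]
    [FiberBundle (Rn d) E] [VectorBundle ℝ (Rn d) E] [ContMDiffVectorBundle ∞ (Rn d) E (𝓡 n)]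
    {F : M → Type*} [TopologicalSpace (TotalSpace (Rn d') F)]
    [∀ x, AddCommGroup (F x)] [∀ x, Module ℝ (F x)] [∀ x, TopologicalSpace (F x)]
    [∀ x, IsTopologicalAddGroup (F x)] [∀ x, ContinuousSMul ℝ (F x)]
    [FiberBundle (Rn d') F] [VectorBundle ℝ (Rn d') F] [ContMDiffVectorBundle ∞ (Rn d') F (𝓡 n)]
    (D₀ : CovariantDerivative (𝓡 n) (Rn n) (TangentSpace (𝓡 n) : M → Type _))
    [D₀.ContMDiffCovariantDerivative ∞] (_hD₀ : D₀.torsion = 0)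
    (D : CovariantDerivative (𝓡 n) (Rn d) E) [D.ContMDiffCovariantDerivative ∞]
    (D' : CovariantDerivative (𝓡 n) (Rn d') F) [D'.ContMDiffCovariantDerivative ∞]
    (r k s j : ℕ) :
    -- the sections of `𝒰_k^r(E)` with the action `f⌟`
    (∃ _ : Module (Fn n M) (USec D₀ D r k),
      (∀ (f : Fn n M) (T : USec D₀ D r k) (p : M), (f • T).1 p = corner D₀ D f p (T.1 p)) ∧
      Module.Finite (Fn n M) (USec D₀ D r k) ∧
      Module.Projective (Fn n M) (USec D₀ D r k)) ∧
    -- the sections of `Hom(𝒰_k^r(E), 𝒰_j^s(F))` with the action by precomposition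
    (∃ _ : Module (Fn n M) (HomSec D₀ D D' r k s j),
      (∀ (f : Fn n M) (H : HomSec D₀ D D' r k s j) (p : M),
        (f • H).1 p = H.1 p ∘ₗ corner D₀ D f p) ∧
      Module.Finite (Fn n M) (HomSec D₀ D D' r k s j) ∧
      Module.Projective (Fn n M) (HomSec D₀ D D' r k s j) ∧
      ∃ N : Submodule (Fn n M) (HomSec D₀ D D' r k s j),
        (∀ H, H ∈ N ↔ IsConsistent D₀ D D' H.1) ∧ ∃ N', IsCompl N N') ∧
    -- the sections of `Hom(𝒰_k^r(E), 𝒰_j^s(F))` with the action by postcomposition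
    (∃ _ : Module (Fn n M) (HomSec D₀ D D' r k s j),
      (∀ (f : Fn n M) (H : HomSec D₀ D D' r k s j) (p : M),
        (f • H).1 p = corner D₀ D' f p ∘ₗ H.1 p) ∧
      Module.Finite (Fn n M) (HomSec D₀ D D' r k s j) ∧
      Module.Projective (Fn n M) (HomSec D₀ D D' r k s j) ∧
      ∃ N : Submodule (Fn n M) (HomSec D₀ D D' r k s j),
        (∀ H, H ∈ N ↔ IsConsistent D₀ D D' H.1) ∧ ∃ N', IsCompl N N') := by
  let m₁ := cornerModule D₀ D r k
  let m₂ := preModule D₀ D D' r k s j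
  let m₃ := postModule D₀ D D' r k s j
  have h₁ := @GradedCoords.finite_projective _ _ _ _ _ _ m₁ _ (uCoords D₀ D r k) _ _ _ _
  have h₂ := @GradedCoords.finite_projective _ _ _ _ _ _ m₂ _ (preCoords D₀ D D' r k s j) _ _ _ _
  have h₃ := @GradedCoords.finite_projective _ _ _ _ _ _ m₃ _ (postCoords D₀ D D' r k s j) _ _ _ _
  exact ⟨⟨m₁, fun _ _ _ => rfl, h₁⟩,
    ⟨m₂, fun _ _ _ => rfl, h₂.1, h₂.2, exists_isCompl_consistent_pre D₀ D D' r k s j⟩,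
    ⟨m₃, fun _ _ _ => rfl, h₃.1, h₃.2, exists_isCompl_consistent_post D₀ D D' r k s j⟩⟩
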